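/- Let $a,b\ge 2$ and $i\ge 0$ be integers and put $n=a+b+2i-2$, $N=n+2=a+b+2i$. **Objects.** * $\operatorname{Skyt}(a,i,b)$ is the set of standard Young tableaux of skew shape $[(i+1)^b,1^{a-2}]/[i^{\,b-2}]$ ($n$ cells; rows and columns increase and each of $1,\dots,n$ occurs once). * $\operatorname{Dyck}(m,\ell,s)$ is the set of Dyck paths of semi-length $m$ (words in $U,D$ with $m$ of each letter and at least as many $U$'s as $D$'s in every prefix) with $\ell$ long ascents (maximal ascents of length at least $2$) and $s$ singletons (maximal ascents of length $1$), in which no singleton occurs after the last long ascent. * A triangulation of the $m$-gon with vertices $1,\dots,m$ in counter-clockwise order is a set of $m-3$ pairwise non-crossing diagonals. Its fan decomposition is $(\mathcal F,\delta)$, where $\mathcal F=(F_1,\dots,F_k)$ is defined recursively: an edge has the empty sequence; otherwise the first fan consists of all triangles containing the vertex with the smallest label (its origin), and it is followed by the sequences of the triangulated polygons $T_1,T_2,\dots$ (taken in counter-clockwise order) that remain after this vertex and its edges are deleted. If $x_j$ is the origin of $F_j$, then $\delta=(x_2-x_1,\dots,x_k-x_{k-1})$. The size of a fan is its number of triangles,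 and it is singular if the size is $1$. $\operatorname{Tri}(m,t,s)$ is the set of triangulations of the $m$-gon with $s+t$ fans, of which exactly $s$ are singular, and with non-singular last fan. * For $\lambda\in\operatorname{Skyt}(a,i,b)$ let $X=\{x_1<\dots<x_{i+b-1}\}$ be the set of entries in the top $b-1$ rows. If $x_j$ is in one of the first $b-2$ rows, let $A_j=\{x_j\}$. If $x_j$ is in row $b-1$, let $y_j$ be the entry directly below it, and let $A_j=\{x_j\}\cup([y_j,y-1]\setminus X)$ if $y$ is the entry immediately to the right of $y_j$, and $A_j=\{x_j\}\cup([y_j,n]\setminus X)$ if there is no such entry. Let $\operatorname{Nom}(\lambda)=(A_1,\dots,A_{i+b-1})$. * A nomincreasing partition of $[n]$ is an ordered partition of $[n]$ into non-empty blocks with increasing minima such that all non-minimal elements of a block are smaller than all non-minimal elements of every later block. * For sequences $(x_1,\dots,x_t)$ of labels and $(u_1,\dots,u_t)$ of sizes, the greedy labelling from $[M]$ is the sequence of sets $(A_1,\dots,A_t)$ in which $A_j$ consists of $x_j$ and of $u_j-1$ further labels, these being taken in increasing order from $[M]\setminus\{x_1,\dots,x_t\}$, for $j=1,2,\dots,t$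 in turn, without repetition. **Theorem.** The map $\operatorname{Nom}$ is a bijection from $\operatorname{Skyt}(a,i,b)$ onto the set of nomincreasing partitions of $[n]$ with exactly $i+1$ blocks of size at least $2$, exactly $b-2$ blocks of size $1$, and last block of size at least $2$. Moreover there are bijections $$\mathtt{SD}:\operatorname{Skyt}(a,i,b)\to\operatorname{Dyck}(n,i+1,b-2),\qquad \mathtt{DT}:\operatorname{Dyck}(n,i+1,b-2)\to\operatorname{Tri}(N,i+1,b-2),$$ $$\mathtt{ST}=\mathtt{DT}\circ\mathtt{SD}:\operatorname{Skyt}(a,i,b)\to\operatorname{Tri}(N,i+1,b-2),$$ which, together with their inverses, are given explicitly as follows. 1. If $\operatorname{Nom}(\lambda)=(A_1,\dots,A_t)$ and $x_j=\min A_j$, then $\mathtt{SD}(\lambda)=U^{\#A_1}D^{x_2-x_1}U^{\#A_2}D^{x_3-x_2}\cdots U^{\#A_t}D^{\,n-x_t+x_1}$. 2. For $P=U^{u_1}D^{d_1}\cdots U^{u_t}D^{d_t}$ (all $u_j,d_j\geq 1$), $\mathtt{SD}^{-1}(P)$ is the unique $\lambda\in\operatorname{Skyt}(a,i,b)$ such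 that $\operatorname{Nom}(\lambda)$ is the greedy labelling from $[n]$ for the labels $x_j=1+d_1+\dots+d_{j-1}$ (the labels of the down steps at the peaks, if the down steps are numbered $1,\dots,n$ from left to right) and the sizes $u_j$. 3. For the same $P$, $\mathtt{DT}(P)$ is the unique triangulation in $\operatorname{Tri}(N,i+1,b-2)$ with fan sizes $(u_1,\dots,u_t)$ and $\delta=(d_1,\dots,d_{t-1})$. 4. If $C\in\operatorname{Tri}(N,i+1,b-2)$ has fans of sizes $u_1,\dots,u_t$ with origins $x_1,\dots,x_t$, then $\mathtt{DT}^{-1}(C)=U^{u_1}D^{x_2-x_1}\cdots U^{u_{t-1}}D^{x_t-x_{t-1}}U^{u_t}D^{d}$, where $d=(N-x_t+x_1)-2$ is the number of boundary edges from $x_t$ counter-clockwise to $x_1$, minus $2$. 5. $\mathtt{ST}(\lambda)$ is the unique triangulation in $\operatorname{Tri}(N,i+1,b-2)$ with fan sizes $(\#A_1,\dots,\#A_t)$ and $\delta=(x_2-x_1,\dots,x_t-x_{t-1})$, where $\operatorname{Nom}(\lambda)=(A_1,\dots,A_t)$ and $x_j=\min A_j$. 6. For $C$ as in 4, $\mathtt{ST}^{-1}(C)$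 is the unique $\lambda\in\operatorname{Skyt}(a,i,b)$ such that $\operatorname{Nom}(\lambda)$ is the greedy labelling from $[N]$ for the labels $x_j$ and the sizes $u_j$. -/

import Mathlib

namespace SkytDyckTri

/-! ## Lists of integers -/

/-- The list of consecutive differences `x₂ - x₁, x₃ - x₂, …` (used on increasing lists only). -/
def diffs (xs : List ℕ) : List ℕ := List.zipWith (fun x y => y - x) xs xs.tail

/-- Given a list of pairs `(x_j, u_j)` and a list `pool` of unused labels, the `j`th block receives
the label `x_j` together with the next `u_j - 1` labels from the pool, which are then used up. -/
def greedyBlocks : List (ℕ × ℕ) → List ℕ → List (Finset ℕ)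
  | [], _ => []
  | (x, u) :: rest, pool =>
      insert x (pool.take (u - 1)).toFinset :: greedyBlocks rest (pool.drop (u - 1))

/-- The greedy labelling with labels from `{1, …, N}`: the `j`th block has size `us_j` and contains
the prescribed label `xs_j`; the other labels are the smallest elements of `{1, …, N}` not in `xs`,
in increasing order, going through the blocks from left to right. -/
def greedyLabels (N : ℕ) (xs us : List ℕ) : List (Finset ℕ) :=
  greedyBlocks (xs.zip us) ((Finset.Icc 1 N \ xs.toFinset).sort (· ≤ ·))

/-- The word `U^{u₁} D^{d₁} U^{u₂} D^{d₂} ⋯`. -/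
def runWord (us ds : List ℕ) : List DyckStep :=
  (List.zipWith (fun u d => List.replicate u DyckStep.U ++ List.replicate d DyckStep.D)
    us ds).flatten

/-! ## Skew tableaux -/

/-- Standard Young tableaux of skew shape `lam / mu`. Cells are pairs (row, column), both counted
from `0`, and the function `entry` is normalised to be `0` outside of the diagram. -/
structure SkewSYT (lam mu : YoungDiagram) where
  entry : ℕ → ℕ → ℕ
  row_strict : ∀ r c c', c < c' → (r, c) ∈ lam.cells \ mu.cells →
    (r, c') ∈ lam.cells \ mu.cells → entry r c < entry r c'
  col_strict : ∀ r r' c, r < r' → (r, c) ∈ lam.cells \ mu.cells →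
    (r', c) ∈ lam.cells \ mu.cells → entry r c < entry r' c
  bijOn : Set.BijOn (fun x : ℕ × ℕ => entry x.1 x.2) (lam.cells \ mu.cells : Finset (ℕ × ℕ))
    (Set.Icc 1 (lam.cells \ mu.cells).card)
  zero_outside : ∀ r c, (r, c) ∉ lam.cells \ mu.cells → entry r c = 0

/-- The diagram of the partition `[(i+1)^b, 1^(a-2)]`. -/
def outerShape (a i b : ℕ) : YoungDiagram :=
  YoungDiagram.ofRowLens (List.replicate b (i + 1) ++ List.replicate (a - 2) 1) (by
    apply List.Pairwise.sortedGE
    rw [List.pairwise_append]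
    refine ⟨?_, ?_, ?_⟩
    · simp [List.pairwise_replicate]
    · simp [List.pairwise_replicate]
    · intro x hx y hy
      rw [List.eq_of_mem_replicate hx, List.eq_of_mem_replicate hy]
      omega)

/-- The diagram of the partition `[i^(b-2)]`. -/
def innerShape (i b : ℕ) : YoungDiagram :=
  YoungDiagram.ofRowLens (List.replicate (b - 2) i) (by
    apply List.Pairwise.sortedGE
    simp [List.pairwise_replicate])

/-- `Skyt(a, i, b)`, the tableaux of shape `[(i+1)^b, 1^(a-2)] / [i^(b-2)]`. -/
abbrev Skyt (a i b : ℕ) : Type := SkewSYT (outerShape a i b) (innerShape i b)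

section Nom

variable {a i b : ℕ}

/-- The set `X` of the entries in the top `b - 1` rows. -/
def topEntries (T : Skyt a i b) : Finset ℕ :=
  (((outerShape a i b).cells \ (innerShape i b).cells).filter (fun x => x.1 < b - 1)).image
    (fun x => T.entry x.1 x.2)

/-- The entries `x₁ < x₂ < ⋯` of the top `b - 1` rows, in increasing order. -/
def topList (T : Skyt a i b) : List ℕ := (topEntries T).sort (· ≤ ·)

/-- The block attached to an entry `x` of the top `b - 1` rows. If `x` is not in row `b - 1`
(rows counted from `1`), it is `{x}`. If `x` is in row `b - 1` and `y` is the entry directly below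
it, then the block consists of `x` and of the labels `z ∉ X` with `y ≤ z` which are smaller than the
right neighbour of `y`, if `y` has one. -/
def block (T : Skyt a i b) (x : ℕ) : Finset ℕ :=
  insert x ((Finset.Icc 1 (a + b + 2 * i - 2) \ topEntries T).filter (fun z =>
    ∃ c ≤ i, T.entry (b - 2) c = x ∧ T.entry (b - 1) c ≤ z ∧
      (c < i → z < T.entry (b - 1) (c + 1))))

/-- The sequence `Nom(T) = (A₁, A₂, …)`. -/
def nom (T : Skyt a i b) : List (Finset ℕ) := (topList T).map (block T)

end Nom

/-- Nomincreasing partitions of `{1, …, n}`: ordered partitions whose blocks have increasing minima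
and in which every non-minimal element of a block is smaller than every non-minimal element of any
later block. -/
def IsNomincreasing (n : ℕ) (A : List (Finset ℕ)) : Prop :=
  (∀ S ∈ A, S.Nonempty) ∧
  (∀ z, (∃ S ∈ A, z ∈ S) ↔ 1 ≤ z ∧ z ≤ n) ∧
  A.Pairwise (fun S S' => Disjoint S S' ∧ S.min < S'.min ∧
    ∀ u ∈ S, ∀ v ∈ S', (∃ s ∈ S, s < u) → (∃ s ∈ S', s < v) → u < v)

/-! ## Dyck paths -/

/-- The maximal blocks of equal consecutive steps of a Dyck path. -/
def runs (P : DyckWord) : List (List DyckStep) := P.toList.splitBy (fun s s' => decide (s = s'))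

/-- The lengths of the maximal ascents, from left to right. -/
def ascents (P : DyckWord) : List ℕ :=
  ((runs P).filter (fun r => decide (DyckStep.U ∈ r))).map List.length

/-- The lengths of the maximal descents, from left to right. -/
def descents (P : DyckWord) : List ℕ :=
  ((runs P).filter (fun r => decide (DyckStep.D ∈ r))).map List.length

/-- The labels of the down steps at the peaks, when the down steps are labelled `1, 2, …` from left
to right: the first down step of the `j`th descent has label `1 + d₁ + ⋯ + d_{j-1}`. -/
def peakLabels (P : DyckWord) : List ℕ := ((descents P).scanl (· + ·) 1).dropLast

/-- No entry equal to `1` of the list occurs after the last entry that is at least `2`. -/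
def NoSingletonAfterLastLong (u : List ℕ) : Prop :=
  ∀ j k : Fin u.length, 2 ≤ u.get j → (∀ j' : Fin u.length, j < j' → u.get j' < 2) →
    j < k → u.get k ≠ 1

/-- `Dyck(n, ℓ, s)`: the Dyck paths of semi-length `n` with `ℓ` long ascents and `s` singletons in
which no singleton occurs after the last long ascent. -/
def Dyck (n ℓ s : ℕ) : Type :=
  {P : DyckWord // P.semilength = n ∧
    (ascents P).countP (fun u => decide (2 ≤ u)) = ℓ ∧
    (ascents P).count 1 = s ∧
    NoSingletonAfterLastLong (ascents P)}

/-! ## Triangulations -/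

/-- Dissections of the polygon with vertices `1, …, n` in counter-clockwise order: sets of chords
`(u, v)`, `u < v`, between non-adjacent vertices, no two of which cross. -/
def IsDissection (n : ℕ) (C : Finset (ℕ × ℕ)) : Prop :=
  (∀ e ∈ C, 1 ≤ e.1 ∧ e.1 + 1 < e.2 ∧ e.2 ≤ n ∧ e ≠ (1, n)) ∧
  ∀ e ∈ C, ∀ f ∈ C, ¬ (e.1 < f.1 ∧ f.1 < e.2 ∧ e.2 < f.2)

/-- Triangulations of the `n`-gon (`n ≥ 3`): dissections with `n - 3` chords. -/
def IsTriangulation (n : ℕ) (C : Finset (ℕ × ℕ)) : Prop :=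
  IsDissection n C ∧ C.card + 3 = n

/-- The edges `(u, v)`, `u < v`, of a dissected polygon: its boundary edges and its chords. -/
def edges (n : ℕ) (C : Finset (ℕ × ℕ)) : Finset (ℕ × ℕ) :=
  (Finset.Ico 1 n).image (fun u => (u, u + 1)) ∪ {(1, n)} ∪ C

/-- A fan: a collection of triangles (given by their vertex sets) with a common vertex. -/
structure Fan where
  origin : ℕ
  triangles : Finset (Finset ℕ)

/-- The number of triangles of a fan. -/
def Fan.size (F : Fan) : ℕ := F.triangles.card

/-- The triangles of the triangulated polygon with edge set `E` restricted to the vertices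
`p, …, q`. -/
def trianglesBetween (E : Finset (ℕ × ℕ)) (p q : ℕ) : Finset (Finset ℕ) :=
  ((Finset.Icc p q).powersetCard 3).filter (fun t => ∀ u ∈ t, ∀ v ∈ t, u < v → (u, v) ∈ E)

/-- The fan at `p` in the triangulated polygon with vertices `p, …, q`: all triangles that
contain `p`. -/
def fanAt (E : Finset (ℕ × ℕ)) (p q : ℕ) : Fan where
  origin := p
  triangles := (trianglesBetween E p q).filter (fun t => p ∈ t)

/-- The neighbours of `p` among `p + 1, …, q`, in increasing order. -/
def nbrs (E : Finset (ℕ × ℕ)) (p q : ℕ) : List ℕ :=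
  ((Finset.Ioc p q).filter (fun v => (p, v) ∈ E)).sort (· ≤ ·)

theorem lt_of_mem_zip_nbrs {E : Finset (ℕ × ℕ)} {p q : ℕ} {w : ℕ × ℕ}
    (hw : w ∈ (nbrs E p q).zip (nbrs E p q).tail) (h : ¬ q ≤ p + 1) : w.2 - w.1 < q - p := by
  obtain ⟨u, v⟩ := w
  obtain ⟨hu, hv⟩ := List.of_mem_zip hw
  have hv' := List.mem_of_mem_tail hv
  simp only [nbrs, Finset.mem_sort, Finset.mem_filter, Finset.mem_Ioc] at hu hv'
  simp only
  omega

/-- The sequence of fans of the triangulated polygon with vertices `p, …, q` (where `p` and `q` are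
adjacent) and with edges taken from `E`. An edge has no fans. Otherwise the sequence starts with the
fan at the smallest vertex `p`. If `w₀ < w₁ < ⋯ < w_k` are the neighbours of `p`, then the deletion
of `p` leaves the triangulated polygons (or edges) `T_j` with vertices `w_{j-1}, …, w_j`, and their
sequences of fans follow in this order. -/
def fanSeq (E : Finset (ℕ × ℕ)) (p q : ℕ) : List Fan :=
  if h : q ≤ p + 1 then [] else
    fanAt E p q ::
      ((nbrs E p q).zip (nbrs E p q).tail).attach.flatMap (fun w => fanSeq E w.1.1 w.1.2)
termination_by q - p
decreasing_by exact lt_of_mem_zip_nbrs w.2 h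

/-- The sequence of fans of a triangulation of the `n`-gon with set of chords `C`. -/
def fans (n : ℕ) (C : Finset (ℕ × ℕ)) : List Fan := fanSeq (edges n C) 1 n

/-- The origins of the fans. -/
def origins (n : ℕ) (C : Finset (ℕ × ℕ)) : List ℕ := (fans n C).map Fan.origin

/-- The sizes of the fans. -/
def fanSizes (n : ℕ) (C : Finset (ℕ × ℕ)) : List ℕ := (fans n C).map Fan.size

/-- The second sequence of the fan decomposition: the differences of consecutive origins. -/
def fanDelta (n : ℕ) (C : Finset (ℕ × ℕ)) : List ℕ := diffs (origins n C)

/-- `Tri(n, t, s)`: the triangulations of the `n`-gon with `s + t` fans, of which exactly `s` are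
singular, and whose last fan is not singular. -/
def Tri (n t s : ℕ) : Type :=
  {C : Finset (ℕ × ℕ) // IsTriangulation n C ∧
    (fans n C).length = s + t ∧
    (fanSizes n C).count 1 = s ∧
    ∃ F ∈ (fans n C).getLast?, F.size ≠ 1}

/-! ## The words of the Dyck paths attached to tableaux and to triangulations -/

/-- `U^{a₁} D^{x₂-x₁} U^{a₂} D^{x₃-x₂} ⋯ U^{a_t} D^{n-x_t+x₁}` with `a_j = #A_j`, where
`Nom(T) = (A₁, …, A_t)`, `x_j = min A_j` and `n = a + b + 2i - 2` is the number of cells. -/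
def wordOfSkyt {a i b : ℕ} (T : Skyt a i b) : List DyckStep :=
  runWord ((nom T).map Finset.card)
    (diffs (topList T) ++
      [a + b + 2 * i - 2 - (topList T).getLastD 0 + (topList T).headD 0])

/-- `U^{u₁} D^{d₁} ⋯ U^{u_m} D^{d_m}`, where `u_j` are the sizes of the fans, `d_j` with `j < m` are
the differences of consecutive origins, and `d_m` is the number `n - x_m + x₁` of boundary edges
from the last origin `x_m` counter-clockwise to the first origin `x₁`, minus `2`. -/
def wordOfTri (n : ℕ) (C : Finset (ℕ × ℕ)) : List DyckStep :=
  runWord (fanSizes n C)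
    (fanDelta n C ++ [n - (origins n C).getLastD 0 + (origins n C).headD 0 - 2])

end SkytDyckTri

open SkytDyckTri

namespace SkytDyckTri

/-! ## Increasing lists and their differences -/

/-! All three families are encoded by one object: a code, that is, a function f on {1, …, n} with
f(1) + ⋯ + f(k) ≥ k for every k ≤ n and total sum n. Its support is the list of labels x_j and its
non-zero values are the sizes u_j. A code is determined by these two lists, and since its support
starts with 1, also by the sizes and the differences of the labels. SD, DT and ST are composed from
three bijections onto `codeSet`. Hence ST = DT ∘ SD holds by cancellation, and every explicit
description reduces to an equality of codes.

Dyck paths: f(v) is the number of up steps immediately before the vth down step. A path is lowest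
immediately after its down steps, so the code inequality is the Dyck condition. As long as there is
a long ascent, "no singleton after the last long ascent" says that the last non-zero value is at
least 2.

Nomincreasing partitions: f(v) is the size of the block with minimum v, if there is one. Blocks with
minimum at most k cover 1, …, k, which is the code inequality. Conversely, the non-minimal labels
increase when read block by block, so the partition is the greedy labelling of its minima and sizes
(`IsNomincreasing.greedyLabels_eq`). The code inequality guarantees that the greedy procedure never
adds to a block a label below its prescribed one (`IsCode.feasible_aux`).

Tableaux: the blocks of size 1 give the cells above row b - 1 (rows counted from 1). The smallest
and second smallest labels of the large blocks give rows b - 1 and b, and the remaining labels fill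
the leg. This inverts `nom`. The last block is large because the right end of row b - 1 carries the
largest entry of the top rows.

Triangulations: f(v) is one less than the number of larger neighbours of v, which is the size of the
fan at v. Let W be the walk with steps f(v) - 1. Non-crossing chords on m points number at most 2m -
3. A triangulation attains this bound, hence also attains it on either side of each edge. In terms
of W, an edge (p, w) therefore satisfies W(w) < W(v) for p < v < w and W(p) ≤ W(w) + 1 (`WalkEdge`).
Conversely, for any code these pairs do not cross, and since W falls by at most 1 per step, exactly
f(p) + 1 of them go up from p. Equality of cardinalities makes the two constructions inverse, and
the fan decomposition is read off by recursion (`map_fanSeq`). -/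

theorem eq_of_pairwise_lt {l₁ l₂ : List ℕ} (h₁ : l₁.Pairwise (· < ·)) (h₂ : l₂.Pairwise (· < ·))
    (h : ∀ x, x ∈ l₁ ↔ x ∈ l₂) : l₁ = l₂ := by
  refine List.Perm.eq_of_pairwise' (h₁.imp le_of_lt) (h₂.imp le_of_lt) ?_
  exact (List.perm_ext_iff_of_nodup (h₁.imp ne_of_lt) (h₂.imp ne_of_lt)).2 h

theorem sort_eq_of_pairwise_lt {s : Finset ℕ} {l : List ℕ} (hl : l.Pairwise (· < ·))
    (h : ∀ x, x ∈ s ↔ x ∈ l) : s.sort (· ≤ ·) = l :=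
  eq_of_pairwise_lt (Finset.sortedLT_sort s).pairwise hl (by simpa using h)

@[simp] theorem diffs_nil : diffs [] = [] := rfl

@[simp] theorem diffs_singleton (x : ℕ) : diffs [x] = [] := rfl

@[simp] theorem diffs_cons_cons (x y : ℕ) (l : List ℕ) :
    diffs (x :: y :: l) = (y - x) :: diffs (y :: l) := rfl

theorem length_diffs (l : List ℕ) : (diffs l).length = l.length - 1 := by
  simp [diffs]

theorem diffs_injective {x : ℕ} {l l' : List ℕ} (hl : (x :: l).Pairwise (· < ·))
    (hl' : (x :: l').Pairwise (· < ·)) (h : diffs (x :: l) = diffs (x :: l')) : l = l' := by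
  induction l generalizing x l' with
  | nil =>
    cases l' with
    | nil => rfl
    | cons y l' => simp at h
  | cons y l ih =>
    cases l' with
    | nil => simp at h
    | cons y' l' =>
      simp only [diffs_cons_cons, List.cons.injEq] at h
      have h1 : x < y := (List.pairwise_cons.1 hl).1 y (by simp)
      have h2 : x < y' := (List.pairwise_cons.1 hl').1 y' (by simp)
      obtain rfl : y = y' := by omega
      rw [ih (List.pairwise_cons.1 hl).2 (List.pairwise_cons.1 hl').2 h.2]

/-! ## Codes -/

/-- The functions that encode the Dyck paths of semi-length `n`: the value at `v` is the number of
up steps immediately before the `v`th down step. -/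
structure IsCode (n : ℕ) (f : ℕ → ℕ) : Prop where
  zero_of : ∀ v, (v = 0 ∨ n < v) → f v = 0
  le_sum : ∀ k ≤ n, k ≤ ∑ v ∈ Finset.range (k + 1), f v
  sum_eq : ∑ v ∈ Finset.range (n + 1), f v = n

/-- The support of a function on `{1, …, n}`, in increasing order. -/
def supp (n : ℕ) (f : ℕ → ℕ) : List ℕ := (List.range' 1 n).filter (fun v => decide (f v ≠ 0))

/-- The non-zero values of a function on `{1, …, n}`. -/
def vals (n : ℕ) (f : ℕ → ℕ) : List ℕ := (supp n f).map f

/-- The codes with `ℓ` values that are at least `2` and `s` values `1`, in which the last non-zero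
value is at least `2`. -/
def codeSet (n ℓ s : ℕ) : Set (ℕ → ℕ) :=
  {f | IsCode n f ∧ (vals n f).countP (fun u => decide (2 ≤ u)) = ℓ ∧ (vals n f).count 1 = s ∧
    ∃ u ∈ (vals n f).getLast?, 2 ≤ u}

theorem pairwise_supp (n : ℕ) (f : ℕ → ℕ) : (supp n f).Pairwise (· < ·) :=
  List.Pairwise.filter _ (List.pairwise_lt_range' 1)

theorem mem_supp {n : ℕ} {f : ℕ → ℕ} {v : ℕ} : v ∈ supp n f ↔ (1 ≤ v ∧ v ≤ n) ∧ f v ≠ 0 := by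
  simp [supp, List.mem_range'_1]
  omega

theorem length_vals (n : ℕ) (f : ℕ → ℕ) : (vals n f).length = (supp n f).length := by
  simp [vals]

theorem one_le_of_mem_vals {n : ℕ} {f : ℕ → ℕ} {u : ℕ} (hu : u ∈ vals n f) : 1 ≤ u := by
  simp only [vals, List.mem_map, mem_supp] at hu
  obtain ⟨v, hv, rfl⟩ := hu
  omega

namespace IsCode

variable {n : ℕ} {f g : ℕ → ℕ}

theorem mem_supp_iff (hf : IsCode n f) {v : ℕ} : v ∈ supp n f ↔ f v ≠ 0 := by
  rw [mem_supp]
  have := hf.zero_of v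
  constructor
  · exact fun h => h.2
  · intro h
    refine ⟨?_, h⟩
    by_contra h'
    exact h (this (by omega))

theorem one_mem_supp (hf : IsCode n f) (hn : 1 ≤ n) : 1 ∈ supp n f := by
  rw [hf.mem_supp_iff]
  have h := hf.le_sum 1 hn
  have h0 := hf.zero_of 0 (Or.inl rfl)
  simp [Finset.sum_range_succ] at h
  omega

theorem supp_eq_cons (hf : IsCode n f) (hn : 1 ≤ n) : ∃ l, supp n f = 1 :: l := by
  have h1 := hf.one_mem_supp hn
  have hp := pairwise_supp n f
  cases hs : supp n f with
  | nil => simp [hs] at h1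
  | cons x l =>
    have hx : x ∈ supp n f := by simp [hs]
    rw [hs] at h1 hp
    rw [List.pairwise_cons] at hp
    rcases List.mem_cons.1 h1 with h | h
    · exact ⟨l, by rw [← h]⟩
    · have := hp.1 1 h
      have := (mem_supp.1 hx).1
      omega

theorem ext_of_supp_vals (hf : IsCode n f) (hg : IsCode n g) (hs : supp n f = supp n g)
    (hv : vals n f = vals n g) : f = g := by
  funext v
  by_cases h : v ∈ supp n f
  · rw [vals, vals, ← hs] at hv
    exact List.map_inj_left.1 hv v h
  · have h' := h
    rw [hs] at h'
    rw [hf.mem_supp_iff, not_not] at h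
    rw [hg.mem_supp_iff, not_not] at h'
    rw [h, h']

/-- The code inequality at k = 1 puts 1 at the head of every support, so the differences already
determine the support. -/
theorem ext_of_diffs_vals (hf : IsCode n f) (hg : IsCode n g) (hn : 1 ≤ n)
    (hs : diffs (supp n f) = diffs (supp n g)) (hv : vals n f = vals n g) : f = g := by
  refine hf.ext_of_supp_vals hg ?_ hv
  obtain ⟨l, hl⟩ := hf.supp_eq_cons hn
  obtain ⟨l', hl'⟩ := hg.supp_eq_cons hn
  have h1 := pairwise_supp n f
  have h2 := pairwise_supp n g
  rw [hl] at h1 hs ⊢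
  rw [hl'] at h2 hs ⊢
  rw [diffs_injective h1 h2 hs]

theorem sum_vals (hf : IsCode n f) : (vals n f).sum = n := by
  conv_rhs => rw [← hf.sum_eq]
  rw [vals, ← List.sum_toFinset _ ((pairwise_supp n f).imp ne_of_lt)]
  refine Finset.sum_subset (fun v hv => ?_) (fun v _ hv => ?_)
  · rw [List.mem_toFinset, mem_supp] at hv
    rw [Finset.mem_range]
    omega
  · rwa [List.mem_toFinset, hf.mem_supp_iff, not_not] at hv

end IsCode

/-- The word `U^{u₁} D^{d₁} ⋯` of a code. -/
def codeWord (n : ℕ) (f : ℕ → ℕ) : List DyckStep :=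
  runWord (vals n f) (diffs (supp n f) ++ [n + 1 - (supp n f).getLastD 0])

/-! ## Triangulations -/

/-- A set of pairwise non-crossing chords on `m ≥ 2` points of a line has at most `2 m - 3`
elements. -/
theorem card_add_three_le_of_noncrossing {V : Finset ℕ} {E : Finset (ℕ × ℕ)} (hV : 2 ≤ V.card)
    (h₁ : ∀ e ∈ E, e.1 ∈ V ∧ e.2 ∈ V ∧ e.1 < e.2)
    (h₂ : ∀ e ∈ E, ∀ f ∈ E, ¬ (e.1 < f.1 ∧ f.1 < e.2 ∧ e.2 < f.2)) :
    E.card + 3 ≤ 2 * V.card := by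
  classical
  have hne : V.Nonempty := Finset.card_pos.1 (by omega)
  set M := V.max' hne
  set m := V.min' hne
  have hmM : m < M := Finset.min'_lt_max'_of_card V (by omega)
  have hM : ∀ x ∈ V, x ≤ M := fun x hx => V.le_max' x hx
  have hm : ∀ x ∈ V, m ≤ x := fun x hx => V.min'_le x hx
  -- Split the chords by whether they are the longest one from their left end. The longest ones are
  -- determined by their left end, which is not the maximum M: at most m - 1. The others are
  -- determined by their right end, which is neither M nor the minimum: at most m - 2. Indeed, if
  -- two chords share a right end and the inner one is not longest, a longer chord from its left end
  -- crosses the outer one.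
  have hcard := Finset.card_filter_add_card_filter_not (s := E)
    (fun e => ∀ f ∈ E, f.1 = e.1 → f.2 ≤ e.2)
  have hA : (E.filter (fun e => ∀ f ∈ E, f.1 = e.1 → f.2 ≤ e.2)).card ≤ (V.erase M).card := by
    refine Finset.card_le_card_of_injOn Prod.fst ?_ ?_
    · intro e he
      have he := (Finset.mem_filter.1 he).1
      obtain ⟨a, b, c⟩ := h₁ e he
      have := hM _ b
      simp only [Finset.coe_erase, Set.mem_sdiff, Finset.mem_coe, Set.mem_singleton_iff]
      exact ⟨a, by omega⟩
    · intro e he f hf hef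
      have he := Finset.mem_filter.1 he
      have hf := Finset.mem_filter.1 hf
      exact Prod.ext hef (le_antisymm (hf.2 e he.1 hef) (he.2 f hf.1 hef.symm))
  have hB : (E.filter (fun e => ¬ ∀ f ∈ E, f.1 = e.1 → f.2 ≤ e.2)).card
      ≤ ((V.erase M).erase m).card := by
    refine Finset.card_le_card_of_injOn Prod.snd ?_ ?_
    · intro e he
      have he := Finset.mem_filter.1 he
      obtain ⟨a, b, c⟩ := h₁ e he.1
      have h := he.2
      push Not at h
      obtain ⟨f, hf, h3, h4⟩ := h
      have := hM _ (h₁ f hf).2.1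
      have := hm _ a
      simp only [Finset.coe_erase, Set.mem_sdiff, Finset.mem_coe, Set.mem_singleton_iff]
      refine ⟨⟨b, by omega⟩, by omega⟩
    · have key : ∀ e ∈ E, ∀ f ∈ E, (¬ ∀ f' ∈ E, f'.1 = f.1 → f'.2 ≤ f.2) → e.2 = f.2 →
          ¬ e.1 < f.1 := by
        intro e he f hf h hef hlt
        push Not at h
        obtain ⟨f', hf', h3, h4⟩ := h
        have := (h₁ f hf).2.2
        exact h₂ e he f' hf' ⟨by omega, by omega, by omega⟩
      intro e he f hf hef
      have he := Finset.mem_filter.1 he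
      have hf := Finset.mem_filter.1 hf
      refine Prod.ext ?_ hef
      have a := key e he.1 f hf.1 hf.2 hef
      have b := key f hf.1 e he.1 he.2 hef.symm
      omega
  have hMV : M ∈ V := V.max'_mem hne
  have hmV : m ∈ V.erase M := Finset.mem_erase.2 ⟨hmM.ne, V.min'_mem hne⟩
  rw [Finset.card_erase_of_mem hmV, Finset.card_erase_of_mem hMV] at hB
  rw [Finset.card_erase_of_mem hMV] at hA
  omega

theorem mem_edges {N : ℕ} {C : Finset (ℕ × ℕ)} {u v : ℕ} :
    (u, v) ∈ edges N C ↔ (1 ≤ u ∧ u < N ∧ v = u + 1) ∨ (u = 1 ∧ v = N) ∨ (u, v) ∈ C := by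
  simp only [edges, Finset.mem_union, Finset.mem_image, Finset.mem_Ico, Finset.mem_singleton,
    Prod.mk.injEq]
  constructor
  · rintro ((⟨x, hx, rfl, rfl⟩ | h) | h)
    · exact Or.inl ⟨hx.1, hx.2, rfl⟩
    · exact Or.inr (Or.inl h)
    · exact Or.inr (Or.inr h)
  · rintro (⟨h1, h2, rfl⟩ | h | h)
    · exact Or.inl (Or.inl ⟨u, ⟨h1, h2⟩, rfl, rfl⟩)
    · exact Or.inl (Or.inr h)
    · exact Or.inr h

/-- The number of larger neighbours of a vertex of a dissected polygon. -/
def upDeg (N : ℕ) (C : Finset (ℕ × ℕ)) (v : ℕ) : ℕ :=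
  ((Finset.Ioc v N).filter (fun w => (v, w) ∈ edges N C)).card

/-- The code of a triangulation. -/
def triCode (N : ℕ) (C : Finset (ℕ × ℕ)) (v : ℕ) : ℕ := upDeg N C v - 1

/-! ### Counting the edges of a dissection by their smaller end points. -/

section Dissection

variable {N : ℕ} {C : Finset (ℕ × ℕ)}

theorem IsDissection.lt_of_mem_edges (hC : IsDissection N C) (hN : 2 ≤ N) {u v : ℕ}
    (h : (u, v) ∈ edges N C) : 1 ≤ u ∧ u < v ∧ v ≤ N := by
  rw [mem_edges] at h
  rcases h with h | h | h
  · omega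
  · omega
  · have := hC.1 _ h
    simp only at this
    omega

theorem IsDissection.noncrossing (hC : IsDissection N C) (hN : 2 ≤ N) {u v u' v' : ℕ}
    (h : (u, v) ∈ edges N C) (h' : (u', v') ∈ edges N C) : ¬ (u < u' ∧ u' < v ∧ v < v') := by
  rintro ⟨h1, h2, h3⟩
  have a := hC.lt_of_mem_edges hN h
  have b := hC.lt_of_mem_edges hN h'
  rw [mem_edges] at h h'
  rcases h with h | h | h
  · omega
  · omega
  · rcases h' with h' | h' | h'
    · omega
    · omega
    · exact hC.2 _ h _ h' ⟨h1, h2, h3⟩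

theorem IsDissection.card_edges (hC : IsDissection N C) (hN : 3 ≤ N) :
    (edges N C).card = N + C.card := by
  rw [edges, Finset.card_union_of_disjoint, Finset.card_union_of_disjoint,
    Finset.card_image_of_injective _ (fun x y h => (Prod.mk.inj h).1), Nat.card_Ico,
    Finset.card_singleton]
  · omega
  · simp
    omega
  · rw [Finset.disjoint_right]
    rintro e he he'
    have := hC.1 e he
    simp only [Finset.mem_union, Finset.mem_image, Finset.mem_singleton] at he'
    rcases he' with ⟨x, -, rfl⟩ | h
    · simp at this
    · exact this.2.2.2 h

theorem IsDissection.card_filter_edges (hC : IsDissection N C) (hN : 2 ≤ N) (s t : ℕ) :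
    ((edges N C).filter (fun e => s ≤ e.1 ∧ e.1 < t)).card = ∑ v ∈ Finset.Ico s t, upDeg N C v := by
  rw [Finset.card_eq_sum_card_fiberwise (f := Prod.fst) (t := Finset.Ico s t)]
  · refine Finset.sum_congr rfl fun v hv => ?_
    rw [Finset.mem_Ico] at hv
    rw [upDeg]
    refine Finset.card_bij' (fun e _ => e.2) (fun w _ => (v, w)) ?_ ?_ ?_ ?_
    · rintro ⟨x, y⟩ h
      simp only [Finset.mem_filter] at h
      obtain ⟨⟨h1, -⟩, rfl⟩ := h
      have := hC.lt_of_mem_edges hN h1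
      simp only [Finset.mem_filter, Finset.mem_Ioc]
      exact ⟨⟨this.2.1, this.2.2⟩, h1⟩
    · intro w h
      simp only [Finset.mem_filter, Finset.mem_Ioc] at h ⊢
      exact ⟨⟨h.2, hv⟩, trivial⟩
    · rintro ⟨x, y⟩ h
      simp only [Finset.mem_filter] at h
      rw [← h.2]
    · intro w h
      rfl
  · intro e he
    have := (Finset.mem_filter.1 he).2
    simpa using this

/-- The side (v, v + 1) is always present. Hence the truncated subtraction in `triCode` is exact at
every vertex except the last. -/
theorem one_le_upDeg {v : ℕ} (h1 : 1 ≤ v) (h2 : v < N) :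
    1 ≤ upDeg N C v := by
  rw [upDeg, Nat.one_le_iff_ne_zero, ← Nat.pos_iff_ne_zero, Finset.card_pos]
  exact ⟨v + 1, Finset.mem_filter.2 ⟨Finset.mem_Ioc.2 ⟨by omega, h2⟩,
    mem_edges.2 (Or.inl ⟨h1, h2, rfl⟩)⟩⟩

theorem IsDissection.upDeg_eq_zero (hC : IsDissection N C) (hN : 2 ≤ N) {v : ℕ}
    (h : v = 0 ∨ N ≤ v) : upDeg N C v = 0 := by
  rw [upDeg, Finset.card_eq_zero, Finset.filter_eq_empty_iff]
  intro w _ h'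
  have := hC.lt_of_mem_edges hN h'
  omega

/-- The edges between the vertices `v, …, w` with smaller end point less than `w`, if no other edge
starts at one of these. -/
theorem IsDissection.sum_upDeg_add_three_le (hC : IsDissection N C) (hN : 2 ≤ N) {v w : ℕ}
    (hvw : v < w) (h : ∀ x y, (x, y) ∈ edges N C → v ≤ x → x < w → y ≤ w) :
    ∑ k ∈ Finset.Ico v w, upDeg N C k + 3 ≤ 2 * (w + 1 - v) := by
  rw [← hC.card_filter_edges hN, ← Nat.card_Icc]
  apply card_add_three_le_of_noncrossing
  · rw [Nat.card_Icc]; omega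
  · rintro ⟨x, y⟩ he
    simp only [Finset.mem_filter] at he
    have h1 := hC.lt_of_mem_edges hN he.1
    have := h _ _ he.1 he.2.1 he.2.2
    simp only [Finset.mem_Icc]
    omega
  · rintro ⟨x, y⟩ he ⟨x', y'⟩ he'
    exact hC.noncrossing hN (Finset.mem_filter.1 he).1 (Finset.mem_filter.1 he').1

end Dissection

/-! ### Edge counts on the two sides of an edge of a triangulation. -/

section Triangulation

variable {N : ℕ} {C : Finset (ℕ × ℕ)}

theorem IsTriangulation.three_le (hC : IsTriangulation N C) : 3 ≤ N := by
  have := hC.2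
  omega

theorem IsTriangulation.card_edges (hC : IsTriangulation N C) : (edges N C).card + 3 = 2 * N := by
  have := hC.2
  rw [hC.1.card_edges hC.three_le]
  omega

theorem IsTriangulation.sum_upDeg (hC : IsTriangulation N C) :
    ∑ k ∈ Finset.Ico 1 N, upDeg N C k + 3 = 2 * N := by
  have hN := hC.three_le
  rw [← hC.card_edges, ← hC.1.card_filter_edges (by omega)]
  congr 2
  rw [Finset.filter_true_of_mem]
  rintro ⟨x, y⟩ h
  have := hC.1.lt_of_mem_edges (by omega) h
  simp only
  omega

/-- At least `2 m - 3` edges join the `m` vertices `p, …, w` on one side of an edge `(p, w)`. -/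
theorem IsTriangulation.le_sum_upDeg (hC : IsTriangulation N C) {p w : ℕ}
    (h : (p, w) ∈ edges N C) : 2 * (w - p) ≤ ∑ k ∈ Finset.Ico p w, upDeg N C k + 1 := by
  have hN := hC.three_le
  have hpw := hC.1.lt_of_mem_edges (by omega) h
  have hcard := Finset.card_filter_add_card_filter_not (s := edges N C)
    (fun e => p ≤ e.1 ∧ e.1 < w ∧ e.2 ≤ w)
  have h1 : ((edges N C).filter (fun e => p ≤ e.1 ∧ e.1 < w ∧ e.2 ≤ w)).card ≤
      ∑ k ∈ Finset.Ico p w, upDeg N C k := by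
    rw [← hC.1.card_filter_edges (by omega)]
    apply Finset.card_le_card
    intro e he
    simp only [Finset.mem_filter] at he ⊢
    exact ⟨he.1, he.2.1, he.2.2.1⟩
  -- An edge that is not contained in p, …, w cannot cross (p, w), so it lives on the vertices 1, …,
  -- p, w, …, N. The upper bound for these edges, subtracted from the exact total 2N - 3, leaves the
  -- lower bound for the inner side. The edge (p, w) belongs to both sides.
  have h2 : (insert (p, w) ((edges N C).filter
      (fun e => ¬ (p ≤ e.1 ∧ e.1 < w ∧ e.2 ≤ w)))).card + 3 ≤
      2 * (Finset.Icc 1 p ∪ Finset.Icc w N).card := by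
    have hsub : ∀ x y, (x, y) ∈ insert (p, w) ((edges N C).filter
      (fun e => ¬ (p ≤ e.1 ∧ e.1 < w ∧ e.2 ≤ w))) → (x, y) ∈ edges N C := by
      intro x y hxy
      rw [Finset.mem_insert, Finset.mem_filter] at hxy
      rcases hxy with hxy | hxy
      · rwa [hxy]
      · exact hxy.1
    apply card_add_three_le_of_noncrossing
    · rw [Nat.succ_le_iff, Finset.one_lt_card]
      exact ⟨p, by simp; omega, w, by simp; omega, by omega⟩
    · rintro ⟨x, y⟩ he
      have hxy := hC.1.lt_of_mem_edges (by omega) (hsub _ _ he)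
      have c1 := hC.1.noncrossing (by omega) h (hsub _ _ he)
      have c2 := hC.1.noncrossing (by omega) (hsub _ _ he) h
      simp only [Finset.mem_insert, Finset.mem_filter, Prod.mk.injEq] at he
      simp only [Finset.mem_union, Finset.mem_Icc]
      omega
    · rintro ⟨x, y⟩ he ⟨x', y'⟩ he'
      exact hC.1.noncrossing (by omega) (hsub _ _ he) (hsub _ _ he')
  rw [Finset.card_insert_of_notMem (by simp; omega), Finset.card_union_of_disjoint, Nat.card_Icc,
    Nat.card_Icc] at h2
  · have := hC.card_edges
    omega
  · rw [Finset.disjoint_left]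
    intro x hx hx'
    simp only [Finset.mem_Icc] at hx hx'
    omega

end Triangulation

/-! ### The walk of a code -/

/-- The walk with steps `f v - 1`. -/
def walk (f : ℕ → ℕ) (k : ℕ) : ℤ := ∑ v ∈ Finset.range k, (f v : ℤ) - k

theorem walk_succ (f : ℕ → ℕ) (k : ℕ) : walk f (k + 1) = walk f k + f k - 1 := by
  simp only [walk, Finset.sum_range_succ]
  push_cast
  ring

theorem walk_sub_walk (f : ℕ → ℕ) {v w : ℕ} (h : v ≤ w) :
    walk f w - walk f v = ∑ k ∈ Finset.Ico v w, (f k : ℤ) - (w - v) := by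
  rw [walk, walk, Finset.sum_Ico_eq_sub _ h]
  ring

/-- The edges of the triangulation with a given code. -/
def WalkEdge (f : ℕ → ℕ) (p w : ℕ) : Prop :=
  p < w ∧ (∀ v, p < v → v < w → walk f w < walk f v) ∧ walk f p ≤ walk f w + 1

theorem walkEdge_succ (f : ℕ → ℕ) (p : ℕ) : WalkEdge f p (p + 1) := by
  refine ⟨by omega, fun v h1 h2 => by omega, ?_⟩
  rw [walk_succ]
  omega

/-- A crossing would give W(v') < W(v) < W(u'), a drop of at least 2 from u' to v', whereas a walk
edge permits a drop of at most 1 between its ends. -/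
theorem WalkEdge.noncrossing {f : ℕ → ℕ} {u v u' v' : ℕ} (h : WalkEdge f u v)
    (h' : WalkEdge f u' v') : ¬ (u < u' ∧ u' < v ∧ v < v') := by
  rintro ⟨h1, h2, h3⟩
  have a := h.2.1 u' h1 h2
  have b := h'.2.1 v h2 h3
  have c := h'.2.2
  omega

theorem WalkEdge.walk_le {f : ℕ → ℕ} {p w : ℕ} (h : WalkEdge f p w) :
    walk f w ≤ walk f (p + 1) := by
  rcases Nat.lt_or_ge (p + 1) w with h' | h'
  · exact (h.2.1 _ (by omega) h').le
  · obtain rfl : w = p + 1 := by have := h.1; omega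
    rfl

/-- A walk edge to the first place where the walk reaches a given height. -/
theorem exists_walkEdge {f : ℕ → ℕ} {p q : ℕ} (hpq : p < q) {t : ℤ} (h1 : walk f p - 1 ≤ t)
    (h2 : t ≤ walk f (p + 1)) (h3 : walk f q ≤ t) :
    ∃ w, w ≤ q ∧ WalkEdge f p w ∧ walk f w = t := by
  classical
  have hex : ∃ w, p < w ∧ walk f w ≤ t := ⟨q, hpq, h3⟩
  have hs := Nat.find_spec hex
  have hmin : ∀ v, p < v → v < Nat.find hex → t < walk f v := by
    intro v hv hv'
    have := Nat.find_min hex hv'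
    push Not at this
    exact this hv
  have hle : Nat.find hex ≤ q := Nat.find_min' hex ⟨hpq, h3⟩
  generalize Nat.find hex = w at *
  -- The walk falls by at most 1 per step, so it cannot jump below t: the first place with height at
  -- most t has height exactly t.
  have heq : walk f w = t := by
    rcases Nat.lt_or_ge (p + 1) w with h' | h'
    · obtain ⟨x, rfl⟩ : ∃ x, w = x + 1 := ⟨w - 1, by omega⟩
      have := hmin x (by omega) (by omega)
      have := walk_succ f x
      omega
    · obtain rfl : w = p + 1 := by omega
      omega
  exact ⟨w, hle, ⟨hs.1, fun v hv hv' => by have := hmin v hv hv'; omega, by omega⟩, heq⟩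

open Classical in
/-- The number of walk edges that go up from `p`. -/
theorem card_walkEdge {f : ℕ → ℕ} {p q : ℕ} (hpq : p < q) (h : walk f q < walk f p) :
    ((Finset.Ioc p q).filter (fun w => WalkEdge f p w)).card = f p + 1 := by
  have h1 := walk_succ f p
  -- The edges from p correspond to the heights of their right ends: each height from W(p) - 1 to
  -- W(p + 1) = W(p) + f(p) - 1 is attained by exactly one, at the first place after p with this
  -- height.
  have : f p + 1 = (Finset.Icc (walk f p - 1) (walk f (p + 1))).card := by
    rw [Int.card_Icc]
    omega
  rw [this]
  refine Finset.card_bij (fun w _ => walk f w) ?_ ?_ ?_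
  · intro w hw
    simp only [Finset.mem_filter] at hw
    have := hw.2.walk_le
    have := hw.2.2.2
    rw [Finset.mem_Icc]
    omega
  · intro w hw w' hw' heq
    simp only [Finset.mem_filter, Finset.mem_Ioc] at hw hw'
    by_contra hne
    rcases Nat.lt_or_gt_of_ne hne with h | h
    · have := hw'.2.2.1 w hw.1.1 h
      omega
    · have := hw.2.2.1 w' hw'.1.1 h
      omega
  · intro t ht
    rw [Finset.mem_Icc] at ht
    obtain ⟨w, hw1, hw2, hw3⟩ := exists_walkEdge (f := f) hpq ht.1 ht.2 (by omega)
    exact ⟨w, by simp [hw1, hw2, hw2.1], hw3⟩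

/-! ### From codes to triangulations. -/

section CodeToTri

variable {n : ℕ} {f : ℕ → ℕ}

/-- This is the code inequality, shifted by one place. Together with the final drop to -2 in
`IsCode.walk_last`, it makes n + 2 the strict minimum of the walk on 1, …, n + 2, so that every
height needed for an edge from an earlier vertex is reached inside the polygon. -/
theorem IsCode.neg_one_le_walk (hf : IsCode n f) {k : ℕ} (h1 : 1 ≤ k) (h2 : k ≤ n + 1) :
    -1 ≤ walk f k := by
  obtain ⟨k, rfl⟩ : ∃ x, k = x + 1 := ⟨k - 1, by omega⟩
  have := hf.le_sum k (by omega)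
  rw [walk, ← Nat.cast_sum]
  push_cast [-Nat.cast_sum]
  omega

theorem IsCode.walk_last (hf : IsCode n f) : walk f (n + 2) = -2 := by
  have := hf.sum_eq
  rw [walk_succ, walk, ← Nat.cast_sum, hf.zero_of (n + 1) (Or.inr (by omega))]
  push_cast [-Nat.cast_sum]
  omega

theorem IsCode.walk_one (hf : IsCode n f) : walk f 1 = -1 := by
  simp [walk, hf.zero_of 0 (Or.inl rfl)]

open Classical in
/-- The chords of the triangulation with a given code. -/
noncomputable def codeChords (n : ℕ) (f : ℕ → ℕ) : Finset (ℕ × ℕ) :=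
  (Finset.Icc 1 (n + 2) ×ˢ Finset.Icc 1 (n + 2)).filter
    (fun e => WalkEdge f e.1 e.2 ∧ e.1 + 1 < e.2 ∧ e ≠ (1, n + 2))

theorem mem_codeChords {e : ℕ × ℕ} : e ∈ codeChords n f ↔
    (1 ≤ e.1 ∧ e.2 ≤ n + 2) ∧ WalkEdge f e.1 e.2 ∧ e.1 + 1 < e.2 ∧ e ≠ (1, n + 2) := by
  simp only [codeChords, Finset.mem_filter, Finset.mem_product, Finset.mem_Icc]
  constructor
  · rintro ⟨h, h'⟩
    exact ⟨by omega, h'⟩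
  · rintro ⟨h, h'⟩
    exact ⟨by omega, h'⟩

theorem isDissection_codeChords : IsDissection (n + 2) (codeChords n f) := by
  refine ⟨fun e he => ?_, fun e he e' he' => ?_⟩
  · rw [mem_codeChords] at he
    exact ⟨he.1.1, he.2.2.1, he.1.2, he.2.2.2⟩
  · rw [mem_codeChords] at he he'
    exact he.2.1.noncrossing he'.2.1

theorem IsCode.walkEdge_one (hf : IsCode n f) : WalkEdge f 1 (n + 2) := by
  refine ⟨by omega, fun v h1 h2 => ?_, ?_⟩
  · have := hf.neg_one_le_walk h1.le (by omega)
    rw [hf.walk_last]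
    omega
  · rw [hf.walk_last, hf.walk_one]
    omega

/-- The sides (p, p + 1) and (1, n + 2) are themselves walk edges. Excluding them from the chords
and adding them back as sides therefore leaves exactly the walk edges inside 1, …, n + 2. -/
theorem IsCode.mem_edges_codeChords (hf : IsCode n f) {p w : ℕ} :
    (p, w) ∈ edges (n + 2) (codeChords n f) ↔ 1 ≤ p ∧ w ≤ n + 2 ∧ WalkEdge f p w := by
  rw [mem_edges, mem_codeChords]
  simp only [ne_eq, Prod.mk.injEq]
  constructor
  · rintro (⟨h1, h2, rfl⟩ | ⟨rfl, rfl⟩ | h)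
    · exact ⟨h1, by omega, walkEdge_succ f p⟩
    · exact ⟨le_rfl, le_rfl, hf.walkEdge_one⟩
    · exact ⟨h.1.1, h.1.2, h.2.1⟩
  · rintro ⟨h1, h2, h3⟩
    have := h3.1
    by_cases h4 : w = p + 1
    · left; omega
    by_cases h5 : p = 1 ∧ w = n + 2
    · right; left; exact h5
    · right; right
      exact ⟨⟨h1, h2⟩, h3, by omega, h5⟩

theorem IsCode.upDeg_codeChords (hf : IsCode n f) {p : ℕ} (h1 : 1 ≤ p) (h2 : p < n + 2) :
    upDeg (n + 2) (codeChords n f) p = f p + 1 := by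
  classical
  rw [← card_walkEdge (q := n + 2) h2, upDeg]
  · congr 1
    ext w
    simp only [Finset.mem_filter, Finset.mem_Ioc, hf.mem_edges_codeChords]
    constructor
    · rintro ⟨h, h'⟩
      exact ⟨h, h'.2.2⟩
    · rintro ⟨h, h'⟩
      exact ⟨h, h1, h.2, h'⟩
  · have := hf.neg_one_le_walk h1 (by omega)
    rw [hf.walk_last]
    omega

/-- Counting edges by their smaller end gives the sum of f(v) + 1 over v = 1, …, n + 1, that is 2n +
1. Subtracting the n + 2 sides leaves n - 1 chords. -/
theorem IsCode.isTriangulation_codeChords (hf : IsCode n f) (hn : 1 ≤ n) :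
    IsTriangulation (n + 2) (codeChords n f) := by
  have hD : IsDissection (n + 2) (codeChords n f) := isDissection_codeChords
  refine ⟨hD, ?_⟩
  have h1 := hD.card_filter_edges (by omega) 1 (n + 2)
  rw [Finset.filter_true_of_mem, hD.card_edges (by omega)] at h1
  · have h2 : ∑ v ∈ Finset.Ico 1 (n + 2), upDeg (n + 2) (codeChords n f) v =
        ∑ v ∈ Finset.Ico 1 (n + 2), (f v + 1) := by
      refine Finset.sum_congr rfl fun v hv => ?_
      rw [Finset.mem_Ico] at hv
      exact hf.upDeg_codeChords hv.1 hv.2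
    have h3 : ∑ v ∈ Finset.Ico 1 (n + 2), f v = n := by
      have := hf.sum_eq
      rw [Finset.sum_Ico_succ_top (by omega), hf.zero_of (n + 1) (Or.inr (by omega))]
      rw [Finset.sum_range_eq_add_Ico _ (by omega), hf.zero_of 0 (Or.inl rfl)] at this
      omega
    rw [h2, Finset.sum_add_distrib, h3] at h1
    simp at h1
    omega
  · rintro ⟨x, y⟩ h
    have := hD.lt_of_mem_edges (by omega) h
    simp only
    omega

theorem IsCode.triCode_codeChords (hf : IsCode n f) :
    triCode (n + 2) (codeChords n f) = f := by
  funext v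
  rw [triCode]
  by_cases h : 1 ≤ v ∧ v < n + 2
  · rw [hf.upDeg_codeChords h.1 h.2]
    omega
  · rw [isDissection_codeChords.upDeg_eq_zero (by omega) (by omega), hf.zero_of v (by omega)]

end CodeToTri

/-! ### From triangulations to codes. -/

section TriToCode

variable {n : ℕ} {C : Finset (ℕ × ℕ)}

/-- Each step of the walk is `upDeg` minus 2, so bounds on numbers of edges become bounds on
differences of heights. -/
theorem walk_triCode_sub {v w : ℕ} (h1 : 1 ≤ v)
    (h2 : v ≤ w) (h3 : w ≤ n + 2) :
    walk (triCode (n + 2) C) w - walk (triCode (n + 2) C) v =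
      ∑ k ∈ Finset.Ico v w, (upDeg (n + 2) C k : ℤ) - 2 * (w - v) := by
  rw [walk_sub_walk _ h2]
  have : ∑ k ∈ Finset.Ico v w, (triCode (n + 2) C k : ℤ) =
      ∑ k ∈ Finset.Ico v w, ((upDeg (n + 2) C k : ℤ) - 1) := by
    refine Finset.sum_congr rfl fun k hk => ?_
    rw [Finset.mem_Ico] at hk
    have := one_le_upDeg (N := n + 2) (C := C) (v := k) (by omega) (by omega)
    rw [triCode]
    omega
  rw [this, Finset.sum_sub_distrib]
  simp
  omega

/-- At most 2(n + 2 - k) - 3 edges join the vertices k + 1, …, n + 2. Since there are 2(n + 2) - 3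
edges in total, at least 2k have their smaller end among 1, …, k, and removing one per vertex leaves
at least k. -/
theorem IsTriangulation.isCode (hC : IsTriangulation (n + 2) C) :
    IsCode n (triCode (n + 2) C) := by
  have hz0 : ∀ v, (v = 0 ∨ n + 2 ≤ v) → triCode (n + 2) C v = 0 := by
    intro v hv
    rw [triCode, hC.1.upDeg_eq_zero (by omega) hv]
  -- The only larger neighbour of n + 1 is n + 2.
  have hl : triCode (n + 2) C (n + 1) = 0 := by
    have : upDeg (n + 2) C (n + 1) ≤ (Finset.Ioc (n + 1) (n + 2)).card := Finset.card_filter_le _ _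
    simp at this
    rw [triCode]
    omega
  have hz : ∀ v, (v = 0 ∨ n < v) → triCode (n + 2) C v = 0 := by
    intro v hv
    by_cases h : v = n + 1
    · rw [h, hl]
    · exact hz0 v (by omega)
  have hsum := hC.sum_upDeg
  have w1 : walk (triCode (n + 2) C) 1 = -1 := by simp [walk, hz 0 (Or.inl rfl)]
  refine ⟨hz, fun k hk => ?_, ?_⟩
  · have h1 := walk_triCode_sub (n := n) (C := C) (v := 1) (w := k + 1) le_rfl (by omega)
      (by omega)
    have h2 := hC.1.sum_upDeg_add_three_le (by omega) (v := k + 1) (w := n + 2) (by omega)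
      (fun x y h _ _ => (hC.1.lt_of_mem_edges (by omega) h).2.2)
    rw [← Finset.sum_Ico_consecutive _ (show 1 ≤ k + 1 by omega) (show k + 1 ≤ n + 2 by omega)]
      at hsum
    rw [w1, walk, ← Nat.cast_sum, ← Nat.cast_sum] at h1
    push_cast [-Nat.cast_sum] at h1
    omega
  · have h1 := walk_triCode_sub (n := n) (C := C) (v := 1) (w := n + 2) le_rfl (by omega)
      (by omega)
    rw [w1, walk_succ, walk, ← Nat.cast_sum, ← Nat.cast_sum, hl] at h1
    push_cast [-Nat.cast_sum] at h1
    omega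

/-- For v strictly between p and w, no edge starting in v, …, w - 1 passes beyond w, so there are at
most 2(w - v) - 1 of them and W falls from v to w. On the whole of p, …, w there are at least 2(w -
p) - 1 edges, so W falls by at most 1 from p to w. -/
theorem IsTriangulation.walkEdge_of_mem (hC : IsTriangulation (n + 2) C) {p w : ℕ}
    (h : (p, w) ∈ edges (n + 2) C) : WalkEdge (triCode (n + 2) C) p w := by
  have hpw := hC.1.lt_of_mem_edges (by omega) h
  refine ⟨hpw.2.1, fun v h1 h2 => ?_, ?_⟩
  · have h3 := walk_triCode_sub (n := n) (C := C) (v := v) (w := w) (by omega) (by omega)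
      (by omega)
    have h4 := hC.1.sum_upDeg_add_three_le (by omega) (v := v) (w := w) h2 (fun x y hxy hx hx' => by
      have := hC.1.noncrossing (by omega) h hxy
      omega)
    rw [← Nat.cast_sum] at h3
    omega
  · have h3 := walk_triCode_sub (n := n) (C := C) (v := p) (w := w) (by omega) (by omega)
      (by omega)
    have h4 := hC.le_sum_upDeg h
    rw [← Nat.cast_sum] at h3
    omega

/-- Every chord of C is a walk edge of its code, and both sets have n - 1 elements, so the inclusion
is an equality. -/
theorem IsTriangulation.codeChords_triCode (hC : IsTriangulation (n + 2) C) (hn : 1 ≤ n) :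
    codeChords n (triCode (n + 2) C) = C := by
  symm
  apply Finset.eq_of_subset_of_card_le
  · rintro ⟨p, w⟩ h
    rw [mem_codeChords]
    have h1 := hC.1.1 _ h
    have h2 : (p, w) ∈ edges (n + 2) C := mem_edges.2 (Or.inr (Or.inr h))
    exact ⟨⟨h1.1, h1.2.2.1⟩, hC.walkEdge_of_mem h2, h1.2.1, h1.2.2.2⟩
  · have h1 := hC.2
    have h2 := (hC.isCode.isTriangulation_codeChords hn).2
    omega

end TriToCode

/-! ### The fans of the triangulation of a code -/

theorem zip_tail_consecutive {l : List ℕ} (hl : l.Pairwise (· < ·)) {w : ℕ × ℕ}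
    (hw : w ∈ l.zip l.tail) :
    w.1 ∈ l ∧ w.2 ∈ l ∧ w.1 < w.2 ∧ ∀ u ∈ l, ¬ (w.1 < u ∧ u < w.2) := by
  induction l with
  | nil => simp at hw
  | cons x l ih =>
    cases l with
    | nil => simp at hw
    | cons y l =>
      have hl' := List.pairwise_cons.1 hl
      have hl'' := List.pairwise_cons.1 hl'.2
      simp only [List.tail_cons, List.zip_cons_cons, List.mem_cons] at hw
      rcases hw with rfl | hw
      · refine ⟨by simp, by simp, hl'.1 y (by simp), fun u hu => ?_⟩
        simp only [List.mem_cons] at hu ⊢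
        rcases hu with rfl | rfl | hu
        · omega
        · omega
        · have := hl''.1 u hu
          omega
      · obtain ⟨h1, h2, h3, h4⟩ := ih hl'.2 hw
        refine ⟨by simp [h1], by simp [h2], h3, fun u hu => ?_⟩
        rcases List.mem_cons.1 hu with rfl | hu
        · have := hl'.1 _ h1
          omega
        · exact h4 u hu

/-- G is additive on adjacent intervals, so the concatenation over consecutive pairs telescopes. The
default x of `getLastD` covers a one-element list, where both sides are empty. -/
theorem flatMap_zip_tail {α : Type*} {G : ℕ → ℕ → List α} (h0 : ∀ a, G a a = [])
    (hG : ∀ a b c, a ≤ b → b ≤ c → G a b ++ G b c = G a c) {x : ℕ} {l : List ℕ}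
    (hl : (x :: l).Pairwise (· < ·)) :
    ((x :: l).zip l).flatMap (fun w => G w.1 w.2) = G x (l.getLastD x) := by
  induction l generalizing x with
  | nil => simp [h0]
  | cons y l ih =>
    have hl' := List.pairwise_cons.1 hl
    rw [List.zip_cons_cons, List.flatMap_cons, ih hl'.2, List.getLastD_cons]
    refine hG _ _ _ (hl'.1 y (by simp)).le ?_
    rw [List.getLastD_eq_getLast?]
    rcases hlast : l.getLast? with _ | z
    · simp
    · exact ((List.pairwise_cons.1 hl'.2).1 z (List.mem_of_getLast? hlast)).le

/-- The non-zero values of `f` at the places `p, …, q - 1`, together with these places. -/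
def fanData (f : ℕ → ℕ) (p q : ℕ) : List (ℕ × ℕ) :=
  ((List.range' p (q - p)).filter (fun v => decide (f v ≠ 0))).map (fun v => (v, f v))

theorem fanData_append (f : ℕ → ℕ) (a b c : ℕ) (h1 : a ≤ b) (h2 : b ≤ c) :
    fanData f a b ++ fanData f b c = fanData f a c := by
  rw [fanData, fanData, fanData, ← List.map_append, ← List.filter_append]
  congr 2
  have h : c - a = (b - a) + (c - b) := by omega
  rw [h, ← List.range'_append_1]
  congr 2
  omega

section FanSeq

variable {n : ℕ} {f : ℕ → ℕ} {E : Finset (ℕ × ℕ)}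

theorem mem_nbrs {p q w : ℕ} : w ∈ nbrs E p q ↔ p < w ∧ w ≤ q ∧ (p, w) ∈ E := by
  simp [nbrs, and_assoc]

theorem pairwise_nbrs (p q : ℕ) : (nbrs E p q).Pairwise (· < ·) :=
  (Finset.sortedLT_sort _).pairwise

variable (hE : ∀ p w, (p, w) ∈ E ↔ 1 ≤ p ∧ w ≤ n + 2 ∧ WalkEdge f p w)

theorem exists_of_mem_fanAt {p q : ℕ} {t : Finset ℕ} (ht : t ∈ (fanAt E p q).triangles) :
    ∃ u w, p < u ∧ u < w ∧ w ≤ q ∧ t = {p, u, w} ∧ (p, u) ∈ E ∧ (p, w) ∈ E ∧ (u, w) ∈ E := by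
  simp only [fanAt, trianglesBetween, Finset.mem_filter, Finset.mem_powersetCard] at ht
  obtain ⟨⟨⟨h1, h2⟩, h3⟩, h4⟩ := ht
  have h5 : (t.erase p).card = 2 := by rw [Finset.card_erase_of_mem h4, h2]
  obtain ⟨u, w, huw, h6⟩ := Finset.card_eq_two.1 h5
  have ht : t = insert p {u, w} := by rw [← h6, Finset.insert_erase h4]
  wlog hlt : u < w generalizing u w
  · exact this w u huw.symm (by rw [h6, Finset.pair_comm]) (by rw [ht, Finset.pair_comm]) (by omega)
  have hu : u ∈ t.erase p := by simp [h6]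
  have hw : w ∈ t.erase p := by simp [h6]
  rw [Finset.mem_erase] at hu hw
  have hu' := Finset.mem_Icc.1 (h1 hu.2)
  have hw' := Finset.mem_Icc.1 (h1 hw.2)
  exact ⟨u, w, by omega, hlt, hw'.2, ht, h3 _ h4 _ hu.2 (by omega), h3 _ h4 _ hw.2 (by omega),
    h3 _ hu.2 _ hw.2 hlt⟩

-- A triangle {p, u, w} with p < u < w is determined by its largest vertex w: two different middle
-- vertices would give crossing edges. The possible w are the neighbours of p other than p + 1,
-- which accounts for the 1 in the count.
include hE in
theorem size_fanAt {p q : ℕ} (hp : 1 ≤ p) (hpq : p < q) (hq : q ≤ n + 2) :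
    (fanAt E p q).size + 1 = ((Finset.Ioc p q).filter (fun w => (p, w) ∈ E)).card := by
  have h1 : p + 1 ∈ (Finset.Ioc p q).filter (fun w => (p, w) ∈ E) := by
    simp only [Finset.mem_filter, Finset.mem_Ioc, hE]
    exact ⟨by omega, hp, by omega, walkEdge_succ f p⟩
  rw [← Finset.card_erase_add_one h1, Fan.size]
  congr 1
  -- The largest vertex is written as a `sup` so that the bijection is given by a function on sets.
  have hsup : ∀ u w, p < u → u < w → ({p, u, w} : Finset ℕ).sup id = w := by
    intro u w _ _
    simp only [Finset.sup_insert, Finset.sup_singleton, id]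
    omega
  refine Finset.card_bij (fun t _ => t.sup id) ?_ ?_ ?_
  · intro t ht
    obtain ⟨u, w, h2, h3, h4, rfl, h5, h6, h7⟩ := exists_of_mem_fanAt ht
    rw [hsup u w h2 h3, Finset.mem_erase, Finset.mem_filter, Finset.mem_Ioc]
    exact ⟨by omega, by omega, h6⟩
  · intro t ht t' ht' h
    obtain ⟨u, w, h2, h3, h4, rfl, h5, h6, h7⟩ := exists_of_mem_fanAt ht
    obtain ⟨u', w', h2', h3', h4', rfl, h5', h6', h7'⟩ := exists_of_mem_fanAt ht'
    rw [hsup u w h2 h3, hsup u' w' h2' h3'] at h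
    subst h
    rw [hE] at h5 h5' h7 h7'
    have c1 := h5.2.2.noncrossing h7'.2.2
    have c2 := h5'.2.2.noncrossing h7.2.2
    obtain rfl : u = u' := by omega
    rfl
  · intro w hw
    simp only [Finset.mem_erase, Finset.mem_filter, Finset.mem_Ioc, hE] at hw
    obtain ⟨hw1, ⟨hw2, hw3⟩, -, hw4, hw5⟩ := hw
    have h2 := hw5.2.1 (p + 1) (by omega) (by omega)
    have h3 := hw5.2.2
    -- The middle vertex is the first place after p at height W(w) + 1. It comes before w because w
    -- ≠ p + 1 forces W(p + 1) > W(w), and then (u, w) is a walk edge as well.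
    obtain ⟨u, hu1, hu2, hu3⟩ := exists_walkEdge (f := f) hw2 (t := walk f w + 1) (by omega)
      (by omega) (by omega)
    have hpu := hu2.1
    have huw : u < w := by
      rcases Nat.lt_or_ge u w with h | h
      · exact h
      · obtain rfl : u = w := by omega
        omega
    have huw' : WalkEdge f u w := ⟨huw, fun v hv hv' => hw5.2.1 v (by omega) hv', by omega⟩
    refine ⟨{p, u, w}, ?_, hsup u w hpu huw⟩
    simp only [fanAt, trianglesBetween, Finset.mem_filter, Finset.mem_powersetCard]
    refine ⟨⟨⟨?_, ?_⟩, ?_⟩, by simp⟩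
    · intro x hx
      simp only [Finset.mem_insert, Finset.mem_singleton] at hx
      rw [Finset.mem_Icc]
      omega
    · rw [Finset.card_eq_three]
      exact ⟨p, u, w, by omega, by omega, by omega, rfl⟩
    · intro x hx y hy hxy
      simp only [Finset.mem_insert, Finset.mem_singleton] at hx hy
      rw [hE]
      refine ⟨by omega, by omega, ?_⟩
      rcases hx with rfl | rfl | rfl <;> rcases hy with rfl | rfl | rfl <;>
        first | exact hu2 | exact hw5 | exact huw' | omega

-- Strong induction on q - p. By `hmax` all larger neighbours of p lie in p, …, q, so the fan at p
-- has its full size f(p). Consecutive neighbours w < w' of p form an edge, and no edge from w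
-- passes beyond w' since it would cross (p, w'), so the induction hypothesis applies to each
-- remaining polygon. The resulting lists telescope from p + 1 to q. A side contributes nothing
-- because f(p) = 0 there.
include hE in
theorem map_fanSeq (hf : IsCode n f) {p q : ℕ} (h : (p, q) ∈ E)
    (hmax : ∀ w, (p, w) ∈ E → w ≤ q) :
    (fanSeq E p q).map (fun F => (F.origin, F.size)) = fanData f p q := by
  classical
  induction hm : q - p using Nat.strong_induction_on generalizing p q with
  | _ m ih =>
    obtain ⟨hp, hq, hwe⟩ := (hE p q).1 h
    have hpq := hwe.1
    have hcard : ((Finset.Ioc p q).filter (fun w => (p, w) ∈ E)).card = f p + 1 := by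
      have h2 := hf.neg_one_le_walk hp (by omega)
      rw [← card_walkEdge (q := n + 2) (by omega) (by rw [hf.walk_last]; omega)]
      congr 1
      ext w
      simp only [Finset.mem_filter, Finset.mem_Ioc]
      constructor
      · rintro ⟨h3, h4⟩
        exact ⟨by omega, ((hE p w).1 h4).2.2⟩
      · rintro ⟨h3, h4⟩
        have h5 : (p, w) ∈ E := (hE p w).2 ⟨hp, h3.2, h4⟩
        exact ⟨⟨h3.1, hmax w h5⟩, h5⟩
    have hsize := size_fanAt hE hp hpq hq
    rw [fanSeq]
    split_ifs with hlt
    · obtain rfl : q = p + 1 := by omega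
      have : ((Finset.Ioc p (p + 1)).filter (fun w => (p, w) ∈ E)).card ≤
        (Finset.Ioc p (p + 1)).card := Finset.card_filter_le _ _
      simp only [Nat.card_Ioc] at this
      have hfp : f p = 0 := by omega
      simp [fanData, hfp]
    · have hfp : f p ≠ 0 := by
        have : 1 < ((Finset.Ioc p q).filter (fun w => (p, w) ∈ E)).card := by
          rw [Finset.one_lt_card]
          refine ⟨p + 1, ?_, q, ?_, by omega⟩
          · simp only [Finset.mem_filter, Finset.mem_Ioc, hE]
            exact ⟨by omega, hp, by omega, walkEdge_succ f p⟩
          · simp only [Finset.mem_filter, Finset.mem_Ioc]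
            exact ⟨by omega, h⟩
        omega
      have hhead : fanData f p q = (p, f p) :: fanData f (p + 1) q := by
        rw [fanData, fanData, show q - p = (q - (p + 1)) + 1 by omega, List.range'_succ]
        simp [hfp]
      have hsz : (fanAt E p q).size = f p := by omega
      rw [hhead, List.map_cons, hsz]
      congr 1
      rw [List.map_flatMap]
      have hstep : ∀ w ∈ (nbrs E p q).zip (nbrs E p q).tail,
          (fanSeq E w.1 w.2).map (fun F => (F.origin, F.size)) = fanData f w.1 w.2 := by
        rintro ⟨w, w'⟩ hw
        obtain ⟨h1, h2, h3, h4⟩ := zip_tail_consecutive (pairwise_nbrs p q) hw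
        simp only [mem_nbrs] at h1 h2 h3 h4 ⊢
        have e1 := ((hE _ _).1 h1.2.2).2.2
        have e2 := ((hE _ _).1 h2.2.2).2.2
        refine ih (w' - w) (by omega) ?_ ?_ rfl
        · rw [hE]
          refine ⟨by omega, by omega, h3, fun v hv hv' => e2.2.1 v (by omega) hv', ?_⟩
          -- If W(w) exceeded W(w') + 1, the first place after p at height W(w') + 1 would be a
          -- neighbour of p strictly between w and w'.
          by_contra hcon
          have := e1.walk_le
          have := e2.2.2
          obtain ⟨u, hu1, hu2, hu3⟩ := exists_walkEdge (f := f) h2.1 (t := walk f w' + 1) (by omega)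
            (by omega) (by omega)
          have hu4 : u ≠ w' := by rintro rfl; omega
          have hu5 : u ≠ w := by rintro rfl; omega
          have hu6 : ¬ u < w := fun hlt => by
            have := e1.2.1 u hu2.1 hlt
            omega
          exact h4 u ⟨hu2.1, by omega, (hE _ _).2 ⟨hp, by omega, hu2⟩⟩ ⟨by omega, by omega⟩
        · intro y hy
          by_contra hcon
          have e3 := ((hE _ _).1 hy).2.2
          exact e2.noncrossing e3 ⟨h1.1, h3, by omega⟩
      have hflat : ((nbrs E p q).zip (nbrs E p q).tail).flatMap (fun w => fanData f w.1 w.2) =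
          fanData f (p + 1) q := by
        have h1 : p + 1 ∈ nbrs E p q := mem_nbrs.2 ⟨by omega, by omega,
          (hE _ _).2 ⟨hp, by omega, walkEdge_succ f p⟩⟩
        have hq' : q ∈ nbrs E p q := mem_nbrs.2 ⟨hpq, le_rfl, h⟩
        have hs := pairwise_nbrs (E := E) p q
        have hle : ∀ w ∈ nbrs E p q, p + 1 ≤ w ∧ w ≤ q := fun w hw => by
          have := mem_nbrs.1 hw
          omega
        generalize nbrs E p q = l at *
        cases l with
        | nil => simp at h1
        | cons x l =>
          have hs' := List.pairwise_cons.1 hs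
          have hx : x = p + 1 := by
            rcases List.mem_cons.1 h1 with h | h
            · exact h.symm
            · have := hs'.1 _ h
              have := hle x (by simp)
              omega
          subst hx
          rw [List.tail_cons, flatMap_zip_tail (fun a => by simp [fanData]) (fanData_append f) hs]
          congr 1
          have hql : q ∈ l := by
            rcases List.mem_cons.1 hq' with h | h
            · omega
            · exact h
          have hne : l ≠ [] := List.ne_nil_of_mem hql
          rw [List.getLastD_eq_getLast?, List.getLast?_eq_some_getLast hne, Option.getD_some]
          refine le_antisymm (hle _ (List.mem_cons_of_mem _ (List.getLast_mem hne))).2 ?_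
          have := hs'.2
          rw [← List.dropLast_append_getLast hne] at this hql
          rcases List.mem_append.1 hql with h | h
          · exact ((List.pairwise_append.1 this).2.2 _ h _ (by simp)).le
          · rw [List.mem_singleton] at h
            exact h.le
      rw [← hflat, List.flatMap_def, List.flatMap_def]
      congr 1
      rw [← List.attach_map_val (l := (nbrs E p q).zip (nbrs E p q).tail)]
      exact List.map_congr_left fun w _ => hstep w.1 w.2

end FanSeq

theorem IsCode.map_fans {n : ℕ} {f : ℕ → ℕ} (hf : IsCode n f) :
    (fans (n + 2) (codeChords n f)).map (fun F => (F.origin, F.size)) =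
      (supp n f).map (fun v => (v, f v)) := by
  rw [fans, map_fanSeq (fun p w => hf.mem_edges_codeChords) hf]
  · rw [fanData, supp, show n + 2 - 1 = n + 1 by omega, List.range'_concat]
    simp [hf.zero_of (n + 1) (Or.inr (by omega)), add_comm 1 n]
  · rw [hf.mem_edges_codeChords]
    exact ⟨le_rfl, le_rfl, hf.walkEdge_one⟩
  · intro w hw
    exact (hf.mem_edges_codeChords.1 hw).2.1

theorem IsCode.origins_codeChords {n : ℕ} {f : ℕ → ℕ} (hf : IsCode n f) :
    origins (n + 2) (codeChords n f) = supp n f := by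
  have := congrArg (List.map Prod.fst) hf.map_fans
  simpa [origins, Function.comp_def] using this

theorem IsCode.fanSizes_codeChords {n : ℕ} {f : ℕ → ℕ} (hf : IsCode n f) :
    fanSizes (n + 2) (codeChords n f) = vals n f := by
  have := congrArg (List.map Prod.snd) hf.map_fans
  simpa [fanSizes, vals, Function.comp_def] using this

theorem IsTriangulation.origins_eq {n : ℕ} {C : Finset (ℕ × ℕ)} (hC : IsTriangulation (n + 2) C)
    (hn : 1 ≤ n) : origins (n + 2) C = supp n (triCode (n + 2) C) := by
  rw [← hC.isCode.origins_codeChords, hC.codeChords_triCode hn]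

theorem IsTriangulation.fanSizes_eq {n : ℕ} {C : Finset (ℕ × ℕ)} (hC : IsTriangulation (n + 2) C)
    (hn : 1 ≤ n) : fanSizes (n + 2) C = vals n (triCode (n + 2) C) := by
  rw [← hC.isCode.fanSizes_codeChords, hC.codeChords_triCode hn]

/-! ## Dyck paths -/

@[simp] theorem runWord_cons_cons (u d : ℕ) (us ds : List ℕ) :
    runWord (u :: us) (d :: ds) =
      List.replicate u DyckStep.U ++ (List.replicate d DyckStep.D ++ runWord us ds) := by
  simp [runWord]

/-- The word `U^{c₁} D U^{c₂} D ⋯`. -/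
def stepWord (cs : List ℕ) : List DyckStep :=
  cs.flatMap (fun c => List.replicate c DyckStep.U ++ [DyckStep.D])

@[simp] theorem stepWord_nil : stepWord [] = [] := rfl

@[simp] theorem stepWord_cons (c : ℕ) (cs : List ℕ) :
    stepWord (c :: cs) = List.replicate c DyckStep.U ++ DyckStep.D :: stepWord cs := by
  simp [stepWord]

theorem stepWord_append (cs cs' : List ℕ) :
    stepWord (cs ++ cs') = stepWord cs ++ stepWord cs' := by
  simp [stepWord]

theorem count_U_stepWord (cs : List ℕ) : (stepWord cs).count DyckStep.U = cs.sum := by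
  induction cs with
  | nil => rfl
  | cons c cs ih => simp [ih]

theorem count_D_stepWord (cs : List ℕ) : (stepWord cs).count DyckStep.D = cs.length := by
  induction cs with
  | nil => rfl
  | cons c cs ih => simp [ih, List.count_replicate]

/-- The height is lowest immediately after a down step, so the hypothesis only checks those
prefixes. The initial height h makes the induction work after the first letters have been removed.
-/
theorem count_D_take_stepWord_le {cs : List ℕ} {h : ℕ}
    (hcs : ∀ k ≤ cs.length, k ≤ h + (cs.take k).sum) (i : ℕ) :
    ((stepWord cs).take i).count DyckStep.D ≤ h + ((stepWord cs).take i).count DyckStep.U := by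
  induction cs generalizing h i with
  | nil => simp
  | cons c cs ih =>
    rw [stepWord_cons]
    rcases Nat.lt_or_ge c i with hi | hi
    · obtain ⟨j, rfl⟩ : ∃ j, i = c + (j + 1) := ⟨i - c - 1, by omega⟩
      have h1 := hcs 1 (by simp)
      simp at h1
      have h2 := ih (h := h + c - 1) (fun k hk => by
        have := hcs (k + 1) (by simpa using hk)
        simp at this
        omega) j
      rw [List.take_append, List.take_of_length_le (by simp)]
      simp [List.count_replicate]
      omega
    · rw [List.take_append_of_le_length (by simpa using hi)]
      simp [List.count_replicate]

theorem exists_stepWord (l : List DyckStep) :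
    ∃ cs c, l = stepWord cs ++ List.replicate c DyckStep.U := by
  induction l with
  | nil => exact ⟨[], 0, rfl⟩
  | cons s l ih =>
    obtain ⟨cs, c, rfl⟩ := ih
    cases s with
    | U =>
      cases cs with
      | nil => exact ⟨[], c + 1, by simp [List.replicate_succ]⟩
      | cons c' cs => exact ⟨(c' + 1) :: cs, c, by simp [List.replicate_succ]⟩
    | D => exact ⟨0 :: cs, c, by simp⟩

theorem sum_take_map_range' (n k : ℕ) (f : ℕ → ℕ) (h0 : f 0 = 0) (hk : k ≤ n) :
    (((List.range' 1 n).map f).take k).sum = ∑ v ∈ Finset.range (k + 1), f v := by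
  obtain ⟨m, rfl⟩ := Nat.exists_eq_add_of_le hk
  rw [← List.map_take, ← List.range'_append_1, List.take_left' List.length_range',
    Finset.sum_range_succ', h0, add_zero]
  clear hk
  induction k with
  | zero => rfl
  | succ k ih => rw [List.range'_concat, Finset.sum_range_succ, ← ih]; simp [add_comm]

theorem isCode_iff {n : ℕ} {f : ℕ → ℕ} (hz : ∀ v, (v = 0 ∨ n < v) → f v = 0) :
    IsCode n f ↔ (∀ k ≤ n, k ≤ (((List.range' 1 n).map f).take k).sum) ∧
      ((List.range' 1 n).map f).sum = n := by
  have h0 := hz 0 (Or.inl rfl)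
  have h1 : ((List.range' 1 n).map f).sum = (((List.range' 1 n).map f).take n).sum := by
    rw [List.take_of_length_le (by simp)]
  rw [h1, sum_take_map_range' n n f h0 le_rfl]
  constructor
  · intro h
    exact ⟨fun k hk => by rw [sum_take_map_range' n k f h0 hk]; exact h.le_sum k hk, h.sum_eq⟩
  · rintro ⟨h, h'⟩
    exact ⟨hz, fun k hk => by rw [← sum_take_map_range' n k f h0 hk]; exact h k hk, h'⟩

theorem stepWord_map_range'_eq {f : ℕ → ℕ} {x d : ℕ} (hd : 1 ≤ d)
    (h : ∀ v, x < v → v < x + d → f v = 0) :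
    stepWord ((List.range' x d).map f) =
      List.replicate (f x) DyckStep.U ++ List.replicate d DyckStep.D := by
  obtain ⟨d, rfl⟩ : ∃ e, d = e + 1 := ⟨d - 1, by omega⟩
  have : ∀ e y, x < y → y + e ≤ x + (d + 1) →
      stepWord ((List.range' y e).map f) = List.replicate e DyckStep.D := by
    intro e
    induction e with
    | zero => simp
    | succ e ih =>
      intro y hy hy'
      rw [List.range'_succ, List.map_cons, stepWord_cons, ih (y + 1) (by omega) (by omega),
        h y hy (by omega)]
      simp [List.replicate_succ]
  rw [List.range'_succ, List.map_cons, stepWord_cons, this d (x + 1) (by omega) (by omega),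
    List.replicate_succ]

/-- Cut x, …, n at the support of f. Each piece is a support point followed by zeros, hence
contributes one ascent, of length the value there, and one descent, of length the size of the piece.
-/
theorem stepWord_map_range'_eq_runWord {f : ℕ → ℕ} {n x : ℕ} {l : List ℕ}
    (hl : (x :: l).Pairwise (· < ·)) (hn : ∀ v ∈ x :: l, v ≤ n)
    (h : ∀ v, x ≤ v → v ≤ n → f v ≠ 0 → v ∈ x :: l) :
    stepWord ((List.range' x (n + 1 - x)).map f) =
      runWord ((x :: l).map f) (diffs (x :: l) ++ [n + 1 - (x :: l).getLastD 0]) := by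
  induction l generalizing x with
  | nil =>
    have hx := hn x (by simp)
    rw [stepWord_map_range'_eq (by omega)]
    · simp [runWord]
    · intro v hv hv'
      by_contra hne
      have := h v (by omega) (by omega) hne
      simp at this
      omega
  | cons y l ih =>
    have hl' := List.pairwise_cons.1 hl
    have hxy := hl'.1 y (by simp)
    have hy := hn y (by simp)
    have hsplit : n + 1 - x = (y - x) + (n + 1 - y) := by omega
    have hy' : x + (y - x) = y := by omega
    rw [hsplit, ← List.range'_append_1, List.map_append, stepWord_append, hy',
      stepWord_map_range'_eq (by omega), ih hl'.2 (fun v hv => hn v (List.mem_cons_of_mem _ hv))]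
    · simp
    · intro v h1 h2 h3
      rcases List.mem_cons.1 (h v (by omega) h2 h3) with h4 | h4
      · omega
      · exact h4
    · intro v h1 h2
      by_contra hne
      rcases List.mem_cons.1 (h v (by omega) (by omega) hne) with h4 | h4
      · omega
      · rcases List.mem_cons.1 h4 with h5 | h5
        · omega
        · have := (List.pairwise_cons.1 hl'.2).1 v h5
          omega

theorem IsCode.codeWord_eq {n : ℕ} {f : ℕ → ℕ} (hf : IsCode n f) (hn : 1 ≤ n) :
    codeWord n f = stepWord ((List.range' 1 n).map f) := by
  obtain ⟨l, hl⟩ := hf.supp_eq_cons hn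
  have h1 := pairwise_supp n f
  have h2 : ∀ v, v ∈ supp n f → v ≤ n := fun v hv => (mem_supp.1 hv).1.2
  have h3 : ∀ v, f v ≠ 0 → v ∈ supp n f := fun v hv => hf.mem_supp_iff.2 hv
  rw [codeWord, vals]
  rw [hl] at h1 h2 h3 ⊢
  rw [← stepWord_map_range'_eq_runWord h1 h2 (fun v _ _ hv => h3 v hv)]
  simp

/-- The Dyck path of a code. -/
def IsCode.toDyckWord {n : ℕ} {f : ℕ → ℕ} (hf : IsCode n f) (hn : 1 ≤ n) : DyckWord where
  toList := codeWord n f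
  count_U_eq_count_D := by
    rw [hf.codeWord_eq hn, count_U_stepWord, count_D_stepWord, ((isCode_iff hf.zero_of).1 hf).2]
    simp
  count_D_le_count_U := by
    rw [hf.codeWord_eq hn]
    intro i
    have := count_D_take_stepWord_le (cs := (List.range' 1 n).map f) (h := 0) (fun k hk => by
      rw [zero_add]
      exact ((isCode_iff hf.zero_of).1 hf).1 k (by simpa using hk)) i
    rwa [zero_add] at this

theorem IsCode.semilength_toDyckWord {n : ℕ} {f : ℕ → ℕ} (hf : IsCode n f) (hn : 1 ≤ n) :
    (hf.toDyckWord hn).semilength = n := by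
  change (codeWord n f).count DyckStep.U = n
  rw [hf.codeWord_eq hn, count_U_stepWord,
    ((isCode_iff hf.zero_of).1 hf).2]

/-- Cut the path after each down step. The prefix ending with the kth down step gives the code
inequality at k, and the equal numbers of letters give the total. -/
theorem exists_isCode_of_dyckWord (P : DyckWord) :
    ∃ f, IsCode P.semilength f ∧ stepWord ((List.range' 1 P.semilength).map f) = P.toList := by
  obtain ⟨cs, c, h⟩ := exists_stepWord P.toList
  have h1 := P.count_U_eq_count_D
  have h2 := P.count_D_le_count_U (stepWord cs).length
  have hn : P.semilength = cs.sum + c := by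
    rw [DyckWord.semilength, h, List.count_append, count_U_stepWord]
    simp
  rw [h, List.take_left', count_D_stepWord, count_U_stepWord] at h2
  · rw [h, List.count_append, List.count_append, count_D_stepWord, count_U_stepWord] at h1
    simp [List.count_replicate] at h1
    -- Up to the last down step there are already at least as many up steps as down steps in the
    -- whole path, so no up step can follow.
    obtain rfl : c = 0 := by omega
    simp only [List.replicate_zero, List.append_nil, add_zero] at h hn h1
    -- Codes are indexed from 1 and lists from 0; the case v = 0 is separate because v - 1 would
    -- truncate to the first entry. The default 0 makes the code vanish beyond n.
    refine ⟨fun v => if v = 0 then 0 else cs.getD (v - 1) 0, ?_⟩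
    have hmap : (List.range' 1 P.semilength).map (fun v => if v = 0 then 0 else cs.getD (v - 1) 0) =
        cs := by
      apply List.ext_getElem
      · simp; omega
      · intro i hi hi'
        simp [hi']
    refine ⟨?_, by rw [hmap, h]⟩
    rw [isCode_iff, hmap]
    · refine ⟨fun k hk => ?_, hn.symm⟩
      have h3 := P.count_D_le_count_U (stepWord (cs.take k)).length
      have h4 : P.toList = stepWord (cs.take k) ++ stepWord (cs.drop k) := by
        rw [← stepWord_append, List.take_append_drop, h]
      rw [h4, List.take_left', count_D_stepWord, count_U_stepWord, List.length_take] at h3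
      · omega
      · rfl
    · intro v hv
      by_cases h0 : v = 0
      · simp [h0]
      · simp only [h0, if_false]
        apply List.getD_eq_default
        omega
  · rfl

/-- All exponents are positive, so neighbouring factors are non-empty and consist of different
letters: the factors are the maximal runs. -/
theorem splitBy_runWord {us ds : List ℕ} (hlen : us.length = ds.length) (hu : ∀ u ∈ us, 1 ≤ u)
    (hd : ∀ d ∈ ds, 1 ≤ d) :
    (runWord us ds).splitBy (fun s s' => decide (s = s')) =
      (List.zipWith (fun u d => [List.replicate u DyckStep.U, List.replicate d DyckStep.D])
        us ds).flatten := by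
  induction us generalizing ds with
  | nil => simp [runWord]
  | cons u us ih =>
    cases ds with
    | nil => simp at hlen
    | cons d ds =>
      have h1 := hu u (by simp)
      have h2 := hd d (by simp)
      rw [runWord_cons_cons, List.splitBy_append, List.splitBy_append, ih (by simpa using hlen)
        (fun x hx => hu x (by simp [hx])) (fun x hx => hd x (by simp [hx])),
        List.splitBy_of_isChain, List.splitBy_of_isChain]
      · simp
      · simp; omega
      · simp [List.isChain_replicate_of_rel]
      · simp; omega
      · simp [List.isChain_replicate_of_rel]
      · intro x hx y hy
        have hx := List.eq_of_mem_replicate (List.mem_of_mem_getLast? hx)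
        have hy : y = DyckStep.U := by
          cases us with
          | nil => simp [runWord] at hy
          | cons u' us =>
            cases ds with
            | nil => simp at hlen
            | cons d' ds =>
              have := hu u' (by simp)
              obtain ⟨m, rfl⟩ : ∃ m, u' = m + 1 := ⟨u' - 1, by omega⟩
              simpa [List.replicate_succ, eq_comm] using hy
        simp [hx, hy]
      · intro x hx y hy
        have hx := List.eq_of_mem_replicate (List.mem_of_mem_getLast? hx)
        obtain ⟨m, rfl⟩ : ∃ m, d = m + 1 := ⟨d - 1, by omega⟩
        have hy : y = DyckStep.D := by simpa [List.replicate_succ, eq_comm] using hy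
        simp [hx, hy]

theorem ascents_eq_of_runWord {P : DyckWord} {us ds : List ℕ} (hP : P.toList = runWord us ds)
    (hlen : us.length = ds.length) (hu : ∀ u ∈ us, 1 ≤ u) (hd : ∀ d ∈ ds, 1 ≤ d) :
    ascents P = us := by
  rw [ascents, runs, hP, splitBy_runWord hlen hu hd]
  clear hP
  induction us generalizing ds with
  | nil => simp
  | cons u us ih =>
    cases ds with
    | nil => simp at hlen
    | cons d ds =>
      have h1 := hu u (by simp)
      rw [List.zipWith_cons_cons, List.flatten_cons, List.filter_append, List.map_append,
        ih (by simpa using hlen) (fun x hx => hu x (by simp [hx])) (fun x hx => hd x (by simp [hx]))]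
      simp [List.mem_replicate, show u ≠ 0 by omega]

theorem descents_eq_of_runWord {P : DyckWord} {us ds : List ℕ} (hP : P.toList = runWord us ds)
    (hlen : us.length = ds.length) (hu : ∀ u ∈ us, 1 ≤ u) (hd : ∀ d ∈ ds, 1 ≤ d) :
    descents P = ds := by
  rw [descents, runs, hP, splitBy_runWord hlen hu hd]
  clear hP
  induction us generalizing ds with
  | nil =>
    cases ds with
    | nil => simp
    | cons d ds => simp at hlen
  | cons u us ih =>
    cases ds with
    | nil => simp at hlen
    | cons d ds =>
      have h1 := hd d (by simp)
      rw [List.zipWith_cons_cons, List.flatten_cons, List.filter_append, List.map_append,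
        ih (by simpa using hlen) (fun x hx => hu x (by simp [hx])) (fun x hx => hd x (by simp [hx]))]
      simp [List.mem_replicate, show d ≠ 0 by omega]

theorem one_le_of_mem_diffs {l : List ℕ} (hl : l.Pairwise (· < ·)) {d : ℕ} (hd : d ∈ diffs l) :
    1 ≤ d := by
  induction l with
  | nil => simp at hd
  | cons x l ih =>
    cases l with
    | nil => simp at hd
    | cons y l =>
      have hl' := List.pairwise_cons.1 hl
      rw [diffs_cons_cons, List.mem_cons] at hd
      rcases hd with rfl | hd
      · have := hl'.1 y (by simp)
        omega
      · exact ih hl'.2 hd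

theorem dropLast_scanl_diffs {x z : ℕ} {l : List ℕ} (hl : (x :: l).Pairwise (· < ·)) :
    ((diffs (x :: l) ++ [z]).scanl (· + ·) x).dropLast = x :: l := by
  induction l generalizing x with
  | nil => simp
  | cons y l ih =>
    have hl' := List.pairwise_cons.1 hl
    have hxy := hl'.1 y (by simp)
    rw [diffs_cons_cons, List.cons_append, List.scanl_cons, Nat.add_sub_cancel' hxy.le,
      List.dropLast_cons_of_ne_nil, ih hl'.2]
    simp

/-! ### Ascents, descents and peak labels of the path of a code. -/

section CodeDyck

variable {n : ℕ} {f : ℕ → ℕ}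

theorem IsCode.length_codeWord_aux (hf : IsCode n f) (hn : 1 ≤ n) :
    (vals n f).length = (diffs (supp n f) ++ [n + 1 - (supp n f).getLastD 0]).length := by
  obtain ⟨l, hl⟩ := hf.supp_eq_cons hn
  simp [length_diffs, length_vals, hl]

theorem IsCode.getLastD_supp_le (_ : IsCode n f) : (supp n f).getLastD 0 ≤ n := by
  rw [List.getLastD_eq_getLast?]
  rcases h : (supp n f).getLast? with _ | x
  · simp
  · exact (mem_supp.1 (List.mem_of_getLast? h)).1.2

theorem IsCode.one_le_codeWord_aux (hf : IsCode n f) :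
    ∀ d ∈ diffs (supp n f) ++ [n + 1 - (supp n f).getLastD 0], 1 ≤ d := by
  intro d hd
  rcases List.mem_append.1 hd with hd | hd
  · exact one_le_of_mem_diffs (pairwise_supp n f) hd
  · rw [List.mem_singleton] at hd
    have := hf.getLastD_supp_le
    omega

theorem IsCode.ascents_eq (hf : IsCode n f) (hn : 1 ≤ n) {P : DyckWord}
    (hP : P.toList = codeWord n f) : ascents P = vals n f :=
  ascents_eq_of_runWord hP (hf.length_codeWord_aux hn) (fun _ hu => one_le_of_mem_vals hu)
    hf.one_le_codeWord_aux

theorem IsCode.descents_eq (hf : IsCode n f) (hn : 1 ≤ n) {P : DyckWord}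
    (hP : P.toList = codeWord n f) :
    descents P = diffs (supp n f) ++ [n + 1 - (supp n f).getLastD 0] :=
  descents_eq_of_runWord hP (hf.length_codeWord_aux hn) (fun _ hu => one_le_of_mem_vals hu)
    hf.one_le_codeWord_aux

theorem IsCode.peakLabels_eq (hf : IsCode n f) (hn : 1 ≤ n) {P : DyckWord}
    (hP : P.toList = codeWord n f) : peakLabels P = supp n f := by
  have h := pairwise_supp n f
  rw [peakLabels, hf.descents_eq hn hP]
  obtain ⟨l, hl⟩ := hf.supp_eq_cons hn
  rw [hl] at h ⊢
  exact dropLast_scanl_diffs h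

end CodeDyck

/-! ## The bijections between codes, triangulations and Dyck paths -/

theorem countP_add_count_one {l : List ℕ} (hl : ∀ u ∈ l, 1 ≤ u) :
    l.countP (fun u => decide (2 ≤ u)) + l.count 1 = l.length := by
  induction l with
  | nil => rfl
  | cons u l ih =>
    have h := ih fun x hx => hl x (by simp [hx])
    have hu := hl u (by simp)
    rw [List.countP_cons, List.count_cons, List.length_cons, ← h]
    by_cases h2 : u = 1
    · simp [h2, add_assoc]
    · have h3 : 2 ≤ u := by omega
      simp [h2, h3]
      omega

/-- Entries are positive, so anything after the last long entry would be a 1. Without a long entry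
the left side is vacuously true and the right side false, which is why one is required. -/
theorem noSingletonAfterLastLong_iff {l : List ℕ} (hl : ∀ u ∈ l, 1 ≤ u)
    (hlong : 1 ≤ l.countP (fun u => decide (2 ≤ u))) :
    NoSingletonAfterLastLong l ↔ ∃ u ∈ l.getLast?, 2 ≤ u := by
  have hne : l ≠ [] := by rintro rfl; simp at hlong
  have hlen : 0 < l.length := List.length_pos_iff.2 hne
  have hlast : l.getLast? = some (l.get ⟨l.length - 1, by omega⟩) := by
    rw [List.getLast?_eq_some_getLast hne, List.getLast_eq_getElem]
    rfl
  constructor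
  · intro h
    refine ⟨_, hlast, ?_⟩
    obtain ⟨u, hu, hu2⟩ := List.countP_pos_iff.1 hlong
    obtain ⟨j₀, hj₀⟩ := List.mem_iff_get.1 hu
    classical
    have hne' : (Finset.univ.filter (fun j : Fin l.length => 2 ≤ l.get j)).Nonempty :=
      ⟨j₀, by simpa [← hj₀] using hu2⟩
    set j := (Finset.univ.filter (fun j : Fin l.length => 2 ≤ l.get j)).max' hne'
    have hj : 2 ≤ l.get j := (Finset.mem_filter.1 (Finset.max'_mem _ hne')).2
    have hmax : ∀ j' : Fin l.length, j < j' → l.get j' < 2 := by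
      intro j' hj'
      by_contra hcon
      exact absurd (Finset.le_max' _ j' (Finset.mem_filter.2 ⟨Finset.mem_univ _, by omega⟩))
        (not_le.2 hj')
    rcases lt_or_ge j ⟨l.length - 1, by omega⟩ with h3 | h3
    · exfalso
      have h4 := hmax _ h3
      have h5 := hl _ (List.get_mem l ⟨l.length - 1, by omega⟩)
      exact h j _ hj hmax h3 (by omega)
    · have h4 : j = ⟨l.length - 1, by omega⟩ := by
        apply Fin.ext
        have := j.2
        have := Fin.le_def.1 h3
        simp only at this ⊢
        omega
      rw [← h4]
      exact hj
  · rintro ⟨u, hu, hu2⟩ j k hj hmax hjk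
    rw [hlast, Option.mem_some] at hu
    have hle : j ≤ ⟨l.length - 1, by omega⟩ := Fin.le_def.2 (by have := j.2; simp only; omega)
    rcases hle.lt_or_eq with h | h
    · have := hmax _ h
      omega
    · have := k.2
      have := Fin.lt_def.1 hjk
      rw [h] at this
      simp only at this
      omega

theorem triCode_mem_codeSet {n ℓ s : ℕ} (hn : 1 ≤ n) (C : Tri (n + 2) ℓ s) :
    triCode (n + 2) C.1 ∈ codeSet n ℓ s := by
  obtain ⟨C, hC, h1, h2, F, hF, h3⟩ := C
  have hv := hC.fanSizes_eq hn
  have hc := countP_add_count_one (l := vals n (triCode (n + 2) C)) fun _ => one_le_of_mem_vals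
  rw [← hv] at hc
  have hlen : (fanSizes (n + 2) C).length = s + ℓ := by rw [fanSizes, List.length_map, h1]
  refine ⟨hC.isCode, ?_, ?_, F.size, ?_, ?_⟩
  · rw [← hv]; omega
  · rw [← hv, h2]
  · rw [← hv, fanSizes, List.getLast?_map, hF]
    rfl
  · have : F.size ∈ vals n (triCode (n + 2) C) := by
      rw [← hv, fanSizes]
      exact List.mem_map_of_mem (List.mem_of_getLast? hF)
    have := one_le_of_mem_vals this
    omega

/-- Triangulations correspond to codes. -/
noncomputable def triEquiv {n : ℕ} (ℓ s : ℕ) (hn : 1 ≤ n) : Tri (n + 2) ℓ s ≃ codeSet n ℓ s where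
  toFun C := ⟨triCode (n + 2) C.1, triCode_mem_codeSet hn C⟩
  invFun f := ⟨codeChords n f.1, by
    obtain ⟨f, hf, h1, h2, u, hu, h3⟩ := f
    have hv := hf.fanSizes_codeChords
    have hc := countP_add_count_one (l := vals n f) fun _ => one_le_of_mem_vals
    refine ⟨hf.isTriangulation_codeChords hn, ?_, by rw [hv, h2], ?_⟩
    · have : (fanSizes (n + 2) (codeChords n f)).length = s + ℓ := by rw [hv]; omega
      rwa [fanSizes, List.length_map] at this
    · rw [← hv, fanSizes, List.getLast?_map, Option.mem_def, Option.map_eq_some_iff] at hu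
      obtain ⟨F, hF, rfl⟩ := hu
      exact ⟨F, hF, by omega⟩⟩
  left_inv C := Subtype.ext (C.2.1.codeChords_triCode hn)
  right_inv f := Subtype.ext f.2.1.triCode_codeChords

/-- The Dyck path of a code, with its statistics. -/
def codeToDyck {n : ℕ} (ℓ s : ℕ) (hn : 1 ≤ n) (hℓ : 1 ≤ ℓ) (f : codeSet n ℓ s) : Dyck n ℓ s :=
  ⟨f.2.1.toDyckWord hn, by
    obtain ⟨f, hf, h1, h2, h3⟩ := f
    have hasc : ascents (hf.toDyckWord hn) = vals n f := hf.ascents_eq hn rfl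
    refine ⟨hf.semilength_toDyckWord hn, by rw [hasc, h1], by rw [hasc, h2], ?_⟩
    rw [hasc, noSingletonAfterLastLong_iff (fun _ => one_le_of_mem_vals) (by omega)]
    exact h3⟩

/-- The path returns the values of the code as its ascents and the support as its peak labels, which
gives injectivity. Surjectivity comes from cutting a path after its down steps. -/
theorem bijective_codeToDyck {n : ℕ} (ℓ s : ℕ) (hn : 1 ≤ n) (hℓ : 1 ≤ ℓ) :
    Function.Bijective (codeToDyck (n := n) ℓ s hn hℓ) := by
  constructor
  · intro f g h
    have hP : f.2.1.toDyckWord hn = g.2.1.toDyckWord hn := congrArg Subtype.val h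
    have e1 := f.2.1.ascents_eq hn (P := f.2.1.toDyckWord hn) rfl
    have e2 := g.2.1.ascents_eq hn (P := g.2.1.toDyckWord hn) rfl
    have e3 := f.2.1.peakLabels_eq hn (P := f.2.1.toDyckWord hn) rfl
    have e4 := g.2.1.peakLabels_eq hn (P := g.2.1.toDyckWord hn) rfl
    exact Subtype.ext (f.2.1.ext_of_supp_vals g.2.1 (by rw [← e3, ← e4, hP])
      (by rw [← e1, ← e2, hP]))
  · rintro ⟨P, rfl, h1, h2, h3⟩
    obtain ⟨f, hf, hw⟩ := exists_isCode_of_dyckWord P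
    rw [← hf.codeWord_eq hn] at hw
    have hasc := hf.ascents_eq hn hw.symm
    rw [hasc] at h1 h2 h3
    rw [noSingletonAfterLastLong_iff (fun _ => one_le_of_mem_vals) (by omega)] at h3
    exact ⟨⟨f, hf, h1, h2, h3⟩, Subtype.ext (DyckWord.ext hw)⟩

/-- Dyck paths correspond to codes. -/
noncomputable def dyckEquiv {n : ℕ} (ℓ s : ℕ) (hn : 1 ≤ n) (hℓ : 1 ≤ ℓ) :
    Dyck n ℓ s ≃ codeSet n ℓ s :=
  (Equiv.ofBijective _ (bijective_codeToDyck ℓ s hn hℓ)).symm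

theorem toList_eq_codeWord {n ℓ s : ℕ} (hn : 1 ≤ n) (hℓ : 1 ≤ ℓ) (P : Dyck n ℓ s) :
    P.1.toList = codeWord n (dyckEquiv ℓ s hn hℓ P).1 := by
  conv_lhs => rw [← (dyckEquiv ℓ s hn hℓ).symm_apply_apply P]
  rfl

/-! ## Nomincreasing partitions and codes -/

/-- The least element of a non-empty finite set of natural numbers. -/
def least (S : Finset ℕ) : ℕ := S.min.untopD 0

theorem coe_least {S : Finset ℕ} (hS : S.Nonempty) : (least S : WithTop ℕ) = S.min := by
  obtain ⟨m, hm⟩ := Finset.min_of_nonempty hS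
  rw [least, hm]
  rfl

theorem least_mem {S : Finset ℕ} (hS : S.Nonempty) : least S ∈ S :=
  Finset.mem_of_min (coe_least hS).symm

theorem least_le {S : Finset ℕ} {x : ℕ} (hx : x ∈ S) : least S ≤ x := by
  have := Finset.min_le hx
  rw [← coe_least ⟨x, hx⟩] at this
  exact WithTop.coe_le_coe.1 this

theorem least_eq {S : Finset ℕ} {x : ℕ} (hx : x ∈ S) (h : ∀ y ∈ S, x ≤ y) : least S = x :=
  le_antisymm (least_le hx) (h _ (least_mem ⟨x, hx⟩))

section Nomincreasing

variable {n : ℕ} {A : List (Finset ℕ)}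

theorem IsNomincreasing.pairwise_least (hA : IsNomincreasing n A) :
    (A.map least).Pairwise (· < ·) := by
  rw [List.pairwise_map]
  refine hA.2.2.imp_of_mem ?_
  intro S S' hS hS' h
  have := h.2.1
  rw [← coe_least (hA.1 S hS), ← coe_least (hA.1 S' hS')] at this
  exact_mod_cast this

theorem IsNomincreasing.eq_of_mem (hA : IsNomincreasing n A) {S S' : Finset ℕ} (hS : S ∈ A)
    (hS' : S' ∈ A) {z : ℕ} (h : z ∈ S) (h' : z ∈ S') : S = S' := by
  by_contra hne
  have hd : A.Pairwise Disjoint := hA.2.2.imp fun h => h.1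
  exact Finset.disjoint_left.1 (hd.forall hS hS' hne) h h'

/-- The non-minimal elements of the blocks, from left to right. -/
def restList (A : List (Finset ℕ)) : List ℕ :=
  A.flatMap (fun S => (S.erase (least S)).sort (· ≤ ·))

theorem mem_restList {z : ℕ} : z ∈ restList A ↔ ∃ S ∈ A, z ∈ S ∧ z ≠ least S := by
  simp [restList, and_comm]

theorem IsNomincreasing.mem_restList_iff (hA : IsNomincreasing n A) {z : ℕ} :
    z ∈ restList A ↔ (1 ≤ z ∧ z ≤ n) ∧ z ∉ A.map least := by
  rw [mem_restList, ← hA.2.1 z]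
  constructor
  · rintro ⟨S, hS, hz, hne⟩
    refine ⟨⟨S, hS, hz⟩, fun h => hne ?_⟩
    obtain ⟨S', hS', rfl⟩ := List.mem_map.1 h
    rw [hA.eq_of_mem hS hS' hz (least_mem (hA.1 S' hS'))]
  · rintro ⟨⟨S, hS, hz⟩, h⟩
    refine ⟨S, hS, hz, ?_⟩
    rintro rfl
    exact h (List.mem_map_of_mem hS)

/-- This is the ordering condition on non-minimal elements, and the reason why a nomincreasing
partition is a greedy labelling. -/
theorem IsNomincreasing.pairwise_restList (hA : IsNomincreasing n A) :
    (restList A).Pairwise (· < ·) := by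
  rw [restList, List.pairwise_flatMap]
  refine ⟨fun S _ => (Finset.sortedLT_sort _).pairwise, ?_⟩
  refine hA.2.2.imp_of_mem ?_
  intro S S' hS hS' h x hx y hy
  rw [Finset.mem_sort, Finset.mem_erase] at hx hy
  have hx' := least_le hx.2
  have hy' := least_le hy.2
  exact h.2.2 x hx.2 y hy.2 ⟨least S, least_mem ⟨x, hx.2⟩, by omega⟩
    ⟨least S', least_mem ⟨y, hy.2⟩, by omega⟩

/-- Each block takes from the pool exactly its own non-minimal elements, which come next. The
procedure stops before `extra`, which later allows the labels to come from [N] instead of [n]. -/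
theorem greedyBlocks_restList (hA : ∀ S ∈ A, S.Nonempty) (extra : List ℕ) :
    greedyBlocks ((A.map least).zip (A.map Finset.card)) (restList A ++ extra) = A := by
  induction A with
  | nil => rfl
  | cons S A ih =>
    have hS := least_mem (hA S (by simp))
    have hlen : ((S.erase (least S)).sort (· ≤ ·)).length = S.card - 1 := by
      rw [Finset.length_sort, Finset.card_erase_of_mem hS]
    have hsplit : restList (S :: A) ++ extra =
        (S.erase (least S)).sort (· ≤ ·) ++ (restList A ++ extra) := by
      simp [restList]
    rw [hsplit, List.map_cons, List.map_cons, List.zip_cons_cons, greedyBlocks,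
      List.take_left' hlen, List.drop_left' hlen, ih fun S' hS' => hA S' (by simp [hS']),
      Finset.sort_toFinset, Finset.insert_erase hS]

theorem IsNomincreasing.greedyLabels_eq (hA : IsNomincreasing n A) {M : ℕ} (hM : n ≤ M) :
    greedyLabels M (A.map least) (A.map Finset.card) = A := by
  have hpool : (Finset.Icc 1 M \ (A.map least).toFinset).sort (· ≤ ·) =
      restList A ++ List.range' (n + 1) (M - n) := by
    have hle : ∀ z ∈ A.map least, z ≤ n := by
      intro z hz
      obtain ⟨S, hS, rfl⟩ := List.mem_map.1 hz
      exact ((hA.2.1 _).1 ⟨S, hS, least_mem (hA.1 S hS)⟩).2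
    apply sort_eq_of_pairwise_lt
    · rw [List.pairwise_append]
      refine ⟨hA.pairwise_restList, List.pairwise_lt_range' 1, ?_⟩
      intro x hx y hy
      rw [hA.mem_restList_iff] at hx
      rw [List.mem_range'_1] at hy
      omega
    · intro x
      have := hle x
      rw [List.mem_append, hA.mem_restList_iff, List.mem_range'_1, Finset.mem_sdiff,
        Finset.mem_Icc, List.mem_toFinset]
      by_cases hx : x ∈ A.map least
      · simp only [hx, not_true, and_false, false_or, false_iff]
        have := this hx
        omega
      · simp only [hx, not_false_iff, and_true]
        omega
  rw [greedyLabels, hpool, greedyBlocks_restList hA.1]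

/-- Let g(z) be the minimum of the block of z and f(v) the number of z with g(z) = v. The sum of f
up to k counts the z with g(z) ≤ k, and these include 1, …, k because g(z) ≤ z. -/
theorem IsNomincreasing.exists_code (hA : IsNomincreasing n A) :
    ∃ f, IsCode n f ∧ supp n f = A.map least ∧ vals n f = A.map Finset.card := by
  classical
  have hex : ∃ g : ℕ → ℕ, ∀ S ∈ A, ∀ z ∈ S, g z = least S := by
    refine ⟨fun z => if h : ∃ S ∈ A, z ∈ S then least h.choose else 0, fun S hS z hz => ?_⟩
    have h : ∃ S ∈ A, z ∈ S := ⟨S, hS, hz⟩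
    simp only [h, dif_pos]
    rw [hA.eq_of_mem h.choose_spec.1 hS h.choose_spec.2 hz]
  obtain ⟨g, hg⟩ := hex
  have hgz : ∀ z, 1 ≤ z → z ≤ n → ∃ S ∈ A, z ∈ S ∧ g z = least S := by
    intro z h1 h2
    obtain ⟨S, hS, hz⟩ := (hA.2.1 z).2 ⟨h1, h2⟩
    exact ⟨S, hS, hz, hg S hS z hz⟩
  have hmem : ∀ S ∈ A, ∀ z ∈ S, 1 ≤ z ∧ z ≤ n := fun S hS z hz => (hA.2.1 z).1 ⟨S, hS, hz⟩
  set f : ℕ → ℕ := fun v => ((Finset.Icc 1 n).filter (fun z => g z = v)).card with hfdef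
  have hfS : ∀ S ∈ A, f (least S) = S.card := by
    intro S hS
    simp only [hfdef]
    congr 1
    ext z
    rw [Finset.mem_filter, Finset.mem_Icc]
    constructor
    · rintro ⟨⟨h1, h2⟩, h3⟩
      obtain ⟨S', hS', hz, h4⟩ := hgz z h1 h2
      have h5 := least_mem (hA.1 S' hS')
      rw [← h4, h3] at h5
      rwa [hA.eq_of_mem hS hS' (least_mem (hA.1 S hS)) h5]
    · intro hz
      exact ⟨hmem S hS z hz, hg S hS z hz⟩
  have hf0 : ∀ v, f v ≠ 0 → v ∈ A.map least := by
    intro v hv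
    obtain ⟨z, hz⟩ := Finset.card_ne_zero.1 hv
    rw [Finset.mem_filter, Finset.mem_Icc] at hz
    obtain ⟨S, hS, -, h⟩ := hgz z hz.1.1 hz.1.2
    rw [← hz.2, h]
    exact List.mem_map_of_mem hS
  have hsum : ∀ k, ∑ v ∈ Finset.range (k + 1), f v =
      ((Finset.Icc 1 n).filter (fun z => g z ≤ k)).card := by
    intro k
    rw [Finset.card_eq_sum_card_fiberwise (f := g) (t := Finset.range (k + 1))]
    · refine Finset.sum_congr rfl fun v hv => ?_
      rw [Finset.mem_range] at hv
      simp only [hfdef]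
      congr 1
      ext z
      simp only [Finset.mem_filter]
      constructor
      · rintro ⟨h1, h2⟩
        exact ⟨⟨h1, by omega⟩, h2⟩
      · rintro ⟨⟨h1, -⟩, h2⟩
        exact ⟨h1, h2⟩
    · intro z hz
      have := (Finset.mem_filter.1 hz).2
      simp only [Finset.coe_range, Set.mem_Iio]
      omega
  have hgle : ∀ z, 1 ≤ z → z ≤ n → g z ≤ z := by
    intro z h1 h2
    obtain ⟨S, hS, hz, h⟩ := hgz z h1 h2
    rw [h]
    exact least_le hz
  have hsupp : supp n f = A.map least := by
    refine eq_of_pairwise_lt (pairwise_supp n f) hA.pairwise_least fun v => ?_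
    rw [mem_supp]
    constructor
    · exact fun h => hf0 v h.2
    · intro h
      obtain ⟨S, hS, rfl⟩ := List.mem_map.1 h
      have h1 := least_mem (hA.1 S hS)
      refine ⟨hmem S hS _ h1, ?_⟩
      rw [hfS S hS]
      exact Finset.card_ne_zero.2 (hA.1 S hS)
  refine ⟨f, ⟨?_, ?_, ?_⟩, hsupp, ?_⟩
  · intro v hv
    by_contra hne
    obtain ⟨S, hS, rfl⟩ := List.mem_map.1 (hf0 v hne)
    have := hmem S hS _ (least_mem (hA.1 S hS))
    omega
  · intro k hk
    rw [hsum]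
    calc k = (Finset.Icc 1 k).card := by simp
      _ ≤ _ := by
        apply Finset.card_le_card
        intro z hz
        rw [Finset.mem_Icc] at hz
        rw [Finset.mem_filter, Finset.mem_Icc]
        have := hgle z hz.1 (by omega)
        exact ⟨by omega, by omega⟩
  · rw [hsum, Finset.filter_true_of_mem]
    · simp
    · intro z hz
      rw [Finset.mem_Icc] at hz
      have := hgle z hz.1 hz.2
      omega
  · rw [vals, hsupp, List.map_map]
    exact List.map_congr_left hfS

end Nomincreasing

/-! ### The greedy labelling of a code -/

/-- A list of labels and sizes and a pool of labels, such that the greedy procedure does not run out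
of labels, and adds to each block only labels that are larger than the prescribed one. -/
def Feasible : List (ℕ × ℕ) → List ℕ → Prop
  | [], _ => True
  | (x, u) :: L, pool =>
    1 ≤ u ∧ u - 1 ≤ pool.length ∧ (∀ z ∈ pool, x < z) ∧ Feasible L (pool.drop (u - 1))

theorem exists_of_mem_greedyBlocks {L : List (ℕ × ℕ)} {pool : List ℕ} (h : Feasible L pool)
    {S : Finset ℕ} (hS : S ∈ greedyBlocks L pool) :
    ∃ x ∈ L.map Prod.fst, ∃ c : List ℕ, (∀ z ∈ c, z ∈ pool ∧ x < z) ∧ S = insert x c.toFinset := by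
  induction L generalizing pool with
  | nil => simp [greedyBlocks] at hS
  | cons p L ih =>
    obtain ⟨x, u⟩ := p
    rw [greedyBlocks, List.mem_cons] at hS
    rcases hS with rfl | hS
    · exact ⟨x, by simp, pool.take (u - 1), fun z hz =>
        ⟨List.mem_of_mem_take hz, h.2.2.1 z (List.mem_of_mem_take hz)⟩, rfl⟩
    · obtain ⟨x', hx', c, hc, hS⟩ := ih h.2.2.2 hS
      exact ⟨x', List.mem_cons_of_mem _ hx', c,
        fun z hz => ⟨List.mem_of_mem_drop (hc z hz).1, (hc z hz).2⟩, hS⟩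

theorem least_insert {x : ℕ} {c : List ℕ} (hc : ∀ z ∈ c, x < z) :
    least (insert x c.toFinset) = x := by
  refine least_eq (by simp) fun y hy => ?_
  rw [Finset.mem_insert, List.mem_toFinset] at hy
  rcases hy with rfl | hy
  · exact le_rfl
  · exact (hc y hy).le

theorem map_least_greedyBlocks {L : List (ℕ × ℕ)} {pool : List ℕ} (h : Feasible L pool) :
    (greedyBlocks L pool).map least = L.map Prod.fst := by
  induction L generalizing pool with
  | nil => rfl
  | cons p L ih =>
    obtain ⟨x, u⟩ := p
    rw [greedyBlocks, List.map_cons, List.map_cons, ih h.2.2.2,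
      least_insert fun z hz => h.2.2.1 z (List.mem_of_mem_take hz)]

theorem map_card_greedyBlocks {L : List (ℕ × ℕ)} {pool : List ℕ} (h : Feasible L pool)
    (hpool : pool.Nodup) : (greedyBlocks L pool).map Finset.card = L.map Prod.snd := by
  induction L generalizing pool with
  | nil => rfl
  | cons p L ih =>
    obtain ⟨x, u⟩ := p
    have h1 := h.1
    have h2 := h.2.1
    rw [greedyBlocks, List.map_cons, List.map_cons,
      ih h.2.2.2 (hpool.sublist (List.drop_sublist _ _)), Finset.card_insert_of_notMem,
      List.toFinset_card_of_nodup (hpool.sublist (List.take_sublist _ _)), List.length_take]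
    · congr 1
      simp only
      omega
    · rw [List.mem_toFinset]
      intro hx
      exact lt_irrefl _ (h.2.2.1 x (List.mem_of_mem_take hx))

theorem exists_mem_greedyBlocks_iff {L : List (ℕ × ℕ)} {pool : List ℕ} {z : ℕ} :
    (∃ S ∈ greedyBlocks L pool, z ∈ S) ↔
      z ∈ L.map Prod.fst ∨ z ∈ pool.take (L.map (fun p => p.2 - 1)).sum := by
  induction L generalizing pool with
  | nil => simp [greedyBlocks]
  | cons p L ih =>
    obtain ⟨x, u⟩ := p
    simp only [greedyBlocks, List.mem_cons, exists_eq_or_imp, ih, List.map_cons, List.sum_cons,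
      Finset.mem_insert, List.mem_toFinset, List.take_add, List.mem_append]
    tauto

theorem pairwise_greedyBlocks {L : List (ℕ × ℕ)} {pool : List ℕ} (h : Feasible L pool)
    (hpool : pool.Pairwise (· < ·)) (hL : (L.map Prod.fst).Pairwise (· < ·))
    (hdisj : ∀ z ∈ pool, z ∉ L.map Prod.fst) :
    (greedyBlocks L pool).Pairwise (fun S S' => Disjoint S S' ∧ S.min < S'.min ∧
      ∀ u ∈ S, ∀ v ∈ S', (∃ s ∈ S, s < u) → (∃ s ∈ S', s < v) → u < v) := by
  induction L generalizing pool with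
  | nil => exact List.Pairwise.nil
  | cons p L ih =>
    obtain ⟨x, u⟩ := p
    have hL' := List.pairwise_cons.1 hL
    have hsplit := hpool
    rw [← List.take_append_drop (u - 1) pool, List.pairwise_append] at hsplit
    rw [greedyBlocks, List.pairwise_cons]
    refine ⟨fun S' hS' => ?_, ih h.2.2.2 hsplit.2.1 hL'.2 fun z hz hz' =>
      hdisj z (List.mem_of_mem_drop hz) (List.mem_cons_of_mem _ hz')⟩
    obtain ⟨x', hx', c, hc, rfl⟩ := exists_of_mem_greedyBlocks h.2.2.2 hS'
    have hxx' := hL'.1 x' hx'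
    have htake : ∀ z ∈ pool.take (u - 1), x < z := fun z hz =>
      h.2.2.1 z (List.mem_of_mem_take hz)
    have hlt : ∀ y ∈ pool.take (u - 1), ∀ z ∈ c, y < z := fun y hy z hz =>
      hsplit.2.2 y hy z (hc z hz).1
    refine ⟨?_, ?_, ?_⟩
    · rw [Finset.disjoint_left]
      intro z hz hz'
      simp only [Finset.mem_insert, List.mem_toFinset] at hz hz'
      rcases hz with rfl | hz <;> rcases hz' with rfl | hz'
      · omega
      · have := (hc z hz').2
        omega
      · exact hdisj z (List.mem_of_mem_take hz) (List.mem_cons_of_mem _ hx')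
      · exact lt_irrefl _ (hlt z hz z hz')
    · rw [← coe_least (Finset.insert_nonempty _ _), ← coe_least (Finset.insert_nonempty _ _),
        least_insert htake, least_insert fun z hz => (hc z hz).2]
      exact_mod_cast hxx'
    · rintro y hy z hz ⟨s, hs, hsy⟩ ⟨t, ht, htz⟩
      simp only [Finset.mem_insert, List.mem_toFinset] at hy hz hs ht
      have hy' : y ∈ pool.take (u - 1) := by
        rcases hy with rfl | hy
        · rcases hs with rfl | hs
          · omega
          · have := htake s hs
            omega
        · exact hy
      have hz' : z ∈ c := by
        rcases hz with rfl | hz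
        · rcases ht with rfl | ht
          · omega
          · have := (hc t ht).2
            omega
        · exact hz
      exact hlt y hy' z hz'

/-- Otherwise z and the K entries removed before it would be K + 1 entries below x. -/
theorem lt_of_mem_drop {l : List ℕ} (hl : l.Pairwise (· < ·)) {x K : ℕ} (hx : x ∉ l)
    (hK : (l.filter (fun z => decide (z < x))).length ≤ K) {z : ℕ} (hz : z ∈ l.drop K) : x < z := by
  by_contra hcon
  have hzl := List.mem_of_mem_drop hz
  have hne : z ≠ x := by rintro rfl; exact hx hzl
  have hlen : K < l.length := by
    by_contra h
    rw [List.drop_eq_nil_of_le (by omega)] at hz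
    simp at hz
  rw [← List.take_append_drop K l, List.pairwise_append] at hl
  rw [← List.take_append_drop K l, List.filter_append, List.length_append,
    List.filter_eq_self.2 (fun y hy => by
      have := hl.2.2 y hy z hz
      simp only [decide_eq_true_eq]
      omega), List.length_take, min_eq_left hlen.le] at hK
  have : 0 < ((l.drop K).filter (fun z => decide (z < x))).length :=
    List.length_pos_of_mem (List.mem_filter.2 ⟨hz, by simp; omega⟩)
  omega

theorem sum_map_sub_one {l : List ℕ} {f : ℕ → ℕ} (hl : ∀ x ∈ l, f x ≠ 0) :
    (l.map (fun x => f x - 1)).sum + l.length = (l.map f).sum := by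
  induction l with
  | nil => rfl
  | cons x l ih =>
    have h := ih fun y hy => hl y (by simp [hy])
    have := hl x (by simp)
    simp only [List.map_cons, List.sum_cons, List.length_cons]
    omega

section GreedyCode

variable {n : ℕ} {f : ℕ → ℕ}

/-- The labels that are not in the support of a code. -/
def poolList (n : ℕ) (f : ℕ → ℕ) : List ℕ :=
  (Finset.Icc 1 n \ (supp n f).toFinset).sort (· ≤ ·)

theorem mem_poolList {z : ℕ} : z ∈ poolList n f ↔ (1 ≤ z ∧ z ≤ n) ∧ z ∉ supp n f := by
  simp [poolList]

theorem pairwise_poolList : (poolList n f).Pairwise (· < ·) :=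
  (Finset.sortedLT_sort _).pairwise

theorem length_poolList : (poolList n f).length + (supp n f).length = n := by
  have h1 : (supp n f).toFinset ⊆ Finset.Icc 1 n := by
    intro z hz
    rw [List.mem_toFinset, mem_supp] at hz
    rw [Finset.mem_Icc]
    exact hz.1
  have h2 := Finset.card_sdiff_add_card_eq_card h1
  rw [List.toFinset_card_of_nodup ((pairwise_supp n f).imp ne_of_lt), Nat.card_Icc] at h2
  rw [poolList, Finset.length_sort]
  omega

/-- When the label x is reached, the earlier labels l have used up the sum of f(y) - 1 over y in l.
The code inequality at x - 1 makes this at least x - 1 - #l. At most that many pool labels lie below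
x, since l itself occupies #l of the places 1, …, x - 1. So only pool labels above x are left. The
pool does not run out: its length n - #supp is the sum of f - 1 over the support. -/
theorem IsCode.feasible_aux (hf : IsCode n f) {l l' : List ℕ} (h : l ++ l' = supp n f) :
    Feasible (l'.map (fun x => (x, f x)))
      ((poolList n f).drop (l.map (fun x => f x - 1)).sum) := by
  induction l' generalizing l with
  | nil => exact trivial
  | cons x l' ih =>
    have hnz : ∀ y ∈ supp n f, f y ≠ 0 := fun y hy => (mem_supp.1 hy).2
    have hp := pairwise_supp n f
    have hlen := length_poolList (n := n) (f := f)
    have hsum := sum_map_sub_one hnz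
    have hvals := hf.sum_vals
    rw [vals] at hvals
    have hxs : x ∈ supp n f := by rw [← h]; simp
    have hx0 := hnz x hxs
    have hx1 := (mem_supp.1 hxs).1
    have hl0 : ∀ y ∈ l, f y ≠ 0 := fun y hy => hnz y (by rw [← h]; simp [hy])
    have hsuml := sum_map_sub_one hl0
    have hmemsupp : ∀ y, f y ≠ 0 → y ∈ l ++ x :: l' := fun y hy => by
      rw [h]; exact hf.mem_supp_iff.2 hy
    have hxpool : x ∉ poolList n f := fun hx => (mem_poolList.1 hx).2 hxs
    rw [← h] at hp hsum
    simp only [List.map_append, List.map_cons, List.sum_append, List.sum_cons] at hsum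
    rw [List.pairwise_append, List.pairwise_cons] at hp
    refine ⟨by omega, ?_, ?_, ?_⟩
    · rw [List.length_drop]
      rw [← h] at hvals hlen
      simp only [List.map_append, List.map_cons, List.sum_append, List.sum_cons] at hvals
      omega
    · intro z hz
      refine lt_of_mem_drop pairwise_poolList hxpool ?_ hz
      have hlnd : l.Nodup := hp.1.imp ne_of_lt
      have h1 : x ≤ (l.map f).sum + 1 := by
        have h2 := hf.le_sum (x - 1) (by omega)
        rw [Nat.sub_add_cancel hx1.1] at h2
        have h3 : ∑ v ∈ Finset.range x, f v ≤ (l.map f).sum := by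
          rw [← List.sum_toFinset _ hlnd]
          refine Finset.sum_le_sum_of_ne_zero fun y hy hy0 => ?_
          rw [Finset.mem_range] at hy
          rw [List.mem_toFinset]
          rcases List.mem_append.1 (hmemsupp y hy0) with h4 | h4
          · exact h4
          · rcases List.mem_cons.1 h4 with h5 | h5
            · omega
            · have := hp.2.1.1 y h5
              omega
        omega
      have h2 : ((poolList n f).filter (fun z => decide (z < x))).length + l.length + 1 ≤ x := by
        rw [← List.toFinset_card_of_nodup ((pairwise_poolList.imp ne_of_lt).filter _),
          ← List.toFinset_card_of_nodup hlnd, ← Finset.card_union_of_disjoint]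
        · have h3 : ((poolList n f).filter (fun z => decide (z < x))).toFinset ∪ l.toFinset ⊆
              Finset.Ico 1 x := by
            intro y hy
            simp only [Finset.mem_union, List.mem_toFinset, List.mem_filter, mem_poolList,
              decide_eq_true_eq] at hy
            rw [Finset.mem_Ico]
            rcases hy with hy | hy
            · omega
            · have h4 := hp.2.2 y hy x (by simp)
              have h5 : y ∈ supp n f := by rw [← h]; simp [hy]
              have := (mem_supp.1 h5).1
              omega
          have h4 := Finset.card_le_card h3
          rw [Nat.card_Ico] at h4
          omega
        · rw [Finset.disjoint_left]
          intro y hy hy'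
          simp only [List.mem_toFinset, List.mem_filter, mem_poolList] at hy hy'
          exact hy.1.2 (by rw [← h]; simp [hy'])
      omega
    · rw [List.drop_drop]
      have := ih (l := l ++ [x]) (by simp [h])
      simpa using this

theorem zip_supp_vals : (supp n f).zip (vals n f) = (supp n f).map (fun x => (x, f x)) := by
  rw [vals]
  induction supp n f with
  | nil => rfl
  | cons x l ih => simp [ih]

theorem IsCode.feasible (hf : IsCode n f) :
    Feasible ((supp n f).map (fun x => (x, f x))) (poolList n f) := by
  simpa using hf.feasible_aux (l := []) (l' := supp n f) rfl

theorem greedyLabels_eq_greedyBlocks : greedyLabels n (supp n f) (vals n f) =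
    greedyBlocks ((supp n f).map (fun x => (x, f x))) (poolList n f) := by
  rw [greedyLabels, zip_supp_vals]
  rfl

theorem IsCode.map_least_greedyLabels (hf : IsCode n f) :
    (greedyLabels n (supp n f) (vals n f)).map least = supp n f := by
  rw [greedyLabels_eq_greedyBlocks, map_least_greedyBlocks hf.feasible]
  simp [Function.comp_def]

theorem IsCode.map_card_greedyLabels (hf : IsCode n f) :
    (greedyLabels n (supp n f) (vals n f)).map Finset.card = vals n f := by
  rw [greedyLabels_eq_greedyBlocks,
    map_card_greedyBlocks hf.feasible (pairwise_poolList.imp ne_of_lt)]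
  simp [Function.comp_def, vals]

theorem IsCode.isNomincreasing_greedyLabels (hf : IsCode n f) :
    IsNomincreasing n (greedyLabels n (supp n f) (vals n f)) := by
  have hfst : ((supp n f).map (fun x => (x, f x))).map Prod.fst = supp n f := by
    simp [Function.comp_def]
  rw [greedyLabels_eq_greedyBlocks]
  refine ⟨fun S hS => ?_, fun z => ?_, ?_⟩
  · obtain ⟨x, -, c, -, rfl⟩ := exists_of_mem_greedyBlocks hf.feasible hS
    exact Finset.insert_nonempty _ _
  · have h1 := sum_map_sub_one (l := supp n f) (f := f) fun x hx => (mem_supp.1 hx).2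
    have h2 := hf.sum_vals
    have h3 := length_poolList (n := n) (f := f)
    rw [vals] at h2
    rw [exists_mem_greedyBlocks_iff, hfst, List.map_map, List.take_of_length_le, mem_poolList]
    · constructor
      · rintro (h | h)
        · exact (mem_supp.1 h).1
        · exact h.1
      · intro h
        by_cases hz : z ∈ supp n f
        · exact Or.inl hz
        · exact Or.inr ⟨h, hz⟩
    · simp only [Function.comp_def]
      omega
  · refine pairwise_greedyBlocks hf.feasible pairwise_poolList ?_ ?_
    · rw [hfst]
      exact pairwise_supp n f
    · intro z hz
      rw [hfst]
      exact (mem_poolList.1 hz).2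

/-- The greedy labelling only depends on the code, and may use more labels than necessary. -/
theorem IsCode.greedyLabels_of_le (hf : IsCode n f) {M : ℕ} (hM : n ≤ M) :
    greedyLabels M (supp n f) (vals n f) = greedyLabels n (supp n f) (vals n f) := by
  have := hf.isNomincreasing_greedyLabels.greedyLabels_eq hM
  rwa [hf.map_least_greedyLabels, hf.map_card_greedyLabels] at this

end GreedyCode

/-- The nomincreasing partitions of `{1, …, n}` with `ℓ` blocks of size at least `2` and `s` blocks
of size `1`, whose last block has size at least `2`. -/
def nomSet (n ℓ s : ℕ) : Set (List (Finset ℕ)) :=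
  {A | IsNomincreasing n A ∧ A.countP (fun S => decide (2 ≤ S.card)) = ℓ ∧
    A.countP (fun S => decide (S.card = 1)) = s ∧ ∃ S ∈ A.getLast?, 2 ≤ S.card}

theorem nomSet_conditions_iff {A : List (Finset ℕ)} {us : List ℕ} (h : us = A.map Finset.card)
    (ℓ s : ℕ) :
    (A.countP (fun S => decide (2 ≤ S.card)) = ℓ ∧
      A.countP (fun S => decide (S.card = 1)) = s ∧ ∃ S ∈ A.getLast?, 2 ≤ S.card) ↔
    (us.countP (fun u => decide (2 ≤ u)) = ℓ ∧ us.count 1 = s ∧ ∃ u ∈ us.getLast?, 2 ≤ u) := by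
  subst h
  rw [List.countP_map, List.count, List.countP_map, List.getLast?_map]
  simp only [Function.comp_def, beq_eq_decide, Option.mem_def, Option.map_eq_some_iff]
  constructor
  · rintro ⟨h1, h2, S, hS, h3⟩
    exact ⟨h1, h2, S.card, ⟨S, hS, rfl⟩, h3⟩
  · rintro ⟨h1, h2, u, ⟨S, hS, rfl⟩, h3⟩
    exact ⟨h1, h2, S, hS, h3⟩

/-- Nomincreasing partitions correspond to codes: the code gives the block sizes. -/
noncomputable def nomEquiv (n ℓ s : ℕ) : codeSet n ℓ s ≃ nomSet n ℓ s :=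
  Equiv.ofBijective
    (fun f => ⟨greedyLabels n (supp n f.1) (vals n f.1), f.2.1.isNomincreasing_greedyLabels,
      (nomSet_conditions_iff f.2.1.map_card_greedyLabels.symm ℓ s).2 f.2.2⟩) (by
    constructor
    · intro f g h
      have h := congrArg Subtype.val h
      simp only at h
      refine Subtype.ext (f.2.1.ext_of_supp_vals g.2.1 ?_ ?_)
      · rw [← f.2.1.map_least_greedyLabels, h, g.2.1.map_least_greedyLabels]
      · rw [← f.2.1.map_card_greedyLabels, h, g.2.1.map_card_greedyLabels]
    · rintro ⟨A, hA, h⟩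
      obtain ⟨f, hf, h1, h2⟩ := hA.exists_code
      refine ⟨⟨f, hf, (nomSet_conditions_iff h2 ℓ s).1 h⟩, Subtype.ext ?_⟩
      simp only
      rw [h1, h2, hA.greedyLabels_eq le_rfl])

/-! ## Skew tableaux -/

/-- The cells of the skew shape `[(i+1)^b, 1^(a-2)] / [i^(b-2)]`. -/
def IsCell (a i b r c : ℕ) : Prop :=
  (r + 2 < b ∧ c = i) ∨ ((r + 2 = b ∨ r + 1 = b) ∧ c ≤ i) ∨ (b ≤ r ∧ r + 2 < a + b ∧ c = 0)

/-! ### The cells of the skew shape. -/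

section Shape

variable {a i b : ℕ}

theorem mem_outerShape (ha : 2 ≤ a) {r c : ℕ} :
    (r, c) ∈ outerShape a i b ↔ (r < b ∧ c ≤ i) ∨ (b ≤ r ∧ r + 2 < a + b ∧ c = 0) := by
  rw [outerShape, YoungDiagram.mem_ofRowLens]
  simp only [List.length_append, List.length_replicate, List.getElem_append,
    List.getElem_replicate, exists_prop]
  split_ifs <;> omega

theorem mem_innerShape {r c : ℕ} : (r, c) ∈ innerShape i b ↔ r < b - 2 ∧ c < i := by
  rw [innerShape, YoungDiagram.mem_ofRowLens]
  simp

theorem mem_cells_iff (ha : 2 ≤ a) (hb : 2 ≤ b) {r c : ℕ} :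
    (r, c) ∈ (outerShape a i b).cells \ (innerShape i b).cells ↔ IsCell a i b r c := by
  rw [Finset.mem_sdiff, YoungDiagram.mem_cells, YoungDiagram.mem_cells, mem_outerShape ha,
    mem_innerShape, IsCell]
  omega

theorem card_cells (ha : 2 ≤ a) (hb : 2 ≤ b) :
    ((outerShape a i b).cells \ (innerShape i b).cells).card = a + b + 2 * i - 2 := by
  have h : (outerShape a i b).cells \ (innerShape i b).cells =
      (Finset.range (b - 2) ×ˢ {i} ∪ Finset.Ico (b - 2) b ×ˢ Finset.range (i + 1)) ∪
        Finset.Ico b (a + b - 2) ×ˢ {0} := by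
    ext ⟨r, c⟩
    rw [mem_cells_iff ha hb, IsCell]
    simp only [Finset.mem_union, Finset.mem_product, Finset.mem_range, Finset.mem_singleton,
      Finset.mem_Ico]
    omega
  rw [h, Finset.card_union_of_disjoint, Finset.card_union_of_disjoint]
  · simp only [Finset.card_product, Finset.card_range, Finset.card_singleton, Nat.card_Ico]
    rw [show b - (b - 2) = 2 by omega]
    omega
  · rw [Finset.disjoint_left]
    rintro ⟨r, c⟩
    simp only [Finset.mem_product, Finset.mem_range, Finset.mem_singleton, Finset.mem_Ico]
    omega
  · rw [Finset.disjoint_left]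
    rintro ⟨r, c⟩
    simp only [Finset.mem_union, Finset.mem_product, Finset.mem_range, Finset.mem_singleton,
      Finset.mem_Ico]
    omega

end Shape

/-! ### The blocks of a tableau and the injectivity of `nom`. -/

section Tableau

variable {a i b : ℕ} (ha : 2 ≤ a) (hb : 2 ≤ b) (T : Skyt a i b)

include ha hb

theorem entry_mem {r c : ℕ} (h : IsCell a i b r c) :
    1 ≤ T.entry r c ∧ T.entry r c ≤ a + b + 2 * i - 2 := by
  have := T.bijOn.mapsTo (Finset.mem_coe.2 ((mem_cells_iff ha hb).2 h))
  rwa [card_cells ha hb] at this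

theorem entry_inj {r c r' c' : ℕ} (h : IsCell a i b r c) (h' : IsCell a i b r' c')
    (heq : T.entry r c = T.entry r' c') : r = r' ∧ c = c' := by
  have := T.bijOn.injOn (Finset.mem_coe.2 ((mem_cells_iff ha hb).2 h))
    (Finset.mem_coe.2 ((mem_cells_iff ha hb).2 h')) heq
  exact Prod.mk.inj this

theorem exists_entry {z : ℕ} (h1 : 1 ≤ z) (h2 : z ≤ a + b + 2 * i - 2) :
    ∃ r c, IsCell a i b r c ∧ T.entry r c = z := by
  rw [← card_cells ha hb] at h2
  obtain ⟨⟨r, c⟩, h, h'⟩ := T.bijOn.surjOn ⟨h1, h2⟩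
  exact ⟨r, c, (mem_cells_iff ha hb).1 (Finset.mem_coe.1 h), h'⟩

theorem entry_lt_row {r c c' : ℕ} (hc : c < c') (h : IsCell a i b r c) (h' : IsCell a i b r c') :
    T.entry r c < T.entry r c' :=
  T.row_strict r c c' hc ((mem_cells_iff ha hb).2 h) ((mem_cells_iff ha hb).2 h')

theorem entry_lt_col {r r' c : ℕ} (hr : r < r') (h : IsCell a i b r c) (h' : IsCell a i b r' c) :
    T.entry r c < T.entry r' c :=
  T.col_strict r r' c hr ((mem_cells_iff ha hb).2 h) ((mem_cells_iff ha hb).2 h')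

theorem mem_topEntries {z : ℕ} :
    z ∈ topEntries T ↔ ∃ r c, IsCell a i b r c ∧ r + 1 < b ∧ T.entry r c = z := by
  rw [topEntries, Finset.mem_image]
  constructor
  · rintro ⟨⟨r, c⟩, h, rfl⟩
    rw [Finset.mem_filter, mem_cells_iff ha hb] at h
    exact ⟨r, c, h.1, by have := h.2; simp only at this; omega, rfl⟩
  · rintro ⟨r, c, h1, h2, rfl⟩
    refine ⟨(r, c), ?_, rfl⟩
    rw [Finset.mem_filter, mem_cells_iff ha hb]
    exact ⟨h1, by simp only; omega⟩

omit ha in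
theorem isCell_lower {c : ℕ} (hc : c ≤ i) : IsCell a i b (b - 1) c :=
  Or.inr (Or.inl ⟨by omega, hc⟩)

omit ha in
theorem isCell_upper {c : ℕ} (hc : c ≤ i) : IsCell a i b (b - 2) c :=
  Or.inr (Or.inl ⟨by omega, hc⟩)

theorem lower_mono {c c' : ℕ} (h : c ≤ c') (hc' : c' ≤ i) :
    T.entry (b - 1) c ≤ T.entry (b - 1) c' := by
  rcases h.lt_or_eq with h | rfl
  · exact (entry_lt_row ha hb T h (isCell_lower hb (by omega)) (isCell_lower hb hc')).le
  · exact le_rfl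

theorem upper_mono {c c' : ℕ} (h : c ≤ c') (hc' : c' ≤ i) :
    T.entry (b - 2) c ≤ T.entry (b - 2) c' := by
  rcases h.lt_or_eq with h | rfl
  · exact (entry_lt_row ha hb T h (isCell_upper hb (by omega)) (isCell_upper hb hc')).le
  · exact le_rfl

theorem upper_lt_lower {c : ℕ} (hc : c ≤ i) : T.entry (b - 2) c < T.entry (b - 1) c :=
  entry_lt_col ha hb T (by omega) (isCell_upper hb hc) (isCell_lower hb hc)

theorem upper_mem_topEntries {c : ℕ} (hc : c ≤ i) : T.entry (b - 2) c ∈ topEntries T :=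
  (mem_topEntries ha hb T).2 ⟨b - 2, c, isCell_upper hb hc, by omega, rfl⟩

theorem lower_notMem_topEntries {c : ℕ} (hc : c ≤ i) : T.entry (b - 1) c ∉ topEntries T := by
  rw [mem_topEntries ha hb]
  rintro ⟨r, c', h1, h2, h3⟩
  have := entry_inj ha hb T h1 (isCell_lower hb hc) h3
  omega

theorem topEntries_cases {z : ℕ} (hz : z ∈ topEntries T) :
    (∃ r, r + 2 < b ∧ T.entry r i = z) ∨ ∃ c ≤ i, T.entry (b - 2) c = z := by
  obtain ⟨r, c, h1, h2, rfl⟩ := (mem_topEntries ha hb T).1 hz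
  rcases h1 with ⟨h, rfl⟩ | ⟨h, h'⟩ | h
  · exact Or.inl ⟨r, h, rfl⟩
  · obtain rfl : r = b - 2 := by omega
    exact Or.inr ⟨c, h', rfl⟩
  · omega

theorem topEntries_mem_Icc {z : ℕ} (hz : z ∈ topEntries T) :
    1 ≤ z ∧ z ≤ a + b + 2 * i - 2 := by
  obtain ⟨r, c, h1, -, rfl⟩ := (mem_topEntries ha hb T).1 hz
  exact entry_mem ha hb T h1

/-- The cells below the top rows form a hook with corner (b - 1, 0), which carries its smallest
entry. This ensures that every label outside the top entries falls into some block. -/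
theorem lower_zero_le {z : ℕ} (h1 : 1 ≤ z) (h2 : z ≤ a + b + 2 * i - 2) (hz : z ∉ topEntries T) :
    T.entry (b - 1) 0 ≤ z := by
  obtain ⟨r, c, h, rfl⟩ := exists_entry ha hb T h1 h2
  have hr : b ≤ r + 1 := by
    by_contra hcon
    exact hz ((mem_topEntries ha hb T).2 ⟨r, c, h, by omega, rfl⟩)
  have h' := h
  rcases h' with h' | ⟨h', h''⟩ | ⟨h', h'', rfl⟩
  · omega
  · obtain rfl : r = b - 1 := by omega
    exact lower_mono ha hb T (by omega) h''
  · exact (entry_lt_col ha hb T (by omega) (isCell_lower hb (by omega)) h).le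

omit ha hb in
theorem mem_block {x z : ℕ} : z ∈ block T x ↔ z = x ∨ ((1 ≤ z ∧ z ≤ a + b + 2 * i - 2) ∧
    z ∉ topEntries T) ∧ ∃ c ≤ i, T.entry (b - 2) c = x ∧ T.entry (b - 1) c ≤ z ∧
      (c < i → z < T.entry (b - 1) (c + 1)) := by
  rw [block, Finset.mem_insert, Finset.mem_filter, Finset.mem_sdiff, Finset.mem_Icc]

theorem exists_of_mem_block {x z : ℕ} (hz : z ∈ block T x) (hne : z ≠ x) :
    z ∉ topEntries T ∧ x < z ∧ ∃ c ≤ i, T.entry (b - 2) c = x ∧ T.entry (b - 1) c ≤ z ∧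
      (c < i → z < T.entry (b - 1) (c + 1)) := by
  rcases (mem_block T).1 hz with h | ⟨h, c, hc, h1, h2⟩
  · exact absurd h hne
  · refine ⟨h.2, ?_, c, hc, h1, h2⟩
    have := upper_lt_lower ha hb T hc
    omega

theorem lower_mem_block {c : ℕ} (hc : c ≤ i) : T.entry (b - 1) c ∈ block T (T.entry (b - 2) c) := by
  refine (mem_block T).2 (Or.inr ⟨⟨entry_mem ha hb T (isCell_lower hb hc),
    lower_notMem_topEntries ha hb T hc⟩, c, hc, rfl, le_rfl, fun h => ?_⟩)
  exact entry_lt_row ha hb T (by omega) (isCell_lower hb hc) (isCell_lower hb (by omega))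

omit ha hb in
theorem self_mem_block (x : ℕ) : x ∈ block T x := Finset.mem_insert_self _ _

theorem le_of_mem_block {x z : ℕ} (hz : z ∈ block T x) : x ≤ z := by
  by_cases h : z = x
  · exact h.ge
  · exact (exists_of_mem_block ha hb T hz h).2.1.le

theorem least_block (x : ℕ) : least (block T x) = x :=
  least_eq (self_mem_block T x) fun _ => le_of_mem_block ha hb T

omit ha hb in
theorem pairwise_topList : (topList T).Pairwise (· < ·) :=
  (Finset.sortedLT_sort _).pairwise

omit ha hb in
theorem mem_topList {x : ℕ} : x ∈ topList T ↔ x ∈ topEntries T := by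
  simp [topList]

theorem map_least_nom : (nom T).map least = topList T := by
  rw [nom, List.map_map]
  conv_rhs => rw [← List.map_id (topList T)]
  exact List.map_congr_left fun x _ => least_block ha hb T x

/-- The non-minimal elements of the block of column c lie between the entries of the lower row in
columns c and c + 1, and these intervals are ordered like the columns. -/
theorem lt_of_mem_block_of_lt {x x' z z' : ℕ} (hx : x < x') (hz : z ∈ block T x)
    (hz' : z' ∈ block T x') (hne : z ≠ x) (hne' : z' ≠ x') : z < z' := by
  obtain ⟨-, -, c, hc, rfl, h1, h2⟩ := exists_of_mem_block ha hb T hz hne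
  obtain ⟨-, -, c', hc', rfl, h1', h2'⟩ := exists_of_mem_block ha hb T hz' hne'
  have hcc : c < c' := by
    by_contra hcon
    have := upper_mono ha hb T (show c' ≤ c by omega) hc
    omega
  have h3 := h2 (by omega)
  have h4 := lower_mono ha hb T (show c + 1 ≤ c' by omega) hc'
  omega

theorem isNomincreasing_nom : IsNomincreasing (a + b + 2 * i - 2) (nom T) := by
  refine ⟨?_, ?_, ?_⟩
  · intro S hS
    obtain ⟨x, -, rfl⟩ := List.mem_map.1 hS
    exact ⟨x, self_mem_block T x⟩
  · intro z
    constructor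
    · rintro ⟨S, hS, hz⟩
      obtain ⟨x, hx, rfl⟩ := List.mem_map.1 hS
      rcases (mem_block T).1 hz with rfl | h
      · exact topEntries_mem_Icc ha hb T ((mem_topList T).1 hx)
      · exact h.1.1
    · rintro ⟨h1, h2⟩
      by_cases hz : z ∈ topEntries T
      · exact ⟨block T z, List.mem_map_of_mem ((mem_topList T).2 hz), self_mem_block T z⟩
      · have h0 := lower_zero_le ha hb T h1 h2 hz
        -- The block of z belongs to the last column whose lower entry is at most z.
        set c := Nat.findGreatest (fun c => T.entry (b - 1) c ≤ z) i with hc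
        have hci : c ≤ i := Nat.findGreatest_le i
        have hcz : T.entry (b - 1) c ≤ z :=
          Nat.findGreatest_spec (P := fun c => T.entry (b - 1) c ≤ z) (Nat.zero_le i) h0
        refine ⟨block T (T.entry (b - 2) c), List.mem_map_of_mem ((mem_topList T).2
          (upper_mem_topEntries ha hb T hci)), (mem_block T).2 (Or.inr ⟨⟨⟨h1, h2⟩, hz⟩, c, hci, rfl,
          hcz, fun hlt => ?_⟩)⟩
        have := Nat.findGreatest_is_greatest (P := fun c => T.entry (b - 1) c ≤ z)
          (n := i) (k := c + 1) (by omega) (by omega)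
        omega
  · rw [nom, List.pairwise_map]
    refine (pairwise_topList T).imp_of_mem ?_
    intro x x' hx hx' hlt
    rw [mem_topList] at hx hx'
    have hord : ∀ u ∈ block T x, ∀ v ∈ block T x', (∃ s ∈ block T x, s < u) →
        (∃ s ∈ block T x', s < v) → u < v := by
      rintro u hu v hv ⟨s, hs, hsu⟩ ⟨t, ht, htv⟩
      have h1 := le_of_mem_block ha hb T hs
      have h2 := le_of_mem_block ha hb T ht
      exact lt_of_mem_block_of_lt ha hb T hlt hu hv (by omega) (by omega)
    refine ⟨?_, ?_, hord⟩
    · rw [Finset.disjoint_left]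
      intro z hz hz'
      by_cases h1 : z = x <;> by_cases h2 : z = x'
      · omega
      · exact (exists_of_mem_block ha hb T hz' h2).1 (h1 ▸ hx)
      · exact (exists_of_mem_block ha hb T hz h1).1 (h2 ▸ hx')
      · exact lt_irrefl _ (lt_of_mem_block_of_lt ha hb T hlt hz hz' h1 h2)
    · rw [← coe_least ⟨x, self_mem_block T x⟩, ← coe_least ⟨x', self_mem_block T x'⟩,
        least_block ha hb, least_block ha hb]
      exact_mod_cast hlt

/-- The block of an entry of row b - 2 contains the entry below it. For every other x the filter in
`block` is empty. -/
theorem two_le_card_block_iff {x : ℕ} : 2 ≤ (block T x).card ↔ ∃ c ≤ i, T.entry (b - 2) c = x := by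
  constructor
  · intro h
    obtain ⟨z, hz, hne⟩ := Finset.exists_mem_ne (Nat.lt_of_succ_le h) x
    obtain ⟨-, -, c, hc, h1, -⟩ := exists_of_mem_block ha hb T hz hne
    exact ⟨c, hc, h1⟩
  · rintro ⟨c, hc, rfl⟩
    rw [Nat.succ_le_iff, Finset.one_lt_card]
    have := upper_lt_lower ha hb T hc
    exact ⟨_, self_mem_block T _, _, lower_mem_block ha hb T hc, by omega⟩

theorem card_block_eq_one_iff {x : ℕ} (hx : x ∈ topEntries T) :
    (block T x).card = 1 ↔ ∃ r, r + 2 < b ∧ T.entry r i = x := by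
  have h1 : 0 < (block T x).card := Finset.card_pos.2 ⟨x, self_mem_block T x⟩
  have h2 := two_le_card_block_iff ha hb T (x := x)
  constructor
  · intro h
    rcases topEntries_cases ha hb T hx with h3 | h3
    · exact h3
    · have := h2.2 h3
      omega
  · rintro ⟨r, hr, rfl⟩
    by_contra hne
    obtain ⟨c, hc, h3⟩ := h2.1 (by omega)
    have := entry_inj ha hb T (isCell_upper hb hc) (Or.inl ⟨hr, rfl⟩) h3
    omega

omit ha hb in
theorem countP_sort (s : Finset ℕ) (p : ℕ → Prop) [DecidablePred p] :
    (s.sort (· ≤ ·)).countP (fun x => decide (p x)) = (s.filter p).card := by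
  rw [List.countP_eq_length_filter, ← List.toFinset_card_of_nodup ((s.sort_nodup _).filter _)]
  congr 1
  ext x
  simp

omit ha hb in
theorem getLast?_eq_of_pairwise_lt {l : List ℕ} (hl : l.Pairwise (· < ·)) {m : ℕ} (hm : m ∈ l)
    (hmax : ∀ x ∈ l, x ≤ m) : l.getLast? = some m := by
  have hne := List.ne_nil_of_mem hm
  rw [List.getLast?_eq_some_getLast hne]
  congr 1
  refine le_antisymm (hmax _ (List.getLast_mem hne)) ?_
  rw [← List.dropLast_append_getLast hne, List.pairwise_append] at hl
  rw [← List.dropLast_append_getLast hne] at hm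
  rcases List.mem_append.1 hm with h | h
  · exact (hl.2.2 m h _ (by simp)).le
  · exact (List.mem_singleton.1 h).le

theorem nom_mem_nomSet : nom T ∈ nomSet (a + b + 2 * i - 2) (i + 1) (b - 2) := by
  refine ⟨isNomincreasing_nom ha hb T, ?_, ?_, ?_⟩
  · rw [nom, List.countP_map]
    simp only [Function.comp_def]
    rw [topList, countP_sort]
    have : (topEntries T).filter (fun x => 2 ≤ (block T x).card) =
        (Finset.range (i + 1)).image (T.entry (b - 2)) := by
      ext x
      rw [Finset.mem_filter, Finset.mem_image, two_le_card_block_iff ha hb]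
      constructor
      · rintro ⟨-, c, hc, h⟩
        exact ⟨c, Finset.mem_range.2 (by omega), h⟩
      · rintro ⟨c, hc, rfl⟩
        have hc := Finset.mem_range.1 hc
        exact ⟨upper_mem_topEntries ha hb T (by omega), c, by omega, rfl⟩
    rw [this, Finset.card_image_of_injOn, Finset.card_range]
    intro c hc c' hc' h
    have hc := Finset.mem_range.1 hc
    have hc' := Finset.mem_range.1 hc'
    exact (entry_inj ha hb T (isCell_upper hb (by omega)) (isCell_upper hb (by omega)) h).2
  · rw [nom, List.countP_map]
    simp only [Function.comp_def]
    rw [topList, countP_sort]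
    have : (topEntries T).filter (fun x => (block T x).card = 1) =
        (Finset.range (b - 2)).image (fun r => T.entry r i) := by
      ext x
      rw [Finset.mem_filter, Finset.mem_image]
      constructor
      · rintro ⟨hx, h⟩
        obtain ⟨r, hr, h⟩ := (card_block_eq_one_iff ha hb T hx).1 h
        exact ⟨r, Finset.mem_range.2 (by omega), h⟩
      · rintro ⟨r, hr, rfl⟩
        have hr := Finset.mem_range.1 hr
        have hx : T.entry r i ∈ topEntries T := (mem_topEntries ha hb T).2
          ⟨r, i, Or.inl ⟨by omega, rfl⟩, by omega, rfl⟩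
        exact ⟨hx, (card_block_eq_one_iff ha hb T hx).2 ⟨r, by omega, rfl⟩⟩
    rw [this, Finset.card_image_of_injOn, Finset.card_range]
    intro r hr r' hr' h
    have hr := Finset.mem_range.1 hr
    have hr' := Finset.mem_range.1 hr'
    exact (entry_inj ha hb T (Or.inl ⟨by omega, rfl⟩) (Or.inl ⟨by omega, rfl⟩) h).1
  -- The cell (b - 2, i) is both the right end of its row and below all cells of the earlier rows,
  -- so its entry is the maximum of the top rows.
  · have hlast : (topList T).getLast? = some (T.entry (b - 2) i) := by
      refine getLast?_eq_of_pairwise_lt (pairwise_topList T)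
        ((mem_topList T).2 (upper_mem_topEntries ha hb T le_rfl)) fun x hx => ?_
      rcases topEntries_cases ha hb T ((mem_topList T).1 hx) with ⟨r, hr, rfl⟩ | ⟨c, hc, rfl⟩
      · exact (entry_lt_col ha hb T (by omega) (Or.inl ⟨hr, rfl⟩) (isCell_upper hb le_rfl)).le
      · exact upper_mono ha hb T hc le_rfl
    rw [nom, List.getLast?_map, hlast]
    exact ⟨_, rfl, (two_le_card_block_iff ha hb T).2 ⟨i, le_rfl, rfl⟩⟩

omit ha hb in
-- The shape consists of four increasing lines (upper column, two rows, leg), each of which can thus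
-- be recovered from its set of entries.
theorem eq_of_same_values {k : ℕ} {g h : ℕ → ℕ} (hg : ∀ c c', c < c' → c' < k → g c < g c')
    (hh : ∀ c c', c < c' → c' < k → h c < h c')
    (heq : ∀ z, (∃ c < k, g c = z) ↔ ∃ c < k, h c = z) {c : ℕ} (hc : c < k) : g c = h c := by
  have key : (List.range k).map g = (List.range k).map h := by
    refine eq_of_pairwise_lt ?_ ?_ ?_
    · rw [List.pairwise_map]
      exact List.pairwise_lt_range.imp_of_mem fun _ h2 h3 => hg _ _ h3 (List.mem_range.1 h2)
    · rw [List.pairwise_map]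
      exact List.pairwise_lt_range.imp_of_mem fun _ h2 h3 => hh _ _ h3 (List.mem_range.1 h2)
    · simpa using heq
  exact List.map_inj_left.1 key c (List.mem_range.2 hc)

/-- The minima of the blocks are the top entries, and the block sizes separate row b - 2 from the
column above it. The lower row consists of the smallest non-minimal elements of the large blocks,
and the leg contains the remaining labels. -/
theorem nom_injective : Function.Injective (fun T : Skyt a i b => nom T) := by
  intro T T' h
  simp only at h
  have htop : topList T = topList T' := by rw [← map_least_nom ha hb, h, map_least_nom ha hb]
  have hX : ∀ x, x ∈ topEntries T ↔ x ∈ topEntries T' := fun x => by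
    rw [← mem_topList, htop, mem_topList]
  have hblock : ∀ x ∈ topEntries T, block T x = block T' x := by
    intro x hx
    rw [nom, nom, ← htop] at h
    exact List.map_inj_left.1 h x ((mem_topList T).2 hx)
  have hup : ∀ c, c < i + 1 → T.entry (b - 2) c = T'.entry (b - 2) c := by
    intro c hc
    refine eq_of_same_values (k := i + 1) ?_ ?_ ?_ hc
    · exact fun c c' h1 h2 => entry_lt_row ha hb T h1 (isCell_upper hb (by omega))
        (isCell_upper hb (by omega))
    · exact fun c c' h1 h2 => entry_lt_row ha hb T' h1 (isCell_upper hb (by omega))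
        (isCell_upper hb (by omega))
    · intro z
      simp only [Nat.lt_succ_iff]
      rw [← two_le_card_block_iff ha hb, ← two_le_card_block_iff ha hb]
      by_cases hz : z ∈ topEntries T
      · rw [hblock z hz]
      · constructor
        · intro h2
          obtain ⟨c, hc, rfl⟩ := (two_le_card_block_iff ha hb T).1 h2
          exact absurd (upper_mem_topEntries ha hb T hc) hz
        · intro h2
          obtain ⟨c, hc, rfl⟩ := (two_le_card_block_iff ha hb T').1 h2
          exact absurd ((hX _).2 (upper_mem_topEntries ha hb T' hc)) hz
  have hcol : ∀ r, r < b - 2 → T.entry r i = T'.entry r i := by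
    intro r hr
    refine eq_of_same_values (k := b - 2) (g := fun r => T.entry r i) (h := fun r => T'.entry r i)
      ?_ ?_ ?_ hr
    · exact fun r r' h1 h2 => entry_lt_col ha hb T h1 (Or.inl ⟨by omega, rfl⟩)
        (Or.inl ⟨by omega, rfl⟩)
    · exact fun r r' h1 h2 => entry_lt_col ha hb T' h1 (Or.inl ⟨by omega, rfl⟩)
        (Or.inl ⟨by omega, rfl⟩)
    · intro z
      simp only [Nat.lt_sub_iff_add_lt]
      have hmem : ∀ T : Skyt a i b, (∃ r, r + 2 < b ∧ T.entry r i = z) → z ∈ topEntries T := by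
        rintro T ⟨r, hr, rfl⟩
        exact (mem_topEntries ha hb T).2 ⟨r, i, Or.inl ⟨hr, rfl⟩, by omega, rfl⟩
      constructor
      · intro h1
        have h2 := hmem T h1
        rw [← card_block_eq_one_iff ha hb T h2, hblock z h2] at h1
        exact (card_block_eq_one_iff ha hb T' ((hX z).1 h2)).1 h1
      · intro h1
        have h2 := hmem T' h1
        have h3 := (hX z).2 h2
        rw [← card_block_eq_one_iff ha hb T' h2, ← hblock z h3] at h1
        exact (card_block_eq_one_iff ha hb T h3).1 h1
  -- The lower entry of T in column c is a non-minimal element of a block shared with T', hence at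
  -- least the lower entry of T' there. Quantifying over both tableaux gives the reverse inequality
  -- by exchanging them.
  have hlowle : ∀ T T' : Skyt a i b,
      (∀ c, c < i + 1 → T.entry (b - 2) c = T'.entry (b - 2) c) →
      (∀ x ∈ topEntries T, block T x = block T' x) →
      (∀ x, x ∈ topEntries T ↔ x ∈ topEntries T') → ∀ c, c < i + 1 →
      T'.entry (b - 1) c ≤ T.entry (b - 1) c := by
    intro T T' hup hblock hX c hc
    have h1 := lower_mem_block ha hb T (show c ≤ i by omega)
    rw [hblock _ (upper_mem_topEntries ha hb T (by omega)), hup c hc] at h1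
    obtain ⟨-, -, c', hc', h2, h3, -⟩ := exists_of_mem_block ha hb T' h1 (by
      intro h2
      have h3 := upper_mem_topEntries ha hb T' (show c ≤ i by omega)
      rw [← h2, ← hX] at h3
      exact lower_notMem_topEntries ha hb T (by omega) h3)
    have := entry_inj ha hb T' (isCell_upper hb hc') (isCell_upper hb (by omega)) h2
    rwa [this.2] at h3
  have hlow : ∀ c, c < i + 1 → T.entry (b - 1) c = T'.entry (b - 1) c := fun c hc =>
    le_antisymm
      (hlowle T' T (fun c hc => (hup c hc).symm) (fun x hx => (hblock x ((hX x).2 hx)).symm)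
        (fun x => (hX x).symm) c hc)
      (hlowle T T' hup hblock hX c hc)
  have hlegmem : ∀ (T : Skyt a i b) (z : ℕ), (∃ k < a - 2, T.entry (b + k) 0 = z) ↔
      (1 ≤ z ∧ z ≤ a + b + 2 * i - 2) ∧ z ∉ topEntries T ∧
        ∀ c, c < i + 1 → T.entry (b - 1) c ≠ z := by
    intro T z
    constructor
    · rintro ⟨k, hk, rfl⟩
      have hcell : IsCell a i b (b + k) 0 := Or.inr (Or.inr ⟨by omega, by omega, rfl⟩)
      refine ⟨entry_mem ha hb T hcell, ?_, fun c hc heq => ?_⟩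
      · rw [mem_topEntries ha hb]
        rintro ⟨r, c, h1, h2, h3⟩
        have := entry_inj ha hb T h1 hcell h3
        omega
      · have := entry_inj ha hb T (isCell_lower hb (by omega)) hcell heq
        omega
    · rintro ⟨⟨h1, h2⟩, h3, h4⟩
      obtain ⟨r, c, h5, rfl⟩ := exists_entry ha hb T h1 h2
      have hr : b ≤ r + 1 := by
        by_contra hcon
        exact h3 ((mem_topEntries ha hb T).2 ⟨r, c, h5, by omega, rfl⟩)
      rcases h5 with h5 | ⟨h5, h6⟩ | ⟨h5, h6, rfl⟩
      · omega
      · obtain rfl : r = b - 1 := by omega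
        exact absurd rfl (h4 c (by omega))
      · exact ⟨r - b, by omega, by rw [Nat.add_sub_cancel' h5]⟩
  have hleg : ∀ k, k < a - 2 → T.entry (b + k) 0 = T'.entry (b + k) 0 := by
    intro k hk
    refine eq_of_same_values (k := a - 2) (g := fun k => T.entry (b + k) 0)
      (h := fun k => T'.entry (b + k) 0) ?_ ?_ ?_ hk
    · exact fun r r' h1 h2 => entry_lt_col ha hb T (by omega)
        (Or.inr (Or.inr ⟨by omega, by omega, rfl⟩)) (Or.inr (Or.inr ⟨by omega, by omega, rfl⟩))
    · exact fun r r' h1 h2 => entry_lt_col ha hb T' (by omega)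
        (Or.inr (Or.inr ⟨by omega, by omega, rfl⟩)) (Or.inr (Or.inr ⟨by omega, by omega, rfl⟩))
    · intro z
      rw [hlegmem, hlegmem, hX]
      have : (∀ c, c < i + 1 → T.entry (b - 1) c ≠ z) ↔ ∀ c, c < i + 1 → T'.entry (b - 1) c ≠ z :=
        forall₂_congr fun c hc => by rw [hlow c hc]
      rw [this]
  have hentry : T.entry = T'.entry := by
    funext r c
    by_cases hcell : IsCell a i b r c
    · rcases hcell with ⟨h1, rfl⟩ | ⟨h1 | h1, h2⟩ | ⟨h1, h2, rfl⟩
      · exact hcol r (by omega)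
      · obtain rfl : r = b - 2 := by omega
        exact hup c (by omega)
      · obtain rfl : r = b - 1 := by omega
        exact hlow c (by omega)
      · have := hleg (r - b) (by omega)
        rwa [Nat.add_sub_cancel' h1] at this
    · rw [← mem_cells_iff ha hb] at hcell
      rw [T.zero_outside r c hcell, T'.zero_outside r c hcell]
  cases T
  cases T'
  simp only at hentry
  subst hentry
  rfl

end Tableau

/-! ## The tableau of a nomincreasing partition -/

/-- The second smallest element of a finite set with at least two elements. -/
def second (S : Finset ℕ) : ℕ := least (S.erase (least S))

theorem erase_least_nonempty {S : Finset ℕ} (hS : 2 ≤ S.card) : (S.erase (least S)).Nonempty := by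
  rw [← Finset.card_pos, Finset.card_erase_of_mem (least_mem (Finset.card_pos.1 (by omega)))]
  omega

theorem second_mem {S : Finset ℕ} (hS : 2 ≤ S.card) : second S ∈ S :=
  Finset.mem_of_mem_erase (least_mem (erase_least_nonempty hS))

theorem least_lt_second {S : Finset ℕ} (hS : 2 ≤ S.card) : least S < second S :=
  lt_of_le_of_ne (least_le (second_mem hS))
    (Finset.ne_of_mem_erase (least_mem (erase_least_nonempty hS))).symm

theorem second_le {S : Finset ℕ} {z : ℕ} (hz : z ∈ S) (hne : z ≠ least S) : second S ≤ z :=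
  least_le (Finset.mem_erase.2 ⟨hne, hz⟩)

theorem pairwise_getD {α : Type*} {R : α → α → Prop} {l : List α} (hl : l.Pairwise R) {d : α}
    {c c' : ℕ} (h : c < c') (h' : c' < l.length) : R (l.getD c d) (l.getD c' d) := by
  rw [List.getD_eq_getElem _ _ (h.trans h'), List.getD_eq_getElem _ _ h']
  exact List.pairwise_iff_getElem.1 hl _ _ _ _ h

/-- The `c`th block of size at least `2`. -/
def largeBlock (A : List (Finset ℕ)) (c : ℕ) : Finset ℕ :=
  (A.filter (fun S => decide (2 ≤ S.card))).getD c ∅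

/-- The `r`th block of size `1`. -/
def smallBlock (A : List (Finset ℕ)) (r : ℕ) : Finset ℕ :=
  (A.filter (fun S => decide (S.card = 1))).getD r ∅

/-- The labels that are neither the smallest nor the second smallest label of their block. -/
def legLabels (n : ℕ) (A : List (Finset ℕ)) : Finset ℕ :=
  Finset.Icc 1 n \
    (A.map least ++ (A.filter (fun S => decide (2 ≤ S.card))).map second).toFinset

/-- The entries of the tableau of a nomincreasing partition. -/
def nomEntry (a i b : ℕ) (A : List (Finset ℕ)) (r c : ℕ) : ℕ :=
  if r + 2 < b then (if c = i then least (smallBlock A r) else 0)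
  else if r + 2 = b then (if c ≤ i then least (largeBlock A c) else 0)
  else if r + 1 = b then (if c ≤ i then second (largeBlock A c) else 0)
  else if r + 2 < a + b ∧ c = 0 then
    ((legLabels (a + b + 2 * i - 2) A).sort (· ≤ ·)).getD (r - b) 0
  else 0

section Construction

variable {a i b : ℕ} {A : List (Finset ℕ)} (ha : 2 ≤ a) (hb : 2 ≤ b)

theorem nomEntry_small {r : ℕ} (h : r + 2 < b) :
    nomEntry a i b A r i = least (smallBlock A r) := by
  simp [nomEntry, h]

include hb in
theorem nomEntry_upper {c : ℕ} (hc : c ≤ i) :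
    nomEntry a i b A (b - 2) c = least (largeBlock A c) := by
  rw [nomEntry, if_neg (by omega), if_pos (by omega), if_pos hc]

include hb in
theorem nomEntry_lower {c : ℕ} (hc : c ≤ i) :
    nomEntry a i b A (b - 1) c = second (largeBlock A c) := by
  rw [nomEntry, if_neg (by omega), if_neg (by omega), if_pos (by omega), if_pos hc]

theorem nomEntry_leg {r : ℕ} (h : b ≤ r) (h' : r + 2 < a + b) :
    nomEntry a i b A r 0 =
      ((legLabels (a + b + 2 * i - 2) A).sort (· ≤ ·)).getD (r - b) 0 := by
  rw [nomEntry, if_neg (by omega), if_neg (by omega), if_neg (by omega), if_pos ⟨h', rfl⟩]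

theorem nomEntry_eq_zero {r c : ℕ} (h : ¬ IsCell a i b r c) : nomEntry a i b A r c = 0 := by
  rw [IsCell] at h
  rw [nomEntry]
  split_ifs <;> first | rfl | omega

variable (hA : A ∈ nomSet (a + b + 2 * i - 2) (i + 1) (b - 2))

include hA

theorem length_large : (A.filter (fun S => decide (2 ≤ S.card))).length = i + 1 := by
  rw [← List.countP_eq_length_filter, hA.2.1]

theorem length_small : (A.filter (fun S => decide (S.card = 1))).length = b - 2 := by
  rw [← List.countP_eq_length_filter, hA.2.2.1]

theorem largeBlock_mem {c : ℕ} (hc : c ≤ i) :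
    largeBlock A c ∈ A ∧ 2 ≤ (largeBlock A c).card := by
  have hlen := length_large hA
  have : largeBlock A c ∈ A.filter (fun S => decide (2 ≤ S.card)) := by
    rw [largeBlock, List.getD_eq_getElem _ _ (by omega)]
    exact List.getElem_mem _
  simpa using this

theorem smallBlock_mem {r : ℕ} (hr : r + 2 < b) :
    smallBlock A r ∈ A ∧ (smallBlock A r).card = 1 := by
  have hlen := length_small hA
  have : smallBlock A r ∈ A.filter (fun S => decide (S.card = 1)) := by
    rw [smallBlock, List.getD_eq_getElem _ _ (by omega)]
    exact List.getElem_mem _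
  simpa using this

theorem exists_largeBlock {S : Finset ℕ} (hS : S ∈ A) (h : 2 ≤ S.card) :
    ∃ c ≤ i, largeBlock A c = S := by
  have hlen := length_large hA
  have : S ∈ A.filter (fun S => decide (2 ≤ S.card)) := by simp [hS, h]
  obtain ⟨c, hc, h'⟩ := List.mem_iff_getElem.1 this
  exact ⟨c, by omega, by rw [largeBlock, List.getD_eq_getElem _ _ hc, h']⟩

theorem exists_smallBlock {S : Finset ℕ} (hS : S ∈ A) (h : S.card = 1) :
    ∃ r, r + 2 < b ∧ smallBlock A r = S := by
  have hlen := length_small hA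
  have : S ∈ A.filter (fun S => decide (S.card = 1)) := by simp [hS, h]
  obtain ⟨r, hr, h'⟩ := List.mem_iff_getElem.1 this
  exact ⟨r, by omega, by rw [smallBlock, List.getD_eq_getElem _ _ hr, h']⟩

theorem least_mem_of_mem {S : Finset ℕ} (hS : S ∈ A) : least S ∈ S :=
  least_mem (hA.1.1 S hS)

theorem eq_of_least_eq {S S' : Finset ℕ} (hS : S ∈ A) (hS' : S' ∈ A) (h : least S = least S') :
    S = S' :=
  hA.1.eq_of_mem hS hS' (least_mem_of_mem hA hS) (h ▸ least_mem_of_mem hA hS')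

theorem least_ne_second {S S' : Finset ℕ} (hS : S ∈ A) (hS' : S' ∈ A) (h' : 2 ≤ S'.card) :
    least S ≠ second S' := by
  intro h
  have h1 := least_mem_of_mem hA hS
  rw [h] at h1
  have := hA.1.eq_of_mem hS hS' h1 (second_mem h')
  subst this
  exact (least_lt_second h').ne h

theorem least_smallBlock_lt {r r' : ℕ} (h : r < r') (hr' : r' + 2 < b) :
    least (smallBlock A r) < least (smallBlock A r') := by
  have hlen := length_small hA
  exact pairwise_getD ((List.pairwise_map.1 hA.1.pairwise_least).filter _) h (by omega)

theorem least_largeBlock_lt {c c' : ℕ} (h : c < c') (hc' : c' ≤ i) :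
    least (largeBlock A c) < least (largeBlock A c') := by
  have hlen := length_large hA
  exact pairwise_getD ((List.pairwise_map.1 hA.1.pairwise_least).filter _) h (by omega)

theorem lt_of_mem_largeBlock {c c' : ℕ} (h : c < c') (hc' : c' ≤ i) {u v : ℕ}
    (hu : u ∈ largeBlock A c) (hv : v ∈ largeBlock A c') (hu' : u ≠ least (largeBlock A c))
    (hv' : v ≠ least (largeBlock A c')) : u < v := by
  have hlen := length_large hA
  refine (pairwise_getD (d := ∅) (hA.1.2.2.filter _) h (by omega)).2.2 u hu v hv
    ⟨_, least_mem ⟨u, hu⟩, lt_of_le_of_ne (least_le hu) hu'.symm⟩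
    ⟨_, least_mem ⟨v, hv⟩, lt_of_le_of_ne (least_le hv) hv'.symm⟩

theorem second_largeBlock_lt {c c' : ℕ} (h : c < c') (hc' : c' ≤ i) :
    second (largeBlock A c) < second (largeBlock A c') := by
  have h1 := largeBlock_mem hA (show c ≤ i by omega)
  have h2 := largeBlock_mem hA hc'
  exact lt_of_mem_largeBlock hA h hc' (second_mem h1.2) (second_mem h2.2)
    (least_lt_second h1.2).ne' (least_lt_second h2.2).ne'

/-- The last block of A is large by hypothesis, hence is the last large block. This is the only use
of the condition on the last block, and it makes column i increase from the singletons to row b - 2.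
-/
theorem least_le_last {S : Finset ℕ} (hS : S ∈ A) : least S ≤ least (largeBlock A i) := by
  obtain ⟨hN, -, -, L, hL, hL2⟩ := id hA
  have hmax : ∀ S ∈ A, least S ≤ least L := by
    intro S hS
    have hne := List.ne_nil_of_mem hS
    rw [Option.mem_def, List.getLast?_eq_some_getLast hne, Option.some_inj] at hL
    have hp := List.pairwise_map.1 hN.pairwise_least
    rw [← List.dropLast_append_getLast hne, hL] at hS hp
    rw [List.pairwise_append] at hp
    rcases List.mem_append.1 hS with h | h
    · exact (hp.2.2 S h L (by simp)).le
    · rw [List.mem_singleton.1 h]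
  have hLA : L ∈ A := List.mem_of_getLast? hL
  obtain ⟨c, hc, rfl⟩ := exists_largeBlock hA hLA hL2
  rcases hc.lt_or_eq with h | rfl
  · have h1 := least_largeBlock_lt hA h le_rfl
    have h2 := hmax _ (largeBlock_mem hA (le_refl i)).1
    omega
  · exact hmax S hS

theorem least_smallBlock_lt_last {r : ℕ} (hr : r + 2 < b) :
    least (smallBlock A r) < least (largeBlock A i) := by
  have h1 := smallBlock_mem hA hr
  have h2 := largeBlock_mem hA (le_refl i)
  refine lt_of_le_of_ne (least_le_last hA h1.1) fun h => ?_
  rw [eq_of_least_eq hA h1.1 h2.1 h] at h1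
  omega

omit hA in
theorem mem_legLabels {n z : ℕ} : z ∈ legLabels n A ↔ (1 ≤ z ∧ z ≤ n) ∧
    (∀ S ∈ A, z ≠ least S) ∧ ∀ S ∈ A, 2 ≤ S.card → z ≠ second S := by
  simp only [legLabels, Finset.mem_sdiff, Finset.mem_Icc, List.mem_toFinset, List.mem_append,
    List.mem_map, List.mem_filter, decide_eq_true_eq, not_or, not_exists, not_and, and_imp, ne_eq,
    eq_comm (a := z)]

-- There are i + b - 1 minima and i + 1 second elements, so at least n - (2i + b) = a - 2 labels
-- remain. Only this bound is needed: it keeps the default value of `getD` in `nomEntry` from being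
-- reached in the leg.
include ha hb in
theorem card_legLabels : a - 2 ≤ (legLabels (a + b + 2 * i - 2) A).card := by
  have h1 := List.toFinset_card_le
    (A.map least ++ (A.filter (fun S => decide (2 ≤ S.card))).map second)
  have h2 := Finset.le_card_sdiff
    (A.map least ++ (A.filter (fun S => decide (2 ≤ S.card))).map second).toFinset
    (Finset.Icc 1 (a + b + 2 * i - 2))
  have h3 := countP_add_count_one (l := A.map Finset.card) (by
    intro u hu
    obtain ⟨S, hS, rfl⟩ := List.mem_map.1 hu
    exact Finset.card_pos.2 (hA.1.1 S hS))
  obtain ⟨h4, h5, -⟩ := (nomSet_conditions_iff rfl _ _).1 hA.2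
  rw [h4, h5, List.length_map] at h3
  rw [List.length_append, List.length_map, List.length_map, length_large hA] at h1
  rw [Nat.card_Icc] at h2
  rw [legLabels]
  omega

include ha hb in
theorem leg_mem {r : ℕ} (h : b ≤ r) (h' : r + 2 < a + b) :
    nomEntry a i b A r 0 ∈ legLabels (a + b + 2 * i - 2) A := by
  have := card_legLabels ha hb hA
  rw [nomEntry_leg h h', List.getD_eq_getElem _ _ (by rw [Finset.length_sort]; omega),
    ← Finset.mem_sort (· ≤ ·)]
  exact List.getElem_mem _

include ha hb in
theorem leg_lt {r r' : ℕ} (h : b ≤ r) (hr : r < r') (h' : r' + 2 < a + b) :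
    nomEntry a i b A r 0 < nomEntry a i b A r' 0 := by
  have := card_legLabels ha hb hA
  rw [nomEntry_leg h (by omega), nomEntry_leg (by omega) h']
  exact pairwise_getD (Finset.sortedLT_sort _).pairwise (by omega) (by rw [Finset.length_sort]; omega)

/-- By the nomincreasing condition, the second elements of the large blocks cut the non-minimal
labels into the blocks, which is the rule that defines `block`. -/
theorem second_zero_le_of_ne_least {z : ℕ} (hz : 1 ≤ z ∧ z ≤ a + b + 2 * i - 2)
    (hne : ∀ S ∈ A, z ≠ least S) :
    ∃ c ≤ i, z ∈ largeBlock A c ∧ second (largeBlock A c) ≤ z ∧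
      (c < i → z < second (largeBlock A (c + 1))) := by
  obtain ⟨S, hS, hzS⟩ := (hA.1.2.1 z).2 hz
  have hcard : 2 ≤ S.card := by
    rw [Nat.succ_le_iff, Finset.one_lt_card]
    exact ⟨z, hzS, _, least_mem_of_mem hA hS, hne S hS⟩
  obtain ⟨c, hc, rfl⟩ := exists_largeBlock hA hS hcard
  refine ⟨c, hc, hzS, second_le hzS (hne _ hS), fun hlt => ?_⟩
  have h1 := largeBlock_mem hA (show c + 1 ≤ i by omega)
  exact lt_of_mem_largeBlock hA (by omega) (by omega) hzS (second_mem h1.2) (hne _ hS)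
    (least_lt_second h1.2).ne'

include ha hb in
theorem second_zero_lt_leg {r : ℕ} (h : b ≤ r) (h' : r + 2 < a + b) :
    second (largeBlock A 0) < nomEntry a i b A r 0 := by
  obtain ⟨h1, h2, h3⟩ := mem_legLabels.1 (leg_mem ha hb hA h h')
  obtain ⟨c, hc, h4, h5, -⟩ := second_zero_le_of_ne_least hA h1 h2
  have h6 := largeBlock_mem hA hc
  have h7 := h3 _ h6.1 h6.2
  have h8 : second (largeBlock A 0) ≤ second (largeBlock A c) := by
    rcases Nat.eq_zero_or_pos c with rfl | hpos
    · exact le_rfl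
    · exact (second_largeBlock_lt hA hpos hc).le
  omega

include hb in
theorem nomEntry_row_strict {r c c' : ℕ} (hc : c < c') (h : IsCell a i b r c)
    (h' : IsCell a i b r c') : nomEntry a i b A r c < nomEntry a i b A r c' := by
  rw [IsCell] at h h'
  by_cases h1 : r + 2 = b
  · obtain rfl : r = b - 2 := by omega
    rw [nomEntry_upper hb (by omega), nomEntry_upper hb (by omega)]
    exact least_largeBlock_lt hA hc (by omega)
  · obtain rfl : r = b - 1 := by omega
    rw [nomEntry_lower hb (by omega), nomEntry_lower hb (by omega)]
    exact second_largeBlock_lt hA hc (by omega)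

include ha hb in
theorem nomEntry_col_strict {r r' c : ℕ} (hr : r < r') (h : IsCell a i b r c)
    (h' : IsCell a i b r' c) : nomEntry a i b A r c < nomEntry a i b A r' c := by
  have hls : ∀ c ≤ i, least (largeBlock A c) < second (largeBlock A c) := fun c hc =>
    least_lt_second (largeBlock_mem hA hc).2
  have hsl := fun r hr => least_smallBlock_lt_last hA (r := r) hr
  have hlast := hls i le_rfl
  rcases h with ⟨h, rfl⟩ | ⟨h | h, hc⟩ | ⟨h, h1, rfl⟩
  · have h2 := hsl r h
    rcases h' with ⟨h', -⟩ | ⟨h' | h', -⟩ | ⟨h', h1', rfl⟩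
    · rw [nomEntry_small h, nomEntry_small h']
      exact least_smallBlock_lt hA hr h'
    · obtain rfl : r' = b - 2 := by omega
      rw [nomEntry_small h, nomEntry_upper hb le_rfl]
      exact h2
    · obtain rfl : r' = b - 1 := by omega
      rw [nomEntry_small h, nomEntry_lower hb le_rfl]
      omega
    -- Only for i = 0 do the upper column and the leg share a column.
    · have := second_zero_lt_leg ha hb hA h' h1'
      rw [nomEntry_small h]
      omega
  · obtain rfl : r = b - 2 := by omega
    have h2 := hls c hc
    rw [nomEntry_upper hb hc]
    rcases h' with ⟨h', -⟩ | ⟨h' | h', -⟩ | ⟨h', h1', rfl⟩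
    · omega
    · omega
    · obtain rfl : r' = b - 1 := by omega
      rwa [nomEntry_lower hb hc]
    · have := second_zero_lt_leg ha hb hA h' h1'
      omega
  · obtain rfl : r = b - 1 := by omega
    rw [nomEntry_lower hb hc]
    rcases h' with ⟨h', -⟩ | ⟨h' | h', -⟩ | ⟨h', h1', rfl⟩
    · omega
    · omega
    · omega
    · exact second_zero_lt_leg ha hb hA h' h1'
  · exact leg_lt ha hb hA h hr (by rw [IsCell] at h'; omega)

include ha hb in
/-- The kind of an entry: smallest in a block of size `1`, smallest or second smallest in a larger
block, or none of these. -/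
theorem nomEntry_cases {r c : ℕ} (h : IsCell a i b r c) :
    (r + 2 < b ∧ c = i ∧ nomEntry a i b A r c = least (smallBlock A r)) ∨
    (r + 2 = b ∧ c ≤ i ∧ nomEntry a i b A r c = least (largeBlock A c)) ∨
    (r + 1 = b ∧ c ≤ i ∧ nomEntry a i b A r c = second (largeBlock A c)) ∨
    (b ≤ r ∧ c = 0 ∧ r + 2 < a + b ∧ nomEntry a i b A r c ∈ legLabels (a + b + 2 * i - 2) A) := by
  rcases h with ⟨h, rfl⟩ | ⟨h | h, hc⟩ | ⟨h, h1, rfl⟩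
  · exact Or.inl ⟨h, rfl, nomEntry_small h⟩
  · obtain rfl : r = b - 2 := by omega
    exact Or.inr (Or.inl ⟨h, hc, nomEntry_upper hb hc⟩)
  · obtain rfl : r = b - 1 := by omega
    exact Or.inr (Or.inr (Or.inl ⟨h, hc, nomEntry_lower hb hc⟩))
  · exact Or.inr (Or.inr (Or.inr ⟨h, rfl, h1, leg_mem ha hb hA h h1⟩))

include ha hb in
theorem nomEntry_mem {r c : ℕ} (h : IsCell a i b r c) :
    1 ≤ nomEntry a i b A r c ∧ nomEntry a i b A r c ≤ a + b + 2 * i - 2 := by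
  rcases nomEntry_cases ha hb hA h with ⟨h, -, he⟩ | ⟨-, h, he⟩ | ⟨-, h, he⟩ | ⟨-, -, -, he⟩
  · rw [he]
    have := (smallBlock_mem hA h).1
    exact (hA.1.2.1 _).1 ⟨_, this, least_mem_of_mem hA this⟩
  · rw [he]
    have := (largeBlock_mem hA h).1
    exact (hA.1.2.1 _).1 ⟨_, this, least_mem_of_mem hA this⟩
  · rw [he]
    have := largeBlock_mem hA h
    exact (hA.1.2.1 _).1 ⟨_, this.1, second_mem this.2⟩
  · exact (mem_legLabels.1 he).1

-- Cells of different rows carry labels of different kinds, except for two singletons or two leg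
-- cells, where monotonicity decides. The ordering r < r' eliminates half of the sixteen cases.
include ha hb in
theorem nomEntry_ne_of_lt {r c r' c' : ℕ} (h : IsCell a i b r c) (h' : IsCell a i b r' c')
    (hr : r < r') : nomEntry a i b A r c ≠ nomEntry a i b A r' c' := by
  intro heq
  rcases nomEntry_cases ha hb hA h with ⟨h1, h2, he⟩ | ⟨h1, h2, he⟩ | ⟨h1, h2, he⟩ |
      ⟨h1, rfl, h3, he⟩ <;>
    rcases nomEntry_cases ha hb hA h' with ⟨h1', h2', he'⟩ | ⟨h1', h2', he'⟩ | ⟨h1', h2', he'⟩ |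
      ⟨h1', rfl, h3', he'⟩
  · rw [he, he'] at heq
    have := least_smallBlock_lt hA hr h1'
    omega
  · rw [he, he'] at heq
    have h3 := smallBlock_mem hA h1
    have h4 := largeBlock_mem hA h2'
    rw [eq_of_least_eq hA h3.1 h4.1 heq] at h3
    omega
  · rw [he, he'] at heq
    have h4 := largeBlock_mem hA h2'
    exact least_ne_second hA (smallBlock_mem hA h1).1 h4.1 h4.2 heq
  · rw [← heq, he] at he'
    exact (mem_legLabels.1 he').2.1 _ (smallBlock_mem hA h1).1 rfl
  · omega
  · omega
  · rw [he, he'] at heq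
    have h4 := largeBlock_mem hA h2'
    exact least_ne_second hA (largeBlock_mem hA h2).1 h4.1 h4.2 heq
  · rw [← heq, he] at he'
    exact (mem_legLabels.1 he').2.1 _ (largeBlock_mem hA h2).1 rfl
  · omega
  · omega
  · omega
  · rw [← heq, he] at he'
    have h4 := largeBlock_mem hA h2
    exact (mem_legLabels.1 he').2.2 _ h4.1 h4.2 rfl
  · omega
  · omega
  · omega
  · have := leg_lt ha hb hA h1 hr h3'
    omega

include ha hb in
theorem nomEntry_inj {r c r' c' : ℕ} (h : IsCell a i b r c) (h' : IsCell a i b r' c')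
    (heq : nomEntry a i b A r c = nomEntry a i b A r' c') : r = r' ∧ c = c' := by
  rcases lt_trichotomy r r' with hr | rfl | hr
  · exact absurd heq (nomEntry_ne_of_lt ha hb hA h h' hr)
  · refine ⟨rfl, ?_⟩
    rcases lt_trichotomy c c' with hc | rfl | hc
    · have := nomEntry_row_strict hb hA hc h h'
      omega
    · rfl
    · have := nomEntry_row_strict hb hA hc h' h
      omega
  · exact absurd heq.symm (nomEntry_ne_of_lt ha hb hA h' h hr)

/-- The tableau of a nomincreasing partition. -/
def nomTableau : Skyt a i b where
  entry := nomEntry a i b A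
  row_strict _ _ _ hc h h' := nomEntry_row_strict hb hA hc ((mem_cells_iff ha hb).1 h)
    ((mem_cells_iff ha hb).1 h')
  col_strict _ _ _ hr h h' := nomEntry_col_strict ha hb hA hr ((mem_cells_iff ha hb).1 h)
    ((mem_cells_iff ha hb).1 h')
  bijOn := by
    rw [card_cells ha hb, ← Finset.coe_Icc]
    have hmaps : Set.MapsTo (fun x : ℕ × ℕ => nomEntry a i b A x.1 x.2)
        ((outerShape a i b).cells \ (innerShape i b).cells : Finset (ℕ × ℕ))
        (Finset.Icc 1 (a + b + 2 * i - 2) : Finset ℕ) := by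
      rintro ⟨r, c⟩ h
      exact Finset.mem_coe.2 (Finset.mem_Icc.2 (nomEntry_mem ha hb hA
        ((mem_cells_iff ha hb).1 (Finset.mem_coe.1 h))))
    have hinj : Set.InjOn (fun x : ℕ × ℕ => nomEntry a i b A x.1 x.2)
        ((outerShape a i b).cells \ (innerShape i b).cells : Finset (ℕ × ℕ)) := by
      rintro ⟨r, c⟩ h ⟨r', c'⟩ h' heq
      have := nomEntry_inj ha hb hA ((mem_cells_iff ha hb).1 (Finset.mem_coe.1 h))
        ((mem_cells_iff ha hb).1 (Finset.mem_coe.1 h')) heq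
      rw [this.1, this.2]
    refine ⟨hmaps, hinj, Finset.surjOn_of_injOn_of_card_le _ hmaps hinj ?_⟩
    rw [card_cells ha hb, Nat.card_Icc]
    omega
  zero_outside r c h := nomEntry_eq_zero fun h' => h ((mem_cells_iff ha hb).2 h')

theorem mem_topEntries_nomTableau {z : ℕ} :
    z ∈ topEntries (nomTableau ha hb hA) ↔ z ∈ A.map least := by
  rw [mem_topEntries ha hb, List.mem_map]
  constructor
  · rintro ⟨r, c, h1, h2, rfl⟩
    rcases nomEntry_cases ha hb hA h1 with ⟨h, -, he⟩ | ⟨-, h, he⟩ | ⟨h, -⟩ | ⟨h, -⟩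
    · exact ⟨_, (smallBlock_mem hA h).1, he.symm⟩
    · exact ⟨_, (largeBlock_mem hA h).1, he.symm⟩
    · omega
    · omega
  · rintro ⟨S, hS, rfl⟩
    have hpos : 0 < S.card := Finset.card_pos.2 (hA.1.1 S hS)
    by_cases h1 : S.card = 1
    · obtain ⟨r, hr, rfl⟩ := exists_smallBlock hA hS h1
      exact ⟨r, i, Or.inl ⟨hr, rfl⟩, by omega, nomEntry_small hr⟩
    · obtain ⟨c, hc, rfl⟩ := exists_largeBlock hA hS (by omega)
      exact ⟨b - 2, c, isCell_upper hb hc, by omega, nomEntry_upper hb hc⟩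

theorem topList_nomTableau : topList (nomTableau ha hb hA) = A.map least :=
  eq_of_pairwise_lt (pairwise_topList _) hA.1.pairwise_least fun z => by
    rw [mem_topList, mem_topEntries_nomTableau ha hb hA]

theorem block_nomTableau {S : Finset ℕ} (hS : S ∈ A) :
    block (nomTableau ha hb hA) (least S) = S := by
  have hentry : (nomTableau ha hb hA).entry = nomEntry a i b A := rfl
  ext z
  rw [mem_block, mem_topEntries_nomTableau ha hb hA, hentry]
  constructor
  · rintro (rfl | ⟨⟨h1, h2⟩, c, hc, h3, h4, h5⟩)
    · exact least_mem_of_mem hA hS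
    · rw [nomEntry_upper hb hc] at h3
      rw [nomEntry_lower hb hc] at h4
      rw [← eq_of_least_eq hA (largeBlock_mem hA hc).1 hS h3]
      obtain ⟨d, hd, h6, h7, h8⟩ := second_zero_le_of_ne_least hA h1
        fun S hS heq => h2 (heq ▸ List.mem_map_of_mem hS)
      have hmono : ∀ c c', c ≤ c' → c' ≤ i →
          second (largeBlock A c) ≤ second (largeBlock A c') := by
        intro c c' h h'
        rcases h.lt_or_eq with h | rfl
        · exact (second_largeBlock_lt hA h h').le
        · exact le_rfl
      -- The label z lies in the intervals attached to c and to d; as these intervals are disjoint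
      -- for different columns, c = d.
      rcases lt_trichotomy c d with h | rfl | h
      · have h9 := h5 (by omega)
        rw [nomEntry_lower hb (by omega)] at h9
        have := hmono (c + 1) d h hd
        omega
      · exact h6
      · have h9 := h8 (by omega)
        have := hmono (d + 1) c h hc
        omega
  · intro hz
    by_cases hne : z = least S
    · exact Or.inl hne
    · right
      have h1 := (hA.1.2.1 z).1 ⟨S, hS, hz⟩
      have h2 : ∀ S' ∈ A, z ≠ least S' := by
        rintro S' hS' rfl
        exact hne (by rw [hA.1.eq_of_mem hS hS' hz (least_mem_of_mem hA hS')])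
      refine ⟨⟨h1, fun h => ?_⟩, ?_⟩
      · obtain ⟨S', hS', h3⟩ := List.mem_map.1 h
        exact h2 S' hS' h3.symm
      · obtain ⟨c, hc, h3, h4, h5⟩ := second_zero_le_of_ne_least hA h1 h2
        refine ⟨c, hc, ?_, ?_, fun hlt => ?_⟩
        · rw [nomEntry_upper hb hc, hA.1.eq_of_mem hS (largeBlock_mem hA hc).1 hz h3]
        · rwa [nomEntry_lower hb hc]
        · rw [nomEntry_lower hb (by omega)]
          exact h5 hlt

theorem nom_nomTableau : nom (nomTableau ha hb hA) = A := by
  rw [nom, topList_nomTableau, List.map_map]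
  conv_rhs => rw [← List.map_id A]
  exact List.map_congr_left fun S hS => block_nomTableau ha hb hA hS

end Construction

/-- Tableaux correspond to nomincreasing partitions. -/
noncomputable def skytEquiv {a i b : ℕ} (ha : 2 ≤ a) (hb : 2 ≤ b) :
    Skyt a i b ≃ nomSet (a + b + 2 * i - 2) (i + 1) (b - 2) :=
  Equiv.ofBijective (fun T => ⟨nom T, nom_mem_nomSet ha hb T⟩)
    ⟨fun _ _ h => nom_injective ha hb (congrArg Subtype.val h),
      fun A => ⟨nomTableau ha hb A.2, Subtype.ext (nom_nomTableau ha hb A.2)⟩⟩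

/-! ## The main theorem -/

/-- The number of vertices is kept as a variable N because a + b + 2i is not literally of the form n
+ 2 when n is a truncated difference. -/
theorem exists_triEquiv {n N ℓ s : ℕ} (hn : 1 ≤ n) (hN : N = n + 2) :
    ∃ e : Tri N ℓ s ≃ codeSet n ℓ s, ∀ C,
      origins N C.1 = supp n (e C).1 ∧ fanSizes N C.1 = vals n (e C).1 := by
  subst hN
  exact ⟨triEquiv ℓ s hn, fun C => ⟨C.2.1.origins_eq hn, C.2.1.fanSizes_eq hn⟩⟩

theorem exists_skytEquiv {a i b : ℕ} (ha : 2 ≤ a) (hb : 2 ≤ b) :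
    ∃ e : Skyt a i b ≃ codeSet (a + b + 2 * i - 2) (i + 1) (b - 2), ∀ T,
      nom T = greedyLabels (a + b + 2 * i - 2) (supp (a + b + 2 * i - 2) (e T).1)
        (vals (a + b + 2 * i - 2) (e T).1) ∧
      topList T = supp (a + b + 2 * i - 2) (e T).1 ∧
      (nom T).map Finset.card = vals (a + b + 2 * i - 2) (e T).1 := by
  refine ⟨(skytEquiv ha hb).trans (nomEquiv _ _ _).symm, fun T => ?_⟩
  set f := ((skytEquiv ha hb).trans (nomEquiv _ _ _).symm) T with hf
  have h : nom T = greedyLabels (a + b + 2 * i - 2) (supp (a + b + 2 * i - 2) f.1)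
      (vals (a + b + 2 * i - 2) f.1) := by
    have : nomEquiv _ _ _ f = skytEquiv ha hb T := by simp [hf]
    exact (congrArg Subtype.val this).symm
  exact ⟨h, by rw [← map_least_nom ha hb, h, f.2.1.map_least_greedyLabels],
    by rw [h, f.2.1.map_card_greedyLabels]⟩

/-- The first label is 1, so the last descent is n + 1 - x_t. The additive hypothesis covers both
ways of writing it, n - x_t + x₁ for tableaux and N - x_t + x₁ - 2 for triangulations. -/
theorem IsCode.codeWord_eq_runWord {n d : ℕ} {f : ℕ → ℕ} (hf : IsCode n f) (hn : 1 ≤ n)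
    (hd : d + (supp n f).getLastD 0 = n + (supp n f).headD 0) :
    codeWord n f = runWord (vals n f) (diffs (supp n f) ++ [d]) := by
  obtain ⟨l, hl⟩ := hf.supp_eq_cons hn
  have h1 : (supp n f).headD 0 = 1 := by rw [hl]; rfl
  rw [codeWord, ← show d = n + 1 - (supp n f).getLastD 0 by omega]

/-- A partition is the greedy labelling of a code if and only if it is that of the same code. -/
theorem IsCode.greedyLabels_eq_iff {n : ℕ} {f g : ℕ → ℕ} (hf : IsCode n f) (hg : IsCode n g) :
    greedyLabels n (supp n f) (vals n f) = greedyLabels n (supp n g) (vals n g) ↔ f = g := by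
  constructor
  · intro h
    refine hf.ext_of_supp_vals hg ?_ ?_
    · rw [← hf.map_least_greedyLabels, h, hg.map_least_greedyLabels]
    · rw [← hf.map_card_greedyLabels, h, hg.map_card_greedyLabels]
  · rintro rfl
    rfl

theorem IsCode.vals_diffs_eq_iff {n : ℕ} {f g : ℕ → ℕ} (hf : IsCode n f) (hg : IsCode n g)
    (hn : 1 ≤ n) :
    (vals n f = vals n g ∧ diffs (supp n f) = diffs (supp n g)) ↔ g = f := by
  constructor
  · rintro ⟨h1, h2⟩
    exact (hf.ext_of_diffs_vals hg hn h2 h1).symm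
  · rintro rfl
    exact ⟨rfl, rfl⟩

end SkytDyckTri

open SkytDyckTri
theorem mainTheorem1 (a i b : ℕ) (ha : 2 ≤ a) (hb : 2 ≤ b) :
    Set.BijOn (fun T : Skyt a i b => nom T) Set.univ
      {A | IsNomincreasing (a + b + 2 * i - 2) A ∧
        A.countP (fun S => decide (2 ≤ S.card)) = i + 1 ∧
        A.countP (fun S => decide (S.card = 1)) = b - 2 ∧
        ∃ S ∈ A.getLast?, 2 ≤ S.card} ∧
    ∃ (SD : Skyt a i b ≃ Dyck (a + b + 2 * i - 2) (i + 1) (b - 2))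
      (DT : Dyck (a + b + 2 * i - 2) (i + 1) (b - 2) ≃ Tri (a + b + 2 * i) (i + 1) (b - 2))
      (ST : Skyt a i b ≃ Tri (a + b + 2 * i) (i + 1) (b - 2)),
      (∀ T, (SD T).1.toList = wordOfSkyt T) ∧
      (∀ P T, SD.symm P = T ↔
        nom T = greedyLabels (a + b + 2 * i - 2) (peakLabels P.1) (ascents P.1)) ∧
      (∀ P C, DT P = C ↔
        fanSizes (a + b + 2 * i) C.1 = ascents P.1 ∧
        fanDelta (a + b + 2 * i) C.1 = (descents P.1).dropLast) ∧
      (∀ C, (DT.symm C).1.toList = wordOfTri (a + b + 2 * i) C.1) ∧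
      (∀ T C, ST T = C ↔
        fanSizes (a + b + 2 * i) C.1 = (nom T).map Finset.card ∧
        fanDelta (a + b + 2 * i) C.1 = diffs (topList T)) ∧
      (∀ C T, ST.symm C = T ↔
        nom T = greedyLabels (a + b + 2 * i) (origins (a + b + 2 * i) C.1)
          (fanSizes (a + b + 2 * i) C.1)) ∧
      (∀ T, ST T = DT (SD T)) := by
  refine ⟨⟨fun T _ => nom_mem_nomSet ha hb T, (nom_injective ha hb).injOn, fun A hA =>
    ⟨nomTableau ha hb hA, trivial, nom_nomTableau ha hb hA⟩⟩, ?_⟩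
  obtain ⟨eS, hS⟩ := exists_skytEquiv (i := i) ha hb
  have hn : 1 ≤ a + b + 2 * i - 2 := by omega
  have hN : a + b + 2 * i = a + b + 2 * i - 2 + 2 := by omega
  obtain ⟨eT, hT⟩ := exists_triEquiv (ℓ := i + 1) (s := b - 2) hn hN
  set eD := dyckEquiv (n := a + b + 2 * i - 2) (i + 1) (b - 2) hn (by omega)
  have hD : ∀ P, P.1.toList = codeWord (a + b + 2 * i - 2) (eD P).1 :=
    toList_eq_codeWord hn (by omega)
  -- All three maps pass through codes, so each of the characterisations below becomes an equality
  -- between the codes of the two objects.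
  refine ⟨eS.trans eD.symm, eD.trans eT.symm, eS.trans eT.symm, ?_, ?_, ?_, ?_, ?_, ?_, ?_⟩
  · intro T
    rw [hD, Equiv.trans_apply, Equiv.apply_symm_apply, wordOfSkyt, (hS T).2.1, (hS T).2.2]
    refine (eS T).2.1.codeWord_eq_runWord hn ?_
    have := (eS T).2.1.getLastD_supp_le
    omega
  · intro P T
    rw [(eD P).2.1.peakLabels_eq hn (hD P), (eD P).2.1.ascents_eq hn (hD P), (hS T).1,
      (eS T).2.1.greedyLabels_eq_iff (eD P).2.1, Equiv.symm_apply_eq, Equiv.trans_apply,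
      Equiv.eq_symm_apply, Subtype.ext_iff, eq_comm]
  · intro P C
    rw [(eD P).2.1.descents_eq hn (hD P), (eD P).2.1.ascents_eq hn (hD P), fanDelta, (hT C).1,
      (hT C).2, List.dropLast_concat, (eT C).2.1.vals_diffs_eq_iff (eD P).2.1 hn,
      Equiv.trans_apply, Equiv.symm_apply_eq, Subtype.ext_iff]
  · intro C
    rw [hD, Equiv.symm_trans_apply, Equiv.symm_symm, Equiv.apply_symm_apply, wordOfTri, fanDelta,
      (hT C).1, (hT C).2]
    refine (eT C).2.1.codeWord_eq_runWord hn ?_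
    have h1 := (eT C).2.1.getLastD_supp_le
    omega
  · intro T C
    rw [(hS T).2.1, (hS T).2.2, fanDelta, (hT C).1, (hT C).2,
      (eT C).2.1.vals_diffs_eq_iff (eS T).2.1 hn, Equiv.trans_apply, Equiv.symm_apply_eq,
      Subtype.ext_iff]
  · intro C T
    -- The labels n + 1 and n + 2 = N are never used, so [N] may be replaced by [n].
    rw [(hT C).1, (hT C).2, (eT C).2.1.greedyLabels_of_le (by omega), (hS T).1,
      (eS T).2.1.greedyLabels_eq_iff (eT C).2.1, Equiv.symm_apply_eq, Equiv.trans_apply,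
      Equiv.eq_symm_apply, Subtype.ext_iff, eq_comm]
  · intro T
    simp
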